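/- Let $d\in\mathbb N$, $T>0$, $\mathbb T^d=\mathbb R^d/\mathbb Z^d$, and let $u:\mathbb T^d\times(0,T)\to\mathbb R^d$ be a weak solution of the incompressible Euler equations, i.e. $u\in L^2(\mathbb T^d\times(0,T))$ and, with test functions smooth on $\mathbb T^d\times(0,T)$ and compactly supported in time, $$\int_0^T\!\!\int_{\mathbb T^d}u\cdot\nabla\varphi\,dx\,dt=0\quad\text{for all scalar test functions }\varphi,$$ $$\int_0^T\!\!\int_{\mathbb T^d}\big(u\cdot\partial_t w+(u\otimes u):\nabla w\big)\,dx\,dt=0\quad\text{for all vector test fields } w \text{ with }\operatorname{div}w=0.$$ Assume that $u\in L^3(0,T;B^\sigma_{3,\infty}(\mathbb T^d))$ for some $\sigma>\tfrac13$. Here $\|f\|_{B^\sigma_{3,\infty}}=\|f*\psi\|_{L^3(\mathbb T^d)}+\sup_{k\ge1}2^{k\sigma}\|f*\phi_k\|_{L^3(\mathbb T^d)}$ (summed over the components of a vector field), where $\hat\phi_k(\xi)=\phi(2^{-k}\xi)$, $\hat\psi=1-\sum_{k\ge1}\hat\phi_k$, and $\phi\in C^\infty(\mathbb R^d;\mathbb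 R)$ is any function supported in $\{\frac12<|\xi|<2\}$ with $\sum_{k\in\mathbb Z}\phi(2^{-k}\xi)=1$ for all $\xi\neq0$; the convolutions are over $\mathbb R^d$, $f$ being regarded as a periodic function. Then $u$ has a pressure, i.e. there exists $q\in L^{3/2}(\mathbb T^d\times(0,T))$ with $\int_{\mathbb T^d}q(x,t)\,dx=0$ for a.e. $t$ and $-\Delta q=\operatorname{div}\operatorname{div}(u\otimes u)$ in the sense of distributions on $\mathbb T^d\times(0,T)$; and for every such $q$ the Duchon--Robert distribution $$D:=-\partial_t\frac{|u|^2}{2}-\operatorname{div}\Big(\Big(\frac{|u|^2}{2}+q\Big)u\Big)$$ vanishes identically, i.e. for every scalar test function $\varphi$, $$\langle D,\varphi\rangle=\int_0^T\!\!\int_{\mathbb T^d}\Big(\frac{|u|^2}{2}\,\partial_t\varphi+\Big(\frac{|u|^2}{2}+q\Big)u\cdot\nabla\varphi\Big)dx\,dt=0.$$ -/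

import Mathlib

open MeasureTheory Set
open scoped ENNReal ContDiff FourierTransform Convolution

noncomputable section

namespace EulerTorus

/-- The Euclidean space `ℝᵈ`. Functions on the torus `𝕋ᵈ = ℝᵈ / ℤᵈ` are the `ℤᵈ`-periodic
functions on it. -/
abbrev E (d : ℕ) : Type := EuclideanSpace ℝ (Fin d)

/-- `f` is `ℤᵈ`-periodic, i.e. a function on the torus. -/
def IsPeriodic {d : ℕ} {F : Type*} (f : E d → F) : Prop :=
  ∀ i : Fin d, Function.Periodic f (EuclideanSpace.single i (1 : ℝ))

/-- The fundamental cell `[0,1)ᵈ` of the torus. -/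
def cell (d : ℕ) : Set (E d) := {x | ∀ i, x i ∈ Ico (0 : ℝ) 1}

/-- Lebesgue measure of the torus. -/
def torusMeasure (d : ℕ) : Measure (E d) := volume.restrict (cell d)

/-- Lebesgue measure of `(0,T) × 𝕋ᵈ`. -/
def spaceTime (d : ℕ) (T : ℝ) : Measure (ℝ × E d) :=
  (volume.restrict (Ioo 0 T)).prod (torusMeasure d)

/-! ### Littlewood--Paley decomposition and Besov norms -/

/-- A dyadic partition of unity: `ϕ` is smooth, its closed support lies in `1/2 < |ξ| < 2`, and
`∑_{k ∈ ℤ} ϕ(2⁻ᵏ ξ) = 1` for `ξ ≠ 0`. -/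
structure LittlewoodPaley (d : ℕ) where
  /-- the profile `ϕ` on the frequency side -/
  ϕ : E d → ℝ
  smooth : ContDiff ℝ ∞ ϕ
  tsupport_subset : tsupport ϕ ⊆ {ξ | 1 / 2 < ‖ξ‖ ∧ ‖ξ‖ < 2}
  hasSum : ∀ ξ : E d, ξ ≠ 0 → HasSum (fun k : ℤ ↦ ϕ ((2 : ℝ) ^ (-k) • ξ)) 1

/-- Dyadic partitions of unity exist. -/
theorem littlewoodPaley_nonempty (d : ℕ) : Nonempty (LittlewoodPaley d) := by
  let χ : ContDiffBump (0 : E d) := ⟨5 / 4, 3 / 2, by norm_num, by norm_num⟩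
  have hone : ∀ x : E d, ‖x‖ ≤ 5 / 4 → χ x = 1 := fun x hx ↦
    χ.one_of_mem_closedBall (by simpa [Metric.mem_closedBall, χ] using hx)
  have hzero : ∀ x : E d, 3 / 2 ≤ ‖x‖ → χ x = 0 := fun x hx ↦
    χ.zero_of_le_dist (by simpa [χ] using hx)
  refine ⟨⟨fun ξ ↦ χ ξ - χ ((2 : ℝ) • ξ), ?_, ?_, ?_⟩⟩
  · exact χ.contDiff.sub (χ.contDiff.comp (contDiff_const_smul (2 : ℝ)))
  · have hcl : IsClosed {ξ : E d | 5 / 8 ≤ ‖ξ‖ ∧ ‖ξ‖ ≤ 3 / 2} :=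
      (isClosed_le continuous_const continuous_norm).inter
        (isClosed_le continuous_norm continuous_const)
    refine (closure_minimal ?_ hcl).trans ?_
    · intro ξ hξ
      have h2 : ‖(2 : ℝ) • ξ‖ = 2 * ‖ξ‖ := by simp [norm_smul]
      by_contra hc
      apply hξ
      rw [mem_ofPred_eq, not_and_or, not_le, not_le] at hc
      rcases hc with hc | hc
      · simp only [hone ξ (by linarith), hone ((2 : ℝ) • ξ) (by rw [h2]; linarith), sub_self]
      · simp only [hzero ξ (by linarith), hzero ((2 : ℝ) • ξ) (by rw [h2]; linarith), sub_self]
    · rintro ξ ⟨h1, h2⟩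
      exact ⟨by linarith, by linarith⟩
  · intro ξ hξ
    have hpos : 0 < ‖ξ‖ := norm_pos_iff.2 hξ
    -- the telescoping function
    let F : ℤ → ℝ := fun k ↦ χ ((2 : ℝ) ^ (-k) • ξ)
    have hn : ∀ k : ℤ, ‖(2 : ℝ) ^ (-k) • ξ‖ = (2 : ℝ) ^ (-k) * ‖ξ‖ := by
      intro k
      rw [norm_smul, Real.norm_of_nonneg (by positivity)]
    obtain ⟨m, hm⟩ := pow_unbounded_of_one_lt (‖ξ‖ + 2 / ‖ξ‖) (one_lt_two : (1 : ℝ) < 2)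
    have hm1 : ‖ξ‖ ≤ 2 ^ m := by
      have : 0 < 2 / ‖ξ‖ := by positivity
      linarith
    have hm2 : 2 ≤ 2 ^ m * ‖ξ‖ := by
      have h : 2 / ‖ξ‖ ≤ 2 ^ m := by linarith
      rwa [div_le_iff₀ hpos] at h
    have hF1 : ∀ k : ℤ, (m : ℤ) ≤ k → F k = 1 := by
      intro k hk
      apply hone
      rw [hn]
      have h1 : (2 : ℝ) ^ (-k) ≤ (2 : ℝ) ^ (-(m : ℤ)) :=
        zpow_le_zpow_right₀ (by norm_num) (by omega)
      have h2 : (2 : ℝ) ^ (-(m : ℤ)) * ‖ξ‖ ≤ 1 := by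
        rw [zpow_neg, zpow_natCast, inv_mul_le_iff₀ (by positivity)]
        linarith
      have h3 := mul_le_mul_of_nonneg_right h1 hpos.le
      linarith
    have hF0 : ∀ k : ℤ, k ≤ -(m : ℤ) → F k = 0 := by
      intro k hk
      apply hzero
      rw [hn]
      have h1 : (2 : ℝ) ^ (m : ℤ) ≤ (2 : ℝ) ^ (-k) :=
        zpow_le_zpow_right₀ (by norm_num) (by omega)
      rw [zpow_natCast] at h1
      have h3 := mul_le_mul_of_nonneg_right h1 hpos.le
      linarith
    have hterm : ∀ k : ℤ, χ ((2 : ℝ) ^ (-k) • ξ) - χ ((2 : ℝ) • (2 : ℝ) ^ (-k) • ξ)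
        = F k - F (k - 1) := by
      intro k
      have h : (2 : ℝ) * (2 : ℝ) ^ (-k) = (2 : ℝ) ^ (-(k - 1)) := by
        rw [← zpow_one_add₀ (by norm_num)]
        congr 1
        ring
      simp only [F, smul_smul, h]
    simp only [hterm]
    have hsupp : ∀ k ∉ Finset.Ioc (-(m : ℤ)) m, F k - F (k - 1) = 0 := by
      intro k hk
      rw [Finset.mem_Ioc, not_and_or, not_lt, not_le] at hk
      rcases hk with hk | hk
      · rw [hF0 k hk, hF0 (k - 1) (by omega), sub_self]
      · rw [hF1 k (by omega), hF1 (k - 1) (by omega), sub_self]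
    have htel : ∀ n : ℕ, ∑ k ∈ Finset.Ioc (-(m : ℤ)) (-(m : ℤ) + n), (F k - F (k - 1))
        = F (-(m : ℤ) + n) - F (-(m : ℤ)) := by
      intro n
      induction n with
      | zero => simp
      | succ n ih =>
        have hI : Finset.Ioc (-(m : ℤ)) (-(m : ℤ) + (n + 1 : ℕ))
            = insert (-(m : ℤ) + (n + 1 : ℕ)) (Finset.Ioc (-(m : ℤ)) (-(m : ℤ) + n)) := by
          ext j
          simp only [Finset.mem_Ioc, Finset.mem_insert]
          push_cast
          omega
        rw [hI, Finset.sum_insert (by simp), ih]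
        have h : -(m : ℤ) + (n + 1 : ℕ) - 1 = -(m : ℤ) + n := by push_cast; ring
        rw [h]
        ring
    have hfin : HasSum (fun k : ℤ ↦ F k - F (k - 1)) _ := hasSum_sum_of_ne_finset_zero hsupp
    have hval := htel (2 * m)
    have hend : -(m : ℤ) + (2 * m : ℕ) = m := by push_cast; ring
    rw [hend, hF1 m le_rfl, hF0 (-(m : ℤ)) le_rfl, sub_zero] at hval
    rwa [hval] at hfin

namespace LittlewoodPaley

variable {d : ℕ} (Φ : LittlewoodPaley d)

/-- The kernel `ϕ_k`, whose Fourier transform is `ϕ(2⁻ᵏ ξ)`. -/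
def block (k : ℕ) : E d → ℂ :=
  𝓕⁻ (fun ξ : E d ↦ ((Φ.ϕ ((2 : ℝ) ^ (-(k : ℤ)) • ξ) : ℝ) : ℂ))

/-- The kernel `ψ`, whose Fourier transform is `1 - ∑_{k ≥ 1} ϕ(2⁻ᵏ ξ)`. -/
def low : E d → ℂ :=
  𝓕⁻ (fun ξ : E d ↦ ((1 - ∑' k : ℕ, Φ.ϕ ((2 : ℝ) ^ (-((k : ℤ) + 1)) • ξ) : ℝ) : ℂ))

/-- The Besov norm `‖f * ψ‖_{Lᵖ} + sup_{k ≥ 1} 2^{kα} ‖f * ϕ_k‖_{Lᵖ}` of a (periodic, locally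
integrable) function `f`; the convolutions are over `ℝᵈ` and the `Lᵖ` norms over the torus. -/
def besovNorm (α : ℝ) (p : ℝ≥0∞) (f : E d → ℂ) : ℝ≥0∞ :=
  eLpNorm (f ⋆[ContinuousLinearMap.mul ℂ ℂ, volume] Φ.low) p (torusMeasure d) +
    ⨆ k : ℕ, ⨆ _ : 1 ≤ k, ENNReal.ofReal ((2 : ℝ) ^ ((k : ℝ) * α)) *
      eLpNorm (f ⋆[ContinuousLinearMap.mul ℂ ℂ, volume] Φ.block k) p (torusMeasure d)

/-- The Besov norm of a vector field: the sum of the norms of its components. -/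
def besovNormVec (α : ℝ) (p : ℝ≥0∞) (f : E d → E d) : ℝ≥0∞ :=
  ∑ i : Fin d, Φ.besovNorm α p (fun x ↦ ((f x i : ℝ) : ℂ))

/-- `u ∈ Lᵖ(0,T; B^α_{p,∞}(𝕋ᵈ))`, for a velocity field `u t x`. -/
def MemLpBesov (T α : ℝ) (p : ℝ≥0∞) (u : ℝ → E d → E d) : Prop :=
  AEStronglyMeasurable (Function.uncurry u) (spaceTime d T) ∧
    eLpNorm (fun t ↦ Φ.besovNormVec α p (u t)) p (volume.restrict (Ioo 0 T)) < ⊤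

end LittlewoodPaley

/-! ### Weak solutions, pressure, Duchon--Robert distribution -/

/-- `φ` is a (scalar or vector-valued) test function on `(0,T) × 𝕋ᵈ`: smooth, periodic in space,
and vanishing for times outside a compact subinterval of `(0,T)`. -/
structure IsTest {d : ℕ} {F : Type*} [NormedAddCommGroup F] [NormedSpace ℝ F] (T : ℝ)
    (φ : ℝ → E d → F) : Prop where
  smooth : ContDiff ℝ ∞ (Function.uncurry φ)
  periodic : ∀ t, IsPeriodic (φ t)
  compact_time : ∃ a b : ℝ, 0 < a ∧ b < T ∧ ∀ t ∉ Icc a b, ∀ x, φ t x = 0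

/-- The divergence of a differentiable vector field. -/
def divergence {d : ℕ} (w : E d → E d) (x : E d) : ℝ :=
  ∑ i : Fin d, (fderiv ℝ w x (EuclideanSpace.single i (1 : ℝ))) i

/-- Weak solutions of the incompressible Euler equations on `(0,T) × 𝕋ᵈ`, with the momentum
equation tested against divergence-free fields. Here `⟪u, (∇w) u⟫ = (u ⊗ u) : ∇w`. -/
structure IsWeakEuler {d : ℕ} (T : ℝ) (u : ℝ → E d → E d) : Prop where
  periodic : ∀ t ∈ Ioo 0 T, IsPeriodic (u t)
  memLp : MemLp (Function.uncurry u) 2 (spaceTime d T)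
  divFree : ∀ φ : ℝ → E d → ℝ, IsTest T φ →
    ∫ z, fderiv ℝ (φ z.1) z.2 (u z.1 z.2) ∂(spaceTime d T) = 0
  momentum : ∀ w : ℝ → E d → E d, IsTest T w → (∀ t x, divergence (w t) x = 0) →
    ∫ z, (inner ℝ (u z.1 z.2) (deriv (fun s ↦ w s z.2) z.1) +
      inner ℝ (u z.1 z.2) (fderiv ℝ (w z.1) z.2 (u z.1 z.2))) ∂(spaceTime d T) = 0

/-- `q ∈ L^{3/2}` is the pressure of `u`: the zero-mean distributional solution of
`-Δ q = div div (u ⊗ u)` on the torus. The integrand on the right is `(u ⊗ u) : ∇²φ`. -/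
structure IsPressure {d : ℕ} (T : ℝ) (u : ℝ → E d → E d) (q : ℝ → E d → ℝ) : Prop where
  periodic : ∀ t ∈ Ioo 0 T, IsPeriodic (q t)
  memLp : MemLp (Function.uncurry q) (3 / 2) (spaceTime d T)
  zeroMean : ∀ᵐ t ∂(volume.restrict (Ioo 0 T)), ∫ x, q t x ∂(torusMeasure d) = 0
  poisson : ∀ φ : ℝ → E d → ℝ, IsTest T φ →
    -∫ z, q z.1 z.2 * Laplacian.laplacian (φ z.1) z.2 ∂(spaceTime d T) =
      ∫ z, fderiv ℝ (fderiv ℝ (φ z.1)) z.2 (u z.1 z.2) (u z.1 z.2) ∂(spaceTime d T)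

/-- The Duchon--Robert distribution `D = -∂ₜ(|u|²/2) - div((|u|²/2 + q) u)`, evaluated at a test
function `φ`. -/
def duchonRobert {d : ℕ} (T : ℝ) (u : ℝ → E d → E d) (q : ℝ → E d → ℝ) (φ : ℝ → E d → ℝ) : ℝ :=
  ∫ z, (‖u z.1 z.2‖ ^ 2 / 2 * deriv (fun s ↦ φ s z.2) z.1 +
    (‖u z.1 z.2‖ ^ 2 / 2 + q z.1 z.2) * fderiv ℝ (φ z.1) z.2 (u z.1 z.2)) ∂(spaceTime d T)

end EulerTorus

end

open EulerTorus

/-!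
The argument is that of Constantin, E and Titi, in the form given by Duchon and Robert, and
localized in space and time.

*Regularity.* For `1/3 < θ < min σ 1`, the Littlewood--Paley characterization of Besov spaces gives
`‖U (· - y) - U‖₃ ≤ C ‖y‖ ^ θ` for a Borel representative `U` of `u` on space-time
(`LittlewoodPaley.exists_increment_le`, `exists_holderField`). All functions are periodic in space
and are extended by zero in time; `cylinder d` is the measure of `ℝ × 𝕋ᵈ`, and its invariance under
translations of periodic functions is encoded in `PeriodSystem`.

*Pressure.* The products `uᵢuⱼ` lie in `L^{3/2}` and have increments of order `θ` there. Hence the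
dyadic blocks of `∂ᵢ∂ⱼΔ⁻¹(uᵢuⱼ)`, which are convolutions with dilated kernels of mean zero, decay
like `2^{-kθ}` in `L^{3/2}` and can be summed; no singular integral theory is needed
(`LittlewoodPaley.exists_riesz`, `exists_isPressure`). Conversely, for any pressure `q`, subtracting
the gradient `∇Δ⁻¹∂ⱼψ` from `ψ eⱼ` makes the test field divergence-free, and the Poisson equation
for `q` evaluates the difference. So each component of the momentum equation holds with pressure
and arbitrary test functions (`exists_eulerSystem`). The inverse Laplacian on test functions of mean
zero is the convolution with the kernel of `LittlewoodPaley.exists_green`.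

*Energy balance.* Let `ρ` be an even mollifier in space-time. Testing the momentum equation with
`φ (ρ * uⱼ) + ρ * (φ uⱼ)`, the time derivatives of `ρ` cancel because `ρ` is even, and no regularity
in time is required. The convection terms that contain derivatives of `ρ` are, up to terms with
derivatives of `φ`, equal to `½ ∑ᵢ ∫ ∂ᵢρ(ζ) ∫ φ(z) |δU|² δUᵢ dz dζ` with `δU = U(z - ζ) - U(z)`
(`EulerSystem.energy_balance`). With spatial scale `2⁻ᵏ` and a time scale so small that increments
in time are harmless, this flux is of order `2ᵏ 2^{-3kθ}` and vanishes as `k → ∞` since `θ > 1/3`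
(`HolderField.exists_mollifiers`). The remaining terms converge, because translations are continuous
in `Lᵖ`, and their limit is `2 ⟨D, φ⟩` (`EulerSystem.integral_energy_eq_zero`).
-/


namespace EulerTorus

/-! ### Periodic functions and their translates -/

/-- A measure `μ` on an additive group together with a retraction `wrap` onto a fundamental domain,
such that translating and wrapping preserves `μ`. It is used for the torus, with `wrap` the
fractional part, and for space-time. -/
structure PeriodSystem {G : Type*} [AddCommGroup G] [MeasurableSpace G] (μ : Measure G) where
  /-- the retraction onto the fundamental domain -/
  wrap : G → G
  measurePreserving : ∀ ζ, MeasurePreserving (fun z ↦ wrap (z + ζ)) μ μ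

namespace PeriodSystem

variable {G : Type*} [AddCommGroup G] [MeasurableSpace G] {μ : Measure G} (S : PeriodSystem μ)
  {F F' F'' : Type*}

/-- Functions invariant under the periods of the system. -/
def Inv (f : G → F) : Prop := ∀ z ζ, f (S.wrap z + ζ) = f (z + ζ)

variable {S}

lemma Inv.shift {f : G → F} (hf : S.Inv f) (ζ : G) : S.Inv (fun z ↦ f (z + ζ)) := fun z ξ ↦ by
  simpa only [add_assoc] using hf z (ξ + ζ)

lemma Inv.shift_sub {f : G → F} (hf : S.Inv f) (ζ : G) : S.Inv (fun z ↦ f (z - ζ)) := by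
  simpa only [sub_eq_add_neg] using hf.shift (-ζ)

lemma Inv.wrap {f : G → F} (hf : S.Inv f) (z : G) : f (S.wrap z) = f z := by
  simpa using hf z 0

lemma Inv.comp {f : G → F} (hf : S.Inv f) (g : F → F') : S.Inv (fun z ↦ g (f z)) := fun z ζ ↦ by
  simp only [hf z ζ]

lemma Inv.comp₂ {f : G → F} {f' : G → F'} (hf : S.Inv f) (hf' : S.Inv f') (g : F → F' → F'') :
    S.Inv (fun z ↦ g (f z) (f' z)) := fun z ζ ↦ by
  simp only [hf z ζ, hf' z ζ]

lemma Inv.mul [Mul F] {f g : G → F} (hf : S.Inv f) (hg : S.Inv g) :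
    S.Inv (fun z ↦ f z * g z) := hf.comp₂ hg _

lemma Inv.sub [Sub F] {f g : G → F} (hf : S.Inv f) (hg : S.Inv g) :
    S.Inv (fun z ↦ f z - g z) := hf.comp₂ hg _

variable [NormedAddCommGroup F]

lemma Inv.aestronglyMeasurable_add {f : G → F} (hf : S.Inv f) (hm : AEStronglyMeasurable f μ)
    (ζ : G) : AEStronglyMeasurable (fun z ↦ f (z + ζ)) μ := by
  simpa only [Function.comp_def, hf.wrap] using
    hm.comp_measurePreserving (S.measurePreserving ζ)

lemma Inv.eLpNorm_add {f : G → F} (hf : S.Inv f) (hm : AEStronglyMeasurable f μ) (p : ℝ≥0∞)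
    (ζ : G) : eLpNorm (fun z ↦ f (z + ζ)) p μ = eLpNorm f p μ := by
  rw [← eLpNorm_comp_measurePreserving (p := p) hm (S.measurePreserving ζ)]
  simp only [Function.comp_def, hf.wrap]

lemma Inv.eLpNorm_sub {f : G → F} (hf : S.Inv f) (hm : AEStronglyMeasurable f μ) (p : ℝ≥0∞)
    (ζ : G) : eLpNorm (fun z ↦ f (z - ζ)) p μ = eLpNorm f p μ := by
  simpa only [sub_eq_add_neg] using hf.eLpNorm_add hm p (-ζ)

lemma Inv.memLp_add {f : G → F} (hf : S.Inv f) {p : ℝ≥0∞} (h : MemLp f p μ) (ζ : G) :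
    MemLp (fun z ↦ f (z + ζ)) p μ :=
  ⟨hf.aestronglyMeasurable_add h.1 ζ, by rw [hf.eLpNorm_add h.1]; exact h.2⟩

lemma Inv.memLp_sub {f : G → F} (hf : S.Inv f) {p : ℝ≥0∞} (h : MemLp f p μ) (ζ : G) :
    MemLp (fun z ↦ f (z - ζ)) p μ := by
  simpa only [sub_eq_add_neg] using hf.memLp_add h (-ζ)

lemma Inv.integrable_add {f : G → F} (hf : S.Inv f) (h : Integrable f μ) (ζ : G) :
    Integrable (fun z ↦ f (z + ζ)) μ :=
  memLp_one_iff_integrable.1 (hf.memLp_add (memLp_one_iff_integrable.2 h) ζ)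

lemma Inv.integral_add [NormedSpace ℝ F] {f : G → F} (hf : S.Inv f)
    (hm : AEStronglyMeasurable f μ) (ζ : G) : ∫ z, f (z + ζ) ∂μ = ∫ z, f z ∂μ := by
  have h := S.measurePreserving ζ
  have hm' := hm
  rw [← h.map_eq] at hm'
  have := integral_map h.measurable.aemeasurable hm'
  rw [h.map_eq] at this
  rw [this]
  simp only [hf.wrap]

lemma Inv.integral_sub [NormedSpace ℝ F] {f : G → F} (hf : S.Inv f)
    (hm : AEStronglyMeasurable f μ) (ζ : G) : ∫ z, f (z - ζ) ∂μ = ∫ z, f z ∂μ := by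
  simpa only [sub_eq_add_neg] using hf.integral_add hm (-ζ)

end PeriodSystem

/-! ### Minkowski's inequality for averages -/

/-- Jensen's inequality for the measure with density `K`. -/
lemma rpow_lintegral_mul_le {β : Type*} [MeasurableSpace β] {ν : Measure β} {p : ℝ} (hp : 1 ≤ p)
    {K f : β → ℝ≥0∞} (hK : AEMeasurable K ν) (hf : AEMeasurable f ν) :
    (∫⁻ y, K y * f y ∂ν) ^ p ≤ (∫⁻ y, K y ∂ν) ^ (p - 1) * ∫⁻ y, K y * f y ^ p ∂ν := by
  rcases hp.eq_or_lt with rfl | hp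
  · simp
  have hpq : p.HolderConjugate (p.conjExponent) := .conjExponent hp
  set q := p.conjExponent with hq
  have hq0 : 0 < q := hpq.symm.pos
  have hp0 : 0 < p := hpq.pos
  have h := ENNReal.lintegral_mul_le_Lp_mul_Lq ν hpq (f := fun y ↦ K y ^ (1 / p) * f y)
    (g := fun y ↦ K y ^ (1 / q)) ((hK.pow_const _).mul hf) (hK.pow_const _)
  have h1 : ∀ y, ((fun y ↦ K y ^ (1 / p) * f y) * fun y ↦ K y ^ (1 / q)) y = K y * f y := by
    intro y
    simp only [Pi.mul_apply]
    rw [mul_right_comm, ← ENNReal.rpow_add_of_nonneg _ _ (by positivity) (by positivity)]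
    have : 1 / p + 1 / q = 1 := by simpa using hpq.inv_add_inv_eq_one
    rw [this, ENNReal.rpow_one]
  have h2 : ∀ y, (K y ^ (1 / p) * f y) ^ p = K y * f y ^ p := by
    intro y
    rw [ENNReal.mul_rpow_of_nonneg _ _ hp0.le, ← ENNReal.rpow_mul, one_div_mul_cancel hp0.ne',
      ENNReal.rpow_one]
  have h3 : ∀ y, (K y ^ (1 / q)) ^ q = K y := by
    intro y
    rw [← ENNReal.rpow_mul, one_div_mul_cancel hq0.ne', ENNReal.rpow_one]
  simp only [h1, h2, h3] at h
  calc (∫⁻ y, K y * f y ∂ν) ^ p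
      ≤ ((∫⁻ y, K y * f y ^ p ∂ν) ^ (1 / p) * (∫⁻ y, K y ∂ν) ^ (1 / q)) ^ p := by gcongr
    _ = (∫⁻ y, K y * f y ^ p ∂ν) * (∫⁻ y, K y ∂ν) ^ (p - 1) := by
        rw [ENNReal.mul_rpow_of_nonneg _ _ hp0.le, ← ENNReal.rpow_mul, ← ENNReal.rpow_mul,
          one_div_mul_cancel hp0.ne', ENNReal.rpow_one]
        congr 2
        rw [hq, Real.conjExponent]; field_simp
    _ = _ := mul_comm _ _

/-- A substitute for Minkowski's integral inequality that follows from Jensen's inequality. It is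
weaker in general, but equally strong when `N` is constant, and `N` need not be measurable. -/
lemma eLpNorm_integral_smul_le {α β : Type*} [MeasurableSpace α] [MeasurableSpace β]
    {μ : Measure α} {ν : Measure β} [SFinite μ] [SFinite ν] {𝕜 V : Type*} [RCLike 𝕜]
    [NormedAddCommGroup V] [NormedSpace ℝ V] [NormedSpace 𝕜 V] {p : ℝ≥0∞} (hp : 1 ≤ p) (hp' : p ≠ ⊤)
    {K : β → 𝕜} {F : α → β → V} (hK : AEStronglyMeasurable K ν)
    (hF : Measurable fun z : α × β ↦ ‖F z.1 z.2‖ₑ) {N : β → ℝ≥0∞}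
    (hN : ∀ y, eLpNorm (fun x ↦ F x y) p μ ≤ N y) :
    eLpNorm (fun x ↦ ∫ y, K y • F x y ∂ν) p μ ≤
      ((∫⁻ y, ‖K y‖ₑ ∂ν) ^ (p.toReal - 1) * ∫⁻ y, ‖K y‖ₑ * N y ^ p.toReal ∂ν) ^ (1 / p.toReal) := by
  have hp0 : p ≠ 0 := (one_pos.trans_le hp).ne'
  have hp1 : 1 ≤ p.toReal := by
    simpa using ENNReal.toReal_mono hp' hp
  have hpp : 0 < p.toReal := by linarith
  rw [eLpNorm_eq_lintegral_rpow_enorm_toReal hp0 hp']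
  gcongr
  calc ∫⁻ x, ‖∫ y, K y • F x y ∂ν‖ₑ ^ p.toReal ∂μ
      ≤ ∫⁻ x, (∫⁻ y, ‖K y‖ₑ ∂ν) ^ (p.toReal - 1) *
          ∫⁻ y, ‖K y‖ₑ * ‖F x y‖ₑ ^ p.toReal ∂ν ∂μ := by
        refine lintegral_mono fun x ↦ ?_
        refine le_trans ?_ (rpow_lintegral_mul_le hp1 hK.enorm
          (f := fun y ↦ ‖F x y‖ₑ) (hF.comp measurable_prodMk_left).aemeasurable)
        gcongr
        refine (enorm_integral_le_lintegral_enorm _).trans (le_of_eq ?_)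
        simp only [enorm_smul]
    _ = (∫⁻ y, ‖K y‖ₑ ∂ν) ^ (p.toReal - 1) *
          ∫⁻ x, ∫⁻ y, ‖K y‖ₑ * ‖F x y‖ₑ ^ p.toReal ∂ν ∂μ := by
        rw [lintegral_const_mul'']
        exact AEMeasurable.lintegral_prod_right' (f := fun z : α × β ↦
          ‖K z.2‖ₑ * ‖F z.1 z.2‖ₑ ^ p.toReal)
          ((hK.enorm.comp_quasiMeasurePreserving Measure.quasiMeasurePreserving_snd).mul
            (hF.pow_const _).aemeasurable)
    _ = (∫⁻ y, ‖K y‖ₑ ∂ν) ^ (p.toReal - 1) *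
          ∫⁻ y, ‖K y‖ₑ * ∫⁻ x, ‖F x y‖ₑ ^ p.toReal ∂μ ∂ν := by
        rw [lintegral_lintegral_swap]
        · congr 1
          refine lintegral_congr fun y ↦ ?_
          exact lintegral_const_mul _ ((hF.pow_const _).comp measurable_prodMk_right)
        · exact (hK.enorm.comp_quasiMeasurePreserving Measure.quasiMeasurePreserving_snd).mul
            (hF.pow_const _).aemeasurable
    _ ≤ _ := by
        gcongr with y
        have := hN y
        rw [eLpNorm_eq_lintegral_rpow_enorm_toReal hp0 hp'] at this
        calc ∫⁻ x, ‖F x y‖ₑ ^ p.toReal ∂μ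
            = ((∫⁻ x, ‖F x y‖ₑ ^ p.toReal ∂μ) ^ (1 / p.toReal)) ^ p.toReal := by
              rw [← ENNReal.rpow_mul, one_div_mul_cancel hpp.ne', ENNReal.rpow_one]
          _ ≤ _ := by gcongr

lemma eLpNorm_integral_smul_le_const {α β : Type*} [MeasurableSpace α] [MeasurableSpace β]
    {μ : Measure α} {ν : Measure β} [SFinite μ] [SFinite ν] {𝕜 V : Type*} [RCLike 𝕜]
    [NormedAddCommGroup V] [NormedSpace ℝ V] [NormedSpace 𝕜 V] {p : ℝ≥0∞} (hp : 1 ≤ p) (hp' : p ≠ ⊤)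
    {K : β → 𝕜} {F : α → β → V} (hK : AEStronglyMeasurable K ν)
    (hF : Measurable fun z : α × β ↦ ‖F z.1 z.2‖ₑ) {c : ℝ≥0∞}
    (hN : ∀ y, eLpNorm (fun x ↦ F x y) p μ ≤ c) :
    eLpNorm (fun x ↦ ∫ y, K y • F x y ∂ν) p μ ≤ (∫⁻ y, ‖K y‖ₑ ∂ν) * c := by
  have hp1 : 1 ≤ p.toReal := by
    simpa using ENNReal.toReal_mono hp' hp
  have hpp : 0 < p.toReal := by linarith
  refine (eLpNorm_integral_smul_le hp hp' hK hF hN).trans (le_of_eq ?_)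
  rw [lintegral_mul_const'' _ hK.enorm, ← mul_assoc]
  nth_rewrite 2 [← ENNReal.rpow_one (∫⁻ y, ‖K y‖ₑ ∂ν)]
  rw [← ENNReal.rpow_add_of_nonneg _ _ (by linarith) zero_le_one, sub_add_cancel,
    ← ENNReal.mul_rpow_of_nonneg _ _ hpp.le, ← ENNReal.rpow_mul, mul_one_div_cancel hpp.ne',
    ENNReal.rpow_one]

/-! ### The torus and space-time as period systems -/

section Torus

variable {d : ℕ}

/-- The standard basis of `ℝᵈ`. -/
noncomputable abbrev stdBasis (d : ℕ) : Module.Basis (Fin d) ℝ (E d) :=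
  (EuclideanSpace.basisFun (Fin d) ℝ).toBasis

lemma cell_eq_fundamentalDomain : cell d = ZSpan.fundamentalDomain (stdBasis d) := by
  ext x
  simp [cell, ZSpan.mem_fundamentalDomain]

lemma measurableSet_cell : MeasurableSet (cell d) := by
  rw [cell_eq_fundamentalDomain]
  exact ZSpan.fundamentalDomain_measurableSet _

/-- The coordinatewise fractional part, a retraction of `ℝᵈ` onto the fundamental cell. -/
noncomputable def torusWrap (x : E d) : E d := WithLp.toLp 2 fun i ↦ Int.fract (x i)

lemma torusWrap_apply (x : E d) (i : Fin d) : torusWrap x i = Int.fract (x i) := rfl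

lemma torusWrap_eq_fract (x : E d) : torusWrap x = ZSpan.fract (stdBasis d) x := by
  ext i
  exact (ZSpan.repr_fract_apply (stdBasis d) x i).symm

lemma torusWrap_mem_cell (x : E d) : torusWrap x ∈ cell d := fun _ ↦
  ⟨Int.fract_nonneg _, Int.fract_lt_one _⟩

lemma torusWrap_of_mem_cell {x : E d} (hx : x ∈ cell d) : torusWrap x = x := by
  ext i
  rw [torusWrap_apply, Int.fract_eq_self]
  exact hx i

lemma measurable_torusWrap : Measurable (torusWrap (d := d)) := by
  refine (EuclideanSpace.volume_preserving_symm_measurableEquiv_toLp (Fin d)).symm.measurable.comp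
    (measurable_pi_lambda _ fun i ↦ measurable_fract.comp ?_)
  fun_prop

lemma IsPeriodic.add_mem_span {F : Type*} {f : E d → F} (hf : IsPeriodic f) {v : E d}
    (hv : v ∈ Submodule.span ℤ (Set.range (stdBasis d))) (x : E d) : f (x + v) = f x := by
  induction hv using Submodule.span_induction generalizing x with
  | mem v hv =>
    obtain ⟨i, rfl⟩ := hv
    simpa using hf i x
  | zero => simp
  | add v w _ _ hv hw => rw [← add_assoc, hw, hv]
  | smul n v _ hv =>
    have : Function.Periodic f v := hv
    exact this.zsmul n x

open scoped Pointwise in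
lemma IsPeriodic.lintegral_add {f : E d → ℝ≥0∞} (hf : IsPeriodic f) (ζ : E d) :
    ∫⁻ x, f (x + ζ) ∂(torusMeasure d) = ∫⁻ x, f x ∂(torusMeasure d) := by
  have : Countable (Submodule.span ℤ (range (stdBasis d))).toAddSubgroup :=
    inferInstanceAs (Countable (Submodule.span ℤ (range (stdBasis d))))
  have hD := ZSpan.isAddFundamentalDomain' (stdBasis d) (volume : Measure (E d))
  rw [← cell_eq_fundamentalDomain] at hD
  have hD' := hD.vadd_of_comm ζ
  have h1 := hD'.setLIntegral_eq hD f fun g x ↦ by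
    rw [AddSubgroup.vadd_def, vadd_eq_add, add_comm]
    exact hf.add_mem_span g.2 x
  have h2 := (measurePreserving_add_right (volume : Measure (E d)) ζ).setLIntegral_comp_preimage_emb
    (measurableEmbedding_addRight ζ) f (ζ +ᵥ cell d)
  have h3 : (fun x ↦ x + ζ) ⁻¹' (ζ +ᵥ cell d) = cell d := by
    ext x
    rw [mem_preimage, Set.mem_vadd_set_iff_neg_vadd_mem, vadd_eq_add, neg_add_eq_sub,
      add_sub_cancel_right]
  rw [h3] at h2
  rw [torusMeasure, ← h1, h2]

lemma isPeriodic_comp_torusWrap {F : Type*} (f : E d → F) : IsPeriodic fun x ↦ f (torusWrap x) := by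
  intro i x
  have h : torusWrap (x + EuclideanSpace.single i 1) = torusWrap x := by
    ext j
    rw [torusWrap_apply, torusWrap_apply, PiLp.add_apply, PiLp.single_apply]
    split_ifs <;> simp
  simp only [h]

lemma IsPeriodic.torusWrap_add {F : Type*} {f : E d → F} (hf : IsPeriodic f) (x y : E d) :
    f (torusWrap x + y) = f (x + y) := by
  rw [torusWrap_eq_fract, ZSpan.fract_apply, sub_add_eq_add_sub, sub_eq_add_neg]
  exact hf.add_mem_span (neg_mem (SetLike.coe_mem _)) _

/-- The torus as a period system. -/
noncomputable def torusSystem (d : ℕ) : PeriodSystem (torusMeasure d) where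
  wrap := torusWrap
  measurePreserving ζ := by
    have hm : Measurable fun z : E d ↦ torusWrap (z + ζ) :=
      measurable_torusWrap.comp (measurable_add_const ζ)
    refine ⟨hm, Measure.ext fun s hs ↦ ?_⟩
    rw [Measure.map_apply hm hs, ← lintegral_indicator_one (hm hs), ← lintegral_indicator_one hs]
    have h := (isPeriodic_comp_torusWrap (s.indicator (1 : E d → ℝ≥0∞))).lintegral_add ζ
    refine (lintegral_congr fun x ↦ ?_).trans (h.trans ?_)
    · rfl
    · rw [torusMeasure]
      exact setLIntegral_congr_fun measurableSet_cell fun x hx ↦ by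
        simp only [torusWrap_of_mem_cell hx]

lemma torusSystem_inv {F : Type*} {f : E d → F} : (torusSystem d).Inv f ↔ IsPeriodic f := by
  refine ⟨fun h i x ↦ ?_, fun h x y ↦ h.torusWrap_add x y⟩
  have h1 := h.wrap (x + EuclideanSpace.single i 1)
  rw [← h1, ← h.wrap x]
  exact isPeriodic_comp_torusWrap f i x

/-- Space-time `ℝ × 𝕋ᵈ`, without restriction on the time variable. -/
noncomputable def cylinder (d : ℕ) : Measure (ℝ × E d) := volume.prod (torusMeasure d)

instance : SFinite (torusMeasure d) := by unfold torusMeasure; infer_instance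

instance : SFinite (cylinder d) := by unfold cylinder; infer_instance

lemma volume_cell : volume (cell d) = 1 := by
  have h := EuclideanSpace.volume_preserving_symm_measurableEquiv_toLp (Fin d)
  have h2 : cell d = (MeasurableEquiv.toLp 2 (Fin d → ℝ)).symm ⁻¹' (Set.pi univ fun _ ↦
      Ico (0 : ℝ) 1) := by
    ext x
    simp [cell, Set.mem_pi]
  rw [h2, h.measure_preimage_equiv, Real.volume_pi_Ico]
  simp

instance : IsProbabilityMeasure (torusMeasure d) := ⟨by
  rw [torusMeasure, Measure.restrict_apply_univ, volume_cell]⟩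

/-- Space-time as a period system; only the space variable is wrapped. -/
noncomputable def cylinderSystem (d : ℕ) : PeriodSystem (cylinder d) where
  wrap z := (z.1, torusWrap z.2)
  measurePreserving ζ := by
    have h1 := (measurePreserving_add_right (volume : Measure ℝ) ζ.1)
    exact h1.prod ((torusSystem d).measurePreserving ζ.2)

lemma cylinderSystem_inv {F : Type*} {f : ℝ × E d → F} :
    (cylinderSystem d).Inv f ↔ ∀ t, IsPeriodic fun x ↦ f (t, x) := by
  constructor
  · intro h t
    rw [← torusSystem_inv]
    intro x y
    have h1 := h (t, x) (0, y)
    simp only [Prod.mk_add_mk, add_zero] at h1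
    refine Eq.trans ?_ h1
    change f (t, _) = f (t + 0, _)
    rw [add_zero]
    rfl
  · intro h z ζ
    exact (h (z.1 + ζ.1)).torusWrap_add z.2 ζ.2

end Torus

/-! ### Products with translates -/

namespace PeriodSystem

variable {G : Type*} [AddCommGroup G] [MeasurableSpace G] {μ ν : Measure G}
  {S : PeriodSystem μ} {𝕜 : Type*} [RCLike 𝕜]

lemma lintegral_enorm_mul_sub_le (p q : ℝ≥0∞) [ENNReal.HolderTriple p q 1] {A B : G → 𝕜}
    (hA : AEStronglyMeasurable A μ) (hB : AEStronglyMeasurable B μ) (hBi : S.Inv B) (y : G) :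
    ∫⁻ x, ‖A x * B (x - y)‖ₑ ∂μ ≤ eLpNorm A p μ * eLpNorm B q μ := by
  have hB' : AEStronglyMeasurable (fun x ↦ B (x - y)) μ := by
    simpa only [sub_eq_add_neg] using hBi.aestronglyMeasurable_add hB (-y)
  have h := eLpNorm_smul_le_mul_eLpNorm (p := p) (q := q) (r := 1) hB' hA
  rw [hBi.eLpNorm_sub hB] at h
  rwa [eLpNorm_one_eq_lintegral_enorm] at h

variable [MeasurableSub₂ G] [SFinite μ] [SFinite ν]

/-- The integrand of a convolution paired with another function is integrable. -/
lemma integrable_kernel_mul (p q : ℝ≥0∞) [ENNReal.HolderTriple p q 1] {K A B : G → 𝕜}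
    (hK : Integrable K ν) (hA : MemLp A p μ) (hB : MemLp B q μ) (hBm : Measurable B)
    (hBi : S.Inv B) :
    Integrable (fun z : G × G ↦ K z.2 * (A z.1 * B (z.1 - z.2))) (μ.prod ν) := by
  have hm : AEStronglyMeasurable (fun z : G × G ↦ A z.1 * B (z.1 - z.2)) (μ.prod ν) :=
    (hA.1.comp_quasiMeasurePreserving Measure.quasiMeasurePreserving_fst).mul
      (hBm.comp measurable_sub).aestronglyMeasurable
  have hm' : AEStronglyMeasurable (fun z : G × G ↦ K z.2 * (A z.1 * B (z.1 - z.2))) (μ.prod ν) :=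
    (hK.1.comp_quasiMeasurePreserving Measure.quasiMeasurePreserving_snd).mul hm
  refine ⟨hm', ?_⟩
  rw [HasFiniteIntegral, lintegral_prod_symm _ hm'.enorm]
  calc ∫⁻ y, ∫⁻ x, ‖K y * (A x * B (x - y))‖ₑ ∂μ ∂ν
      ≤ ∫⁻ y, ‖K y‖ₑ * (eLpNorm A p μ * eLpNorm B q μ) ∂ν := by
        refine lintegral_mono fun y ↦ ?_
        simp only [enorm_mul (K y)]
        rw [lintegral_const_mul' _ _ enorm_ne_top]
        gcongr
        exact lintegral_enorm_mul_sub_le p q hA.1 hB.1 hBi y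
    _ = (∫⁻ y, ‖K y‖ₑ ∂ν) * (eLpNorm A p μ * eLpNorm B q μ) :=
        lintegral_mul_const'' _ hK.1.enorm
    _ < ⊤ := ENNReal.mul_lt_top hK.2 (ENNReal.mul_lt_top hA.2 hB.2)

lemma integrable_kernel {K B : G → 𝕜} (hK : Integrable K ν) (hB : Integrable B μ)
    (hBm : Measurable B) (hBi : S.Inv B) [IsFiniteMeasure μ] :
    Integrable (fun z : G × G ↦ K z.2 * B (z.1 - z.2)) (μ.prod ν) := by
  simpa using integrable_kernel_mul ⊤ 1 hK (memLp_top_const (1 : 𝕜))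
    (memLp_one_iff_integrable.2 hB) hBm hBi

end PeriodSystem

/-! ### Fourier coefficients on the torus -/

section Fourier

variable {d : ℕ}

/-- The frequency `n ∈ ℤᵈ` as a vector of `ℝᵈ`. -/
noncomputable def freq (n : Fin d → ℤ) : E d := WithLp.toLp 2 fun i ↦ (n i : ℝ)

@[simp] lemma freq_apply (n : Fin d → ℤ) (i : Fin d) : freq n i = n i := rfl

/-- The character `x ↦ exp (-2πi n · x)` of the torus. -/
noncomputable def wave (n : Fin d → ℤ) (x : E d) : ℂ := (Real.fourierChar (-inner ℝ x (freq n)) : ℂ)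

lemma wave_add (n : Fin d → ℤ) (x y : E d) : wave n (x + y) = wave n x * wave n y := by
  simp only [wave, inner_add_left, neg_add]
  rw [AddChar.map_add_eq_mul]
  simp

@[simp] lemma norm_wave (n : Fin d → ℤ) (x : E d) : ‖wave n x‖ = 1 := Circle.norm_coe _

lemma wave_eq_exp (n : Fin d → ℤ) (x : E d) :
    wave n x = Complex.exp (((-(2 * Real.pi * inner ℝ x (freq n)) : ℝ) : ℂ) * Complex.I) := by
  simp only [wave, Real.fourierChar_apply]
  congr 2
  push_cast
  ring

lemma contDiff_wave (n : Fin d → ℤ) : ContDiff ℝ ∞ (wave n) := by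
  simp only [funext (wave_eq_exp n)]
  have h : ContDiff ℝ ∞ fun x : E d ↦ -(2 * Real.pi * inner ℝ x (freq n)) :=
    (contDiff_const.mul (contDiff_id.inner ℝ contDiff_const)).neg
  exact ((Complex.ofRealCLM.contDiff.comp h).mul contDiff_const).cexp

lemma inner_freq (x : E d) (n : Fin d → ℤ) : inner ℝ x (freq n) = ∑ i, x i * n i := by
  simp [PiLp.inner_apply, mul_comm]

lemma wave_periodic (n : Fin d → ℤ) : IsPeriodic (wave n) := by
  intro i x
  rw [wave_add]
  have : wave n (EuclideanSpace.single i 1) = 1 := by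
    rw [wave_eq_exp, inner_freq, Complex.exp_eq_one_iff]
    refine ⟨-n i, ?_⟩
    have : ∑ j, (EuclideanSpace.single i (1 : ℝ) : E d) j * n j = n i := by
      simp
    rw [this]
    push_cast
    ring
  rw [this, mul_one]

/-- The Fourier coefficients of a function on the torus. -/
noncomputable def coef (f : E d → ℂ) (n : Fin d → ℤ) : ℂ := ∫ x, wave n x * f x ∂(torusMeasure d)

lemma integrable_wave_mul {f : E d → ℂ} (hf : Integrable f (torusMeasure d)) (n : Fin d → ℤ) :
    Integrable (fun x ↦ wave n x * f x) (torusMeasure d) :=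
  hf.bdd_mul (c := 1) (contDiff_wave n).continuous.aestronglyMeasurable
    (Filter.Eventually.of_forall fun x ↦ (norm_wave n x).le)

lemma coef_sub {f g : E d → ℂ} (hf : Integrable f (torusMeasure d))
    (hg : Integrable g (torusMeasure d)) (n : Fin d → ℤ) :
    coef (fun x ↦ f x - g x) n = coef f n - coef g n := by
  simp only [coef, mul_sub]
  exact integral_sub (integrable_wave_mul hf n) (integrable_wave_mul hg n)

/-- A convolution over `ℝᵈ` acts on the Fourier coefficients of a periodic function as the
multiplier given by the Fourier transform of the kernel. -/
lemma coef_convolution {K f : E d → ℂ} (hK : Integrable K) (hf : Integrable f (torusMeasure d))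
    (hfm : Measurable f) (hfp : IsPeriodic f) (n : Fin d → ℤ) :
    coef (fun x ↦ ∫ z, K z * f (x - z)) n = 𝓕 K (freq n) * coef f n := by
  have hw : MemLp (wave n) ⊤ (torusMeasure d) :=
    memLp_top_of_bound (contDiff_wave n).continuous.aestronglyMeasurable 1
      (Filter.Eventually.of_forall fun x ↦ (norm_wave n x).le)
  have hint := PeriodSystem.integrable_kernel_mul ⊤ 1 hK hw (memLp_one_iff_integrable.2 hf) hfm
    (torusSystem_inv.2 hfp)
  calc coef (fun x ↦ ∫ z, K z * f (x - z)) n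
      = ∫ x, ∫ z, K z * (wave n x * f (x - z)) ∂volume ∂(torusMeasure d) := by
        refine integral_congr_ae (Filter.Eventually.of_forall fun x ↦ ?_)
        simp only
        rw [← integral_const_mul]
        congr 1
        ext z
        ring
    _ = ∫ z, ∫ x, K z * (wave n x * f (x - z)) ∂(torusMeasure d) := integral_integral_swap hint
    _ = ∫ z, (wave n z * K z) * coef f n := by
        congr 1
        ext z
        rw [integral_const_mul]
        have h1 : (torusSystem d).Inv (fun x ↦ wave n (x + z) * f x) :=
          ((torusSystem_inv.2 (wave_periodic n)).shift z).mul (torusSystem_inv.2 hfp)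
        have hm : AEStronglyMeasurable (fun x ↦ wave n (x + z) * f x) (torusMeasure d) :=
          (((contDiff_wave n).continuous.comp (continuous_add_const z)).measurable.mul
            hfm).aestronglyMeasurable
        have h2 := h1.integral_sub hm z
        simp only [sub_add_cancel] at h2
        have h3 : ∫ x, wave n (x + z) * f x ∂(torusMeasure d) = wave n z * coef f n := by
          rw [coef, ← integral_const_mul]
          refine integral_congr_ae (Filter.Eventually.of_forall fun x ↦ ?_)
          simp only [wave_add]
          ring
        rw [h2, h3]
        ring
    _ = _ := by
        rw [integral_mul_const, Real.fourier_eq]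
        rfl

lemma map_torusMeasure : (torusMeasure d).map (MeasurableEquiv.toLp 2 (Fin d → ℝ)).symm =
    volume.restrict {x : Fin d → ℝ | ∀ i,
        x i ∈ Ioc ((0 : Fin d → ℝ) i) ((0 : Fin d → ℝ) i + 1)} := by
  have h := EuclideanSpace.volume_preserving_symm_measurableEquiv_toLp (Fin d)
  have h2 : cell d = (MeasurableEquiv.toLp 2 (Fin d → ℝ)).symm ⁻¹'
      (Set.pi univ fun _ ↦ Ico (0 : ℝ) 1) := by
    ext x
    simp [cell, Set.mem_pi]
  have h3 := h.restrict_preimage_emb (MeasurableEquiv.measurableEmbedding _)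
    (Set.pi univ fun _ ↦ Ico (0 : ℝ) 1)
  rw [← h2] at h3
  rw [torusMeasure, h3.map_eq]
  refine Measure.restrict_congr_set ?_
  refine (Measure.univ_pi_Ico_ae_eq_Icc (μ := fun _ : Fin d ↦ (volume : Measure ℝ))
    (f := 0) (g := 1)).trans ?_
  refine (Measure.univ_pi_Ioc_ae_eq_Icc (μ := fun _ : Fin d ↦ (volume : Measure ℝ))
    (f := 0) (g := 1)).symm.trans ?_
  refine Filter.EventuallyEq.of_eq ?_
  ext x
  change (x ∈ Set.pi univ _) ↔ (x ∈ {x : Fin d → ℝ | _})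
  simp [Set.mem_pi]

/-- A square-integrable function on the torus with vanishing Fourier coefficients vanishes. -/
lemma ae_eq_zero_of_coef_eq_zero {f : E d → ℂ} (hfm : Measurable f)
    (hf : MemLp f 2 (torusMeasure d)) (h0 : ∀ n, coef f n = 0) : f =ᵐ[torusMeasure d] 0 := by
  -- transfer to `UnitAddTorus`, with the fundamental cell `(0,1]ᵈ` instead of `[0,1)ᵈ`
  let := instMeasureSpaceUnitAddCircle
  let e := UnitAddTorus.measurableEquivPiIoc (ι := Fin d) 0
  let g : UnitAddTorus (Fin d) → ℂ := fun θ ↦ f (WithLp.toLp 2 (e θ).1)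
  have hgm : Measurable g := by
    refine hfm.comp ((MeasurableEquiv.toLp 2 (Fin d → ℝ)).measurable.comp ?_)
    exact measurable_subtype_coe.comp e.measurable
  have hg : ∀ x : Fin d → ℝ, (∀ i, x i ∈ Ioc ((0 : Fin d → ℝ) i) ((0 : Fin d → ℝ) i + 1)) →
      g (fun i ↦ x i) = f (WithLp.toLp 2 x) := by
    intro x hx
    have := e.apply_symm_apply ⟨x, hx⟩
    simp only [g]
    rw [show (fun i ↦ (x i : UnitAddCircle)) = e.symm ⟨x, hx⟩ from rfl, this]
  have hS : MeasurableSet {x : Fin d → ℝ | ∀ i,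
      x i ∈ Ioc ((0 : Fin d → ℝ) i) ((0 : Fin d → ℝ) i + 1)} :=
    MeasurableSet.univ_pi' (fun i => measurableSet_Ioc)
  have hlint : ∀ H : ℂ → ℝ≥0∞, Measurable H → ∫⁻ θ, H (g θ) = ∫⁻ x, H (f x) ∂(torusMeasure d) := by
    intro H hH
    rw [UnitAddTorus.lintegral_preimage _ 0,
      setLIntegral_congr_fun (g := fun x ↦ H (f (WithLp.toLp 2 x))) hS fun x hx ↦
        by simp only [hg x hx],
      ← map_torusMeasure, lintegral_map]
    · rfl
    · exact hH.comp (hfm.comp (MeasurableEquiv.toLp 2 (Fin d → ℝ)).measurable)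
    · exact (MeasurableEquiv.toLp 2 (Fin d → ℝ)).symm.measurable
  have hgL : MemLp g 2 := by
    refine ⟨hgm.aestronglyMeasurable, ?_⟩
    have := hf.2
    rw [eLpNorm_lt_top_iff_lintegral_rpow_enorm_lt_top (by norm_num) (by norm_num)] at this ⊢
    rwa [hlint (fun c ↦ ‖c‖ₑ ^ (2 : ℝ≥0∞).toReal) (by fun_prop)]
  have hcoef : ∀ n, UnitAddTorus.mFourierCoeff g n = 0 := by
    intro n
    rw [← h0 n, UnitAddTorus.mFourierCoeff_eq_integral _ _ 0, coef,
      setIntegral_congr_fun (g := fun x ↦ wave n (WithLp.toLp 2 x) * f (WithLp.toLp 2 x)) hS,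
      ← map_torusMeasure, integral_map_equiv]
    · rfl
    · intro x hx
      simp only [hg x hx, smul_eq_mul]
      congr 1
      rw [wave_eq_exp, inner_freq]
      simp only [UnitAddTorus.mFourier, ContinuousMap.coe_mk, fourier_coe_apply, Pi.neg_apply]
      rw [← Complex.exp_sum]
      congr 1
      push_cast
      rw [Finset.mul_sum, ← Finset.sum_neg_distrib, Finset.sum_mul]
      refine Finset.sum_congr rfl fun i _ ↦ ?_
      ring
  have hz : hgL.toLp g = 0 := by
    apply (UnitAddTorus.mFourierBasis (d := Fin d)).repr.injective
    ext n
    rw [UnitAddTorus.mFourierBasis_repr, map_zero]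
    simp only [lp.coeFn_zero, Pi.zero_apply]
    rw [← hcoef n]
    refine integral_congr_ae ?_
    filter_upwards [hgL.coeFn_toLp] with θ hθ
    rw [hθ]
  have hz' : g =ᵐ[volume] 0 := by
    have h1 := hgL.coeFn_toLp
    rw [hz] at h1
    exact h1.symm.trans (Lp.coeFn_zero _ _ _)
  have h2 : ∫⁻ θ, ‖g θ‖ₑ = 0 := by
    rw [lintegral_congr_ae (g := fun _ ↦ 0)]
    · simp
    · filter_upwards [hz'] with θ hθ
      simp [hθ]
  rw [hlint (fun c ↦ ‖c‖ₑ) (by fun_prop), lintegral_eq_zero_iff hfm.enorm] at h2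
  filter_upwards [h2] with x hx
  simpa using hx

end Fourier

/-! ### Dilated kernels -/

section Dilation

variable {d : ℕ} {F : Type*} [NormedAddCommGroup F]

/-- The `L¹`-normalised dilation `2ᵏᵈ K(2ᵏ x)` of a kernel. -/
noncomputable def dil [NormedSpace ℝ F] (k : ℕ) (K : E d → F) (x : E d) : F :=
  ((2 : ℝ) ^ k) ^ d • K ((2 : ℝ) ^ k • x)

lemma lintegral_dil (k : ℕ) {h : E d → ℝ≥0∞} (hh : AEMeasurable h) :
    ∫⁻ x, ENNReal.ofReal (((2 : ℝ) ^ k) ^ d) * h ((2 : ℝ) ^ k • x) = ∫⁻ x, h x := by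
  have h2 : (0 : ℝ) < 2 ^ k := by positivity
  have hmap := Measure.map_addHaar_smul (volume : Measure (E d)) h2.ne'
  rw [finrank_euclideanSpace_fin, abs_of_pos (by positivity)] at hmap
  rw [lintegral_const_mul' _ _ ENNReal.ofReal_ne_top]
  have h3 : ∫⁻ x, h ((2 : ℝ) ^ k • x) = ∫⁻ x, h x ∂(Measure.map ((2 : ℝ) ^ k • ·) volume) := by
    rw [lintegral_map' _ (measurable_const_smul _).aemeasurable]
    rw [hmap]
    exact hh.smul_measure _
  rw [h3, hmap, lintegral_smul_measure, smul_eq_mul, ← mul_assoc,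
    ← ENNReal.ofReal_mul (by positivity), mul_inv_cancel₀ (by positivity), ENNReal.ofReal_one,
    one_mul]

variable [NormedSpace ℝ F]

lemma enorm_dil (k : ℕ) (K : E d → F) (x : E d) :
    ‖dil k K x‖ₑ = ENNReal.ofReal (((2 : ℝ) ^ k) ^ d) * ‖K ((2 : ℝ) ^ k • x)‖ₑ := by
  rw [dil, enorm_smul, Real.enorm_of_nonneg (by positivity)]

lemma integrable_dil (k : ℕ) {K : E d → F} (hK : Integrable K) : Integrable (dil k K) :=
  (hK.comp_smul (by positivity)).smul _

/-- Change of variables for weighted `L¹` norms of dilated kernels. -/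
lemma lintegral_enorm_dil_mul (k : ℕ) {K : E d → F} (hK : AEStronglyMeasurable K)
    {h : E d → ℝ≥0∞} (hh : Measurable h) :
    ∫⁻ x, ‖dil k K x‖ₑ * h x = ∫⁻ x, ‖K x‖ₑ * h (((2 : ℝ) ^ k)⁻¹ • x) := by
  have hm : AEMeasurable fun x ↦ ‖K x‖ₑ * h (((2 : ℝ) ^ k)⁻¹ • x) :=
    hK.enorm.mul (hh.comp (measurable_const_smul _)).aemeasurable
  rw [← lintegral_dil k hm]
  refine lintegral_congr fun x ↦ ?_
  rw [enorm_dil, inv_smul_smul₀ (by positivity), mul_assoc]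

lemma lintegral_enorm_dil (k : ℕ) {K : E d → F} (hK : AEStronglyMeasurable K) :
    ∫⁻ x, ‖dil k K x‖ₑ = ∫⁻ x, ‖K x‖ₑ := by
  simpa using lintegral_enorm_dil_mul k hK (h := fun _ ↦ 1) measurable_const

lemma lintegral_enorm_dil_sub (k : ℕ) {K : E d → F} (hK : Continuous K) (y : E d) :
    ∫⁻ x, ‖dil k K (x - y) - dil k K x‖ₑ = ∫⁻ x, ‖K (x - (2 : ℝ) ^ k • y) - K x‖ₑ := by
  rw [← lintegral_enorm_dil k (K := fun x ↦ K (x - (2 : ℝ) ^ k • y) - K x)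
    (by fun_prop : Continuous _).aestronglyMeasurable]
  refine lintegral_congr fun x ↦ ?_
  simp only [dil, smul_sub]

lemma fourier_dil (k : ℕ) (K : E d → ℂ) (ξ : E d) :
    𝓕 (dil k K) ξ = 𝓕 K (((2 : ℝ) ^ k)⁻¹ • ξ) := by
  have h2 : (0 : ℝ) < 2 ^ k := by positivity
  rw [Real.fourier_eq, Real.fourier_eq]
  have := Measure.integral_comp_smul (volume : Measure (E d))
    (fun x ↦ Real.fourierChar (-inner ℝ x (((2 : ℝ) ^ k)⁻¹ • ξ)) • K x) ((2 : ℝ) ^ k)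
  rw [finrank_euclideanSpace_fin, abs_of_pos (by positivity), eq_inv_smul_iff₀ (by positivity),
    ← integral_smul] at this
  rw [← this]
  congr 1
  ext x
  rw [inner_smul_left, inner_smul_right]
  simp only [dil, conj_trivial, mul_inv_cancel_left₀ h2.ne']
  rw [smul_comm]

/-- The translates of a Schwartz function depend on the translation in a Hölder continuous way,
in `L¹`. -/
lemma exists_lintegral_sub_le [CompleteSpace F] (X : SchwartzMap (E d) F)
    {θ : ℝ} (hθ : 0 ≤ θ) (hθ1 : θ ≤ 1) :
    ∃ C : ℝ≥0∞, C ≠ ⊤ ∧ ∀ y, ∫⁻ x, ‖X (x - y) - X x‖ₑ ≤ C * ENNReal.ofReal (‖y‖ ^ θ) := by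
  have hX : Integrable X := X.integrable
  have hdX : Integrable (fderiv ℝ X) := (SchwartzMap.fderivCLM ℝ (E d) F X).integrable
  refine ⟨(∫⁻ x, ‖fderiv ℝ X x‖ₑ) + 2 * ∫⁻ x, ‖X x‖ₑ, ?_, fun y ↦ ?_⟩
  · exact ENNReal.add_ne_top.2 ⟨hdX.2.ne, ENNReal.mul_ne_top (by simp) hX.2.ne⟩
  rcases le_total ‖y‖ 1 with hy | hy
  -- for `‖y‖ ≤ 1` by the fundamental theorem of calculus, otherwise trivially
  · have hXd : ∀ x, HasFDerivAt X (fderiv ℝ X x) x := fun x ↦ X.differentiableAt.hasFDerivAt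
    have hcont : Continuous (fderiv ℝ X) := X.smooth'.continuous_fderiv (by simp)
    have hpt : ∀ x, ‖X (x - y) - X x‖ₑ ≤
        ∫⁻ s in Ioc (0 : ℝ) 1, ‖fderiv ℝ X (x - s • y)‖ₑ * ‖y‖ₑ := by
      intro x
      have hd : ∀ s : ℝ,
          HasDerivAt (fun s : ℝ ↦ X (x - s • y)) (fderiv ℝ X (x - s • y) (-y)) s := by
        intro s
        have h1 : HasDerivAt (fun s : ℝ ↦ x - s • y) (-y) s := by
          simpa using ((hasDerivAt_id s).smul_const y).const_sub x
        exact (hXd _).comp_hasDerivAt s h1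
      have hc : Continuous fun s : ℝ ↦ fderiv ℝ X (x - s • y) (-y) := by fun_prop
      have hi := intervalIntegral.integral_eq_sub_of_hasDerivAt (fun s _ ↦ hd s)
        (hc.intervalIntegrable 0 1)
      simp only [one_smul, zero_smul, sub_zero] at hi
      rw [← hi, intervalIntegral.integral_of_le zero_le_one]
      refine (enorm_integral_le_lintegral_enorm _).trans (lintegral_mono fun s ↦ ?_)
      simpa using (fderiv ℝ X (x - s • y)).le_opENorm (-y)
    have hmeas : Measurable fun z : E d × ℝ ↦ ‖fderiv ℝ X (z.1 - z.2 • y)‖ₑ * ‖y‖ₑ :=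
      (by fun_prop : Continuous fun z : E d × ℝ ↦
          fderiv ℝ X (z.1 - z.2 • y)).enorm.measurable.mul_const _
    calc ∫⁻ x, ‖X (x - y) - X x‖ₑ
        ≤ ∫⁻ x, ∫⁻ s in Ioc (0 : ℝ) 1, ‖fderiv ℝ X (x - s • y)‖ₑ * ‖y‖ₑ := lintegral_mono hpt
      _ = ∫⁻ s in Ioc (0 : ℝ) 1, ∫⁻ x, ‖fderiv ℝ X (x - s • y)‖ₑ * ‖y‖ₑ :=
          lintegral_lintegral_swap hmeas.aemeasurable
      _ = ∫⁻ s in Ioc (0 : ℝ) 1, (∫⁻ x, ‖fderiv ℝ X x‖ₑ) * ‖y‖ₑ := by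
          refine lintegral_congr fun s ↦ ?_
          rw [lintegral_mul_const' _ _ enorm_ne_top,
            lintegral_sub_right_eq_self (fun x ↦ ‖fderiv ℝ X x‖ₑ) (s • y)]
      _ = (∫⁻ x, ‖fderiv ℝ X x‖ₑ) * ‖y‖ₑ := by simp
      _ ≤ _ := by
          gcongr
          · exact le_self_add
          · rw [← ofReal_norm]
            refine ENNReal.ofReal_le_ofReal ?_
            simpa using Real.rpow_le_rpow_of_exponent_ge' (norm_nonneg y) hy hθ hθ1
  · have h1 : (1 : ℝ≥0∞) ≤ ENNReal.ofReal (‖y‖ ^ θ) := by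
      rw [← ENNReal.ofReal_one]
      exact ENNReal.ofReal_le_ofReal (Real.one_le_rpow hy hθ)
    calc ∫⁻ x, ‖X (x - y) - X x‖ₑ ≤ ∫⁻ x, (‖X (x - y)‖ₑ + ‖X x‖ₑ) :=
          lintegral_mono fun x ↦ enorm_sub_le
      _ = 2 * ∫⁻ x, ‖X x‖ₑ := by
          rw [lintegral_add_right _ X.continuous.enorm.measurable,
            lintegral_sub_right_eq_self (fun x ↦ ‖X x‖ₑ) y, two_mul]
      _ ≤ _ := by
          refine le_trans le_add_self (le_mul_of_one_le_right' h1)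

end Dilation

/-! ### Littlewood--Paley kernels -/

lemma exists_schwartz_fourierInv {d : ℕ} {h : E d → ℂ} (hc : HasCompactSupport h)
    (hs : ContDiff ℝ ∞ h) :
    ∃ K : SchwartzMap (E d) ℂ, (K : E d → ℂ) = 𝓕⁻ h ∧ 𝓕 (K : E d → ℂ) = h := by
  refine ⟨𝓕⁻ (hc.toSchwartzMap hs), ?_, ?_⟩
  · rw [SchwartzMap.fourierInv_coe]
    rfl
  · rw [← SchwartzMap.fourier_coe, FourierTransform.fourier_fourierInv_eq]
    rfl

section LittlewoodPaley

variable {d : ℕ} (Φ : LittlewoodPaley d)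

namespace LittlewoodPaley

lemma phi_eq_zero_of_le {ξ : E d} (h : ‖ξ‖ ≤ 1 / 2) : Φ.ϕ ξ = 0 := by
  by_contra hc
  have := (Φ.tsupport_subset (subset_tsupport _ hc)).1
  linarith

lemma phi_eq_zero_of_ge {ξ : E d} (h : 2 ≤ ‖ξ‖) : Φ.ϕ ξ = 0 := by
  by_contra hc
  have := (Φ.tsupport_subset (subset_tsupport _ hc)).2
  linarith

lemma norm_two_zpow_smul (k : ℤ) (ξ : E d) : ‖(2 : ℝ) ^ k • ξ‖ = (2 : ℝ) ^ k * ‖ξ‖ := by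
  rw [norm_smul, Real.norm_of_nonneg (by positivity)]

/-- At a given frequency only finitely many of the blocks `k ≥ 0` are active. -/
lemma phi_eq_zero_of_norm_le {ξ : E d} {m k : ℕ} (h : ‖ξ‖ ≤ 2 ^ m) (hk : m ≤ k) :
    Φ.ϕ ((2 : ℝ) ^ (-((k : ℤ) + 1)) • ξ) = 0 := by
  apply Φ.phi_eq_zero_of_le
  rw [norm_two_zpow_smul, zpow_neg, ← Nat.cast_succ, zpow_natCast, inv_mul_le_iff₀ (by positivity),
    pow_succ]
  have : (2 : ℝ) ^ m ≤ 2 ^ k := pow_le_pow_right₀ (by norm_num) hk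
  linarith

lemma summable_phi (ξ : E d) : Summable fun k : ℕ ↦ Φ.ϕ ((2 : ℝ) ^ (-((k : ℤ) + 1)) • ξ) := by
  obtain ⟨m, hm⟩ := pow_unbounded_of_one_lt ‖ξ‖ (one_lt_two : (1 : ℝ) < 2)
  refine summable_of_ne_finset_zero (s := Finset.range m) fun k hk ↦ ?_
  exact Φ.phi_eq_zero_of_norm_le hm.le (by simpa using hk)

/-- The frequency profile of the low frequency kernel `ψ`. -/
noncomputable def lowSymbol (ξ : E d) : ℝ := 1 - ∑' k : ℕ, Φ.ϕ ((2 : ℝ) ^ (-((k : ℤ) + 1)) • ξ)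

lemma contDiff_lowSymbol : ContDiff ℝ ∞ Φ.lowSymbol := by
  rw [contDiff_iff_contDiffAt]
  intro ξ
  obtain ⟨m, hm⟩ := pow_unbounded_of_one_lt ‖ξ‖ (one_lt_two : (1 : ℝ) < 2)
  have h : Φ.lowSymbol =ᶠ[nhds ξ] fun ξ ↦
      1 - ∑ k ∈ Finset.range m, Φ.ϕ ((2 : ℝ) ^ (-((k : ℤ) + 1)) • ξ) := by
    filter_upwards [(isOpen_lt continuous_norm continuous_const).mem_nhds hm] with η hη
    rw [lowSymbol, tsum_eq_sum (s := Finset.range m) fun k hk ↦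
      Φ.phi_eq_zero_of_norm_le (le_of_lt hη) (by simpa using hk)]
  refine ContDiffAt.congr_of_eventuallyEq (ContDiff.contDiffAt ?_) h
  exact contDiff_const.sub (ContDiff.sum fun k _ ↦ Φ.smooth.comp (contDiff_const_smul _))

/-- For frequencies at distance `≥ 1` from the origin the blocks `k ≥ 0` form a partition
of unity. -/
lemma hasSum_phi_nat {ξ : E d} (hξ : 1 ≤ ‖ξ‖) :
    HasSum (fun k : ℕ ↦ Φ.ϕ ((2 : ℝ) ^ (-(k : ℤ)) • ξ)) 1 := by
  have h := Φ.hasSum ξ (by rintro rfl; simp at hξ; linarith)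
  have hinj : Function.Injective ((↑) : ℕ → ℤ) := Nat.cast_injective
  rw [← hinj.hasSum_iff (f := fun k : ℤ ↦ Φ.ϕ ((2 : ℝ) ^ (-k) • ξ))] at h
  · exact h
  · intro k hk
    apply Φ.phi_eq_zero_of_ge
    have hk' : 1 ≤ -k := by
      by_contra hc
      exact hk ⟨k.toNat, by omega⟩
    rw [norm_two_zpow_smul]
    have : (2 : ℝ) ^ (1 : ℤ) ≤ 2 ^ (-k) := zpow_le_zpow_right₀ (by norm_num) hk'
    rw [zpow_one] at this
    nlinarith

lemma lowSymbol_eq_zero {ξ : E d} (hξ : 2 ≤ ‖ξ‖) : Φ.lowSymbol ξ = 0 := by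
  have h := Φ.hasSum_phi_nat (by linarith : 1 ≤ ‖ξ‖)
  rw [← hasSum_nat_add_iff' 1] at h
  simp only [Finset.range_one, Finset.sum_singleton, Nat.cast_zero, neg_zero, zpow_zero, one_smul,
    Φ.phi_eq_zero_of_ge hξ, sub_zero, Nat.cast_add, Nat.cast_one] at h
  rw [lowSymbol, h.tsum_eq, sub_self]

/-- The symbols of the kernels of the Besov norm: `ψ` for `k = 0` and `ϕ_k` for `k ≥ 1`. -/
noncomputable def symbol : ℕ → E d → ℝ
  | 0 => Φ.lowSymbol
  | (k + 1) => fun ξ ↦ Φ.ϕ ((2 : ℝ) ^ (-((k : ℤ) + 1)) • ξ)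

/-- The kernels of the Besov norm: `ψ` for `k = 0` and `ϕ_k` for `k ≥ 1`. -/
noncomputable def kernel : ℕ → E d → ℂ
  | 0 => Φ.low
  | (k + 1) => Φ.block (k + 1)

lemma kernel_eq (k : ℕ) : Φ.kernel k = 𝓕⁻ fun ξ ↦ ((Φ.symbol k ξ : ℝ) : ℂ) := by
  cases k with
  | zero => rfl
  | succ k => simp [kernel, block, symbol]

lemma contDiff_symbol (k : ℕ) : ContDiff ℝ ∞ (Φ.symbol k) := by
  cases k with
  | zero => exact Φ.contDiff_lowSymbol
  | succ k => exact Φ.smooth.comp (contDiff_const_smul _)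

lemma symbol_eq_zero {k : ℕ} {ξ : E d} (hξ : 2 ^ (k + 1) ≤ ‖ξ‖) : Φ.symbol k ξ = 0 := by
  cases k with
  | zero => exact Φ.lowSymbol_eq_zero (by simpa using hξ)
  | succ k =>
    apply Φ.phi_eq_zero_of_ge
    rw [norm_two_zpow_smul, zpow_neg, ← Nat.cast_succ, zpow_natCast,
        le_inv_mul_iff₀ (by positivity),
      ← pow_succ]
    exact hξ

lemma exists_schwartz_kernel (k : ℕ) : ∃ K : SchwartzMap (E d) ℂ, (K : E d → ℂ) = Φ.kernel k ∧
    𝓕 (Φ.kernel k) = fun ξ ↦ ((Φ.symbol k ξ : ℝ) : ℂ) := by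
  have hc : HasCompactSupport fun ξ ↦ ((Φ.symbol k ξ : ℝ) : ℂ) :=
    HasCompactSupport.intro (isCompact_closedBall (0 : E d) (2 ^ (k + 1))) fun ξ hξ ↦ by
      rw [Φ.symbol_eq_zero (not_le.1 (by simpa using hξ)).le, Complex.ofReal_zero]
  obtain ⟨K, h1, h2⟩ := exists_schwartz_fourierInv hc
    (Complex.ofRealCLM.contDiff.comp (Φ.contDiff_symbol k))
  rw [← Φ.kernel_eq] at h1
  exact ⟨K, h1, h1 ▸ h2⟩

lemma integrable_kernel (k : ℕ) : Integrable (Φ.kernel k) := by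
  obtain ⟨K, h, -⟩ := Φ.exists_schwartz_kernel k
  rw [← h]
  exact K.integrable

lemma fourier_kernel (k : ℕ) (ξ : E d) : 𝓕 (Φ.kernel k) ξ = Φ.symbol k ξ := by
  obtain ⟨K, -, h⟩ := Φ.exists_schwartz_kernel k
  rw [h]

lemma hasSum_symbol (ξ : E d) : HasSum (fun k ↦ Φ.symbol k ξ) 1 := by
  rw [← hasSum_nat_add_iff' 1]
  simpa [symbol, lowSymbol] using (Φ.summable_phi ξ).hasSum

end LittlewoodPaley

end LittlewoodPaley

/-! ### Sums in `Lᵖ` -/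

lemma eLpNorm_le_tsum {α V : Type*} [MeasurableSpace α] {μ : Measure α} [NormedAddCommGroup V]
    {p : ℝ≥0∞} (hp : 1 ≤ p) {f : ℕ → α → V} {F : α → V} (hf : ∀ k, AEStronglyMeasurable (f k) μ)
    (hF : ∀ᵐ x ∂μ, HasSum (fun k ↦ f k x) (F x)) : eLpNorm F p μ ≤ ∑' k, eLpNorm (f k) p μ := by
  refine (Lp.eLpNorm_lim_le_liminf_eLpNorm (f := fun n x ↦ ∑ k ∈ Finset.range n, f k x)
    (fun n ↦ Finset.aestronglyMeasurable_fun_sum _ fun k _ ↦ hf k) F ?_).trans ?_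
  · filter_upwards [hF] with x hx using hx.tendsto_sum_nat
  · refine Filter.liminf_le_of_le (by isBoundedDefault) fun b hb ↦ ?_
    obtain ⟨n, hn⟩ := hb.exists
    refine hn.trans (le_trans ?_ (ENNReal.sum_le_tsum (Finset.range n)))
    exact (eLpNorm_congr_ae (by simp [Finset.sum_fn])).trans_le
      (eLpNorm_sum_le (fun k _ ↦ hf k) hp)

/-- A series with summable `Lᵖ` norms converges almost everywhere, and its sum is in `Lᵖ`. -/
lemma memLp_tsum {α V : Type*} [MeasurableSpace α] {μ : Measure α} [NormedAddCommGroup V]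
    [CompleteSpace V] {p : ℝ≥0∞} (hp : 1 ≤ p) {f : ℕ → α → V}
    (hf : ∀ k, AEStronglyMeasurable (f k) μ) (hs : ∑' k, eLpNorm (f k) p μ ≠ ⊤) :
    (∀ᵐ x ∂μ, HasSum (fun k ↦ f k x) (∑' k, f k x)) ∧ MemLp (fun x ↦ ∑' k, f k x) p μ := by
  have hF : ∀ᵐ x ∂μ, HasSum (fun k ↦ f k x) (∑' k, f k x) := by
    filter_upwards [summable_norm_of_tsum_eLpNorm_ne_top hp hf hs] with x hx using
      hx.of_norm.hasSum
  refine ⟨hF, ?_, (eLpNorm_le_tsum hp hf hF).trans_lt hs.lt_top⟩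
  refine aestronglyMeasurable_of_tendsto_ae Filter.atTop
    (f := fun n x ↦ ∑ k ∈ Finset.range n, f k x)
    (fun n ↦ Finset.aestronglyMeasurable_fun_sum _ fun k _ ↦ hf k) ?_
  filter_upwards [hF] with x hx using hx.tendsto_sum_nat

lemma tsum_ofReal_two_rpow_ne_top {s : ℝ} (hs : 0 < s) :
    ∑' k : ℕ, ENNReal.ofReal ((2 : ℝ) ^ (-((k : ℝ) * s))) ≠ ⊤ := by
  have h : ∀ k : ℕ, ENNReal.ofReal ((2 : ℝ) ^ (-((k : ℝ) * s))) =
      (ENNReal.ofReal ((2 : ℝ) ^ (-s))) ^ k := fun k ↦ by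
    rw [← ENNReal.ofReal_pow (by positivity), ← Real.rpow_mul_natCast (by norm_num)]
    congr 2
    ring
  simp only [h, ENNReal.tsum_geometric]
  rw [Ne, ENNReal.inv_eq_top, tsub_eq_zero_iff_le, not_le, ENNReal.ofReal_lt_one]
  exact Real.rpow_lt_one_of_one_lt_of_neg (by norm_num) (by linarith)

lemma PeriodSystem.Inv.ae_sub {G : Type*} [AddCommGroup G] [MeasurableSpace G] {μ : Measure G}
    {S : PeriodSystem μ} {P : G → Prop} (hP : S.Inv P) (h : ∀ᵐ z ∂μ, P z) (ζ : G) :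
    ∀ᵐ z ∂μ, P (z - ζ) := by
  filter_upwards [(S.measurePreserving (-ζ)).quasiMeasurePreserving.ae h] with z hz
  rwa [hP.wrap, ← sub_eq_add_neg] at hz

/-! ### Convolution of a kernel with a periodic function -/

section Conv

variable {d : ℕ}

/-- The convolution over `ℝᵈ` of a kernel and a periodic function. -/
noncomputable def conv (K f : E d → ℂ) (x : E d) : ℂ := ∫ z, K z * f (x - z)

lemma conv_eq_convolution (K f : E d → ℂ) :
    (f ⋆[ContinuousLinearMap.mul ℂ ℂ, volume] K) = conv K f := by
  ext x
  rw [convolution_eq_swap, conv]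
  congr 1
  ext z
  simp [mul_comm]

lemma measurable_conv {K f : E d → ℂ} (hK : Measurable K) (hf : Measurable f) :
    Measurable (conv K f) := by
  have : Measurable fun z : E d × E d ↦ K z.2 * f (z.1 - z.2) :=
    (hK.comp measurable_snd).mul (hf.comp measurable_sub)
  exact this.stronglyMeasurable.integral_prod_right.measurable

lemma isPeriodic_conv (K : E d → ℂ) {f : E d → ℂ} (hf : IsPeriodic f) : IsPeriodic (conv K f) := by
  intro i x
  simp only [conv]
  congr 1
  ext z
  rw [add_sub_right_comm, hf i]

lemma eLpNorm_conv_le {p : ℝ≥0∞} (hp : 1 ≤ p) (hp' : p ≠ ⊤) {K f : E d → ℂ} (hK : Integrable K)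
    (hfm : Measurable f) (hf : IsPeriodic f) :
    eLpNorm (conv K f) p (torusMeasure d) ≤
      (∫⁻ z, ‖K z‖ₑ) * eLpNorm f p (torusMeasure d) := by
  refine eLpNorm_integral_smul_le_const (F := fun x z ↦ f (x - z)) hp hp' hK.1
    (hfm.comp measurable_sub).enorm fun y ↦ ?_
  rw [(torusSystem_inv.2 hf).eLpNorm_sub hfm.aestronglyMeasurable]

lemma ae_integrable_conv {K f : E d → ℂ} (hK : Integrable K) (hfm : Measurable f)
    (hf : IsPeriodic f) (hfi : Integrable f (torusMeasure d)) :
    ∀ᵐ x ∂(torusMeasure d), Integrable fun z ↦ K z * f (x - z) :=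
  (PeriodSystem.integrable_kernel hK hfi hfm (torusSystem_inv.2 hf)).prod_right_ae

lemma eLpNorm_conv_sub_le {p : ℝ≥0∞} (hp : 1 ≤ p) (hp' : p ≠ ⊤) {K f : E d → ℂ}
    (hK : Integrable K)
    (hfm : Measurable f) (hf : IsPeriodic f) (hfi : Integrable f (torusMeasure d)) (y : E d) :
    eLpNorm (fun x ↦ conv K f (x - y) - conv K f x) p (torusMeasure d) ≤
      (∫⁻ z, ‖K (z - y) - K z‖ₑ) * eLpNorm f p (torusMeasure d) := by
  have hKy : Integrable fun z ↦ K (z - y) := hK.comp_sub_right y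
  refine le_trans (le_of_eq ?_)
    (eLpNorm_conv_le hp hp' (K := fun z ↦ K (z - y) - K z) (hKy.sub hK) hfm hf)
  refine eLpNorm_congr_ae ?_
  filter_upwards [ae_integrable_conv hK hfm hf hfi, ae_integrable_conv hKy hfm hf hfi] with x h1 h2
  have h3 : conv K f (x - y) = ∫ z, K (z - y) * f (x - z) := by
    rw [conv, ← integral_sub_right_eq_self _ y]
    simp only [sub_sub_sub_cancel_right]
  rw [h3, conv, ← integral_sub h2 h1, conv]
  simp only [sub_mul]

end Conv

lemma ae_eq_zero_of_coef_eq_zero' {d : ℕ} {f : E d → ℂ}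
    (hf : MemLp f 2 (torusMeasure d)) (h0 : ∀ n, coef f n = 0) : f =ᵐ[torusMeasure d] 0 := by
  have h := hf.1.ae_eq_mk
  refine h.trans (ae_eq_zero_of_coef_eq_zero hf.1.stronglyMeasurable_mk.measurable
    ((memLp_congr_ae h).1 hf) fun n ↦ ?_)
  rw [← h0 n]
  refine integral_congr_ae ?_
  filter_upwards [h] with x hx
  rw [hx]

/-! ### Increments of Besov functions -/

section Besov

variable {d : ℕ} (Φ : LittlewoodPaley d)

namespace LittlewoodPaley

lemma eLpNorm_conv_kernel_le (σ : ℝ) (p : ℝ≥0∞) (f : E d → ℂ) (k : ℕ) :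
    eLpNorm (conv (Φ.kernel k) f) p (torusMeasure d) ≤
      ENNReal.ofReal ((2 : ℝ) ^ (-((k : ℝ) * σ))) * Φ.besovNorm σ p f := by
  rw [← conv_eq_convolution]
  cases k with
  | zero =>
    simp only [CharP.cast_eq_zero, zero_mul, neg_zero, Real.rpow_zero, ENNReal.ofReal_one, one_mul]
    exact le_self_add
  | succ k =>
    have h : ENNReal.ofReal ((2 : ℝ) ^ (((k + 1 : ℕ) : ℝ) * σ)) *
        eLpNorm (f ⋆[ContinuousLinearMap.mul ℂ ℂ, volume] Φ.block (k + 1)) p (torusMeasure d) ≤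
        Φ.besovNorm σ p f := by
      refine le_trans ?_ le_add_self
      exact le_iSup₂ (f := fun (k : ℕ) (_ : 1 ≤ k) ↦ ENNReal.ofReal ((2 : ℝ) ^ ((k : ℝ) * σ)) *
        eLpNorm (f ⋆[ContinuousLinearMap.mul ℂ ℂ, volume] Φ.block k) p (torusMeasure d))
        (k + 1) (by omega)
    calc eLpNorm (f ⋆[ContinuousLinearMap.mul ℂ ℂ, volume] Φ.kernel (k + 1)) p (torusMeasure d)
        = ENNReal.ofReal ((2 : ℝ) ^ (-(((k + 1 : ℕ) : ℝ) * σ))) *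
          (ENNReal.ofReal ((2 : ℝ) ^ (((k + 1 : ℕ) : ℝ) * σ)) *
        eLpNorm (f ⋆[ContinuousLinearMap.mul ℂ ℂ, volume] Φ.block (k + 1)) p (torusMeasure d)) := by
          rw [← mul_assoc, ← ENNReal.ofReal_mul (by positivity), ← Real.rpow_add (by norm_num)]
          simp [kernel]
      _ ≤ _ := by gcongr

/-- A function in the Besov space `B^σ_{3,∞}` has increments of order `θ < σ` in `L³`. The function
is recovered as `∑ₖ χₖ * (f * ϕₖ)`, where `χₖ` is a dilated Schwartz function whose Fourier
transform is `1` on the support of that of `ϕₖ`; this identity is checked on Fourier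
coefficients. -/
lemma exists_increment_le {σ θ : ℝ} (hθ : 0 ≤ θ) (hθ1 : θ ≤ 1) (hσ : θ < σ) :
    ∃ C : ℝ≥0∞, C ≠ ⊤ ∧ ∀ f : E d → ℂ, Measurable f → IsPeriodic f → MemLp f 2 (torusMeasure d) →
      (∀ y, eLpNorm (fun x ↦ f (x - y) - f x) 3 (torusMeasure d) ≤
        C * ENNReal.ofReal (‖y‖ ^ θ) * Φ.besovNorm σ 3 f) ∧
      eLpNorm f 3 (torusMeasure d) ≤ C * Φ.besovNorm σ 3 f := by
  let χ : ContDiffBump (0 : E d) := ⟨2, 3, by norm_num, by norm_num⟩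
  obtain ⟨X, -, hX⟩ := exists_schwartz_fourierInv (h := fun ξ ↦ ((χ ξ : ℝ) : ℂ))
    (χ.hasCompactSupport.comp_left (g := ((↑) : ℝ → ℂ)) Complex.ofReal_zero)
    (Complex.ofRealCLM.contDiff.comp χ.contDiff)
  obtain ⟨C₁, hC₁, hXy⟩ := exists_lintegral_sub_le X hθ hθ1
  set S₀ := ∑' k : ℕ, ENNReal.ofReal ((2 : ℝ) ^ (-((k : ℝ) * σ))) with hS₀
  set S₁ := ∑' k : ℕ, ENNReal.ofReal ((2 : ℝ) ^ (-((k : ℝ) * (σ - θ)))) with hS₁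
  have hS₀t : S₀ ≠ ⊤ := tsum_ofReal_two_rpow_ne_top (by linarith)
  have hS₁t : S₁ ≠ ⊤ := tsum_ofReal_two_rpow_ne_top (by linarith)
  have hX1 : ∫⁻ z, ‖X z‖ₑ ≠ ⊤ := X.integrable.2.ne
  refine ⟨1 + (∫⁻ z, ‖X z‖ₑ) * S₀ + C₁ * S₁, by finiteness, fun f hfm hfp hf2 ↦ ?_⟩
  set B := Φ.besovNorm σ 3 f with hB
  -- if the Besov norm is infinite, the bounds hold trivially, except for `y = 0`
  by_cases hBt : B = ⊤
  · have hne : (1 + (∫⁻ z, ‖X z‖ₑ) * S₀ + C₁ * S₁) ≠ 0 := by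
      rw [add_assoc]
      exact ne_of_gt (lt_of_lt_of_le one_pos le_self_add)
    refine ⟨fun y ↦ ?_, ?_⟩
    · rcases eq_or_ne y 0 with rfl | hy
      · simp
      · rw [hBt, ENNReal.mul_top]
        · exact le_top
        · refine mul_ne_zero hne ?_
          have : 0 < ‖y‖ ^ θ := Real.rpow_pos_of_pos (norm_pos_iff.2 hy) _
          simpa using this
    · rw [hBt, ENNReal.mul_top hne]
      exact le_top
  have hfi : Integrable f (torusMeasure d) := hf2.integrable (by norm_num)
  have hXk : ∀ k, Measurable (dil k (X : E d → ℂ)) := fun k ↦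
    ((X.continuous.comp (continuous_const_smul _)).const_smul _).measurable
  -- the Littlewood--Paley blocks of `f` and their reproductions
  let b : ℕ → E d → ℂ := fun k ↦ conv (Φ.kernel k) f
  let g : ℕ → E d → ℂ := fun k ↦ conv (dil k X) (b k)
  have hKm : ∀ k, Measurable (Φ.kernel k) := fun k ↦ by
    obtain ⟨K, h, -⟩ := Φ.exists_schwartz_kernel k
    rw [← h]
    exact K.continuous.measurable
  have hbm : ∀ k, Measurable (b k) := fun k ↦ measurable_conv (hKm k) hfm
  have hbp : ∀ k, IsPeriodic (b k) := fun k ↦ isPeriodic_conv _ hfp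
  have hb3 : ∀ k, eLpNorm (b k) 3 (torusMeasure d) ≤
      ENNReal.ofReal ((2 : ℝ) ^ (-((k : ℝ) * σ))) * B := Φ.eLpNorm_conv_kernel_le σ 3 f
  have hbL : ∀ k, MemLp (b k) 3 (torusMeasure d) := fun k ↦
    ⟨(hbm k).aestronglyMeasurable, (hb3 k).trans_lt (by finiteness)⟩
  have hbi : ∀ k, Integrable (b k) (torusMeasure d) := fun k ↦ (hbL k).integrable (by norm_num)
  have hgm : ∀ k, Measurable (g k) := fun k ↦ measurable_conv (hXk k) (hbm k)
  have hgp : ∀ k, IsPeriodic (g k) := fun k ↦ isPeriodic_conv _ (hbp k)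
  have hg3 : ∀ k, eLpNorm (g k) 3 (torusMeasure d) ≤
      (∫⁻ z, ‖X z‖ₑ) * (ENNReal.ofReal ((2 : ℝ) ^ (-((k : ℝ) * σ))) * B) := fun k ↦ by
    refine (eLpNorm_conv_le (by norm_num) (by norm_num) (integrable_dil k X.integrable) (hbm k)
      (hbp k)).trans ?_
    rw [lintegral_enorm_dil k X.continuous.aestronglyMeasurable]
    gcongr
    exact hb3 k
  have hsum : ∑' k, eLpNorm (g k) 3 (torusMeasure d) ≤ (∫⁻ z, ‖X z‖ₑ) * S₀ * B := by
    refine (ENNReal.tsum_le_tsum hg3).trans (le_of_eq ?_)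
    rw [ENNReal.tsum_mul_left, ENNReal.tsum_mul_right, mul_assoc]
  have hsum' : ∑' k, eLpNorm (g k) 3 (torusMeasure d) ≠ ⊤ :=
    (hsum.trans_lt (by finiteness)).ne
  let F : E d → ℂ := fun x ↦ ∑' k, g k x
  obtain ⟨hF, hFL⟩ : (∀ᵐ x ∂(torusMeasure d), HasSum (fun k ↦ g k x) (F x)) ∧
      MemLp F 3 (torusMeasure d) :=
    memLp_tsum (by norm_num) (fun k ↦ (hgm k).aestronglyMeasurable) hsum'
  have hF3 : eLpNorm F 3 (torusMeasure d) ≤ (∫⁻ z, ‖X z‖ₑ) * S₀ * B :=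
    (eLpNorm_le_tsum (by norm_num) (fun k ↦ (hgm k).aestronglyMeasurable) hF).trans hsum
  -- by the partition of unity, the reproduced function has the Fourier coefficients of `f`
  have hcoef : ∀ n, coef F n = coef f n := by
    intro n
    have h1 : coef F n = ∫ x, ∑' k, wave n x * g k x ∂(torusMeasure d) := by
      simp only [coef, F, tsum_mul_left]
    rw [h1, integral_tsum]
    · have h2 : ∀ k, ∫ x, wave n x * g k x ∂(torusMeasure d) =
        (Φ.symbol k (freq n) : ℂ) * coef f n := by
        intro k
        have e1 : coef (g k) n = 𝓕 (dil k (X : E d → ℂ)) (freq n) * coef (b k) n :=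
          coef_convolution (integrable_dil k X.integrable) (hbi k) (hbm k) (hbp k) n
        have e2 : coef (b k) n = 𝓕 (Φ.kernel k) (freq n) * coef f n :=
          coef_convolution (Φ.integrable_kernel k) hfi hfm hfp n
        change coef (g k) n = _
        rw [e1, e2, Φ.fourier_kernel, fourier_dil, hX]
        by_cases hs : 2 ^ (k + 1) ≤ ‖freq n‖
        · simp [Φ.symbol_eq_zero hs]
        -- the bump function is `1` on the support of the symbol
        · have : χ (((2 : ℝ) ^ k)⁻¹ • freq n) = 1 := by
            apply χ.one_of_mem_closedBall
            rw [mem_closedBall_zero_iff, norm_smul, norm_inv, norm_pow, Real.norm_ofNat,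
              inv_mul_le_iff₀ (by positivity), ← pow_succ]
            exact (not_le.1 hs).le
          simp [this]
      simp only [h2]
      rw [tsum_mul_right, ← Complex.ofReal_tsum, (Φ.hasSum_symbol _).tsum_eq]
      simp
    · exact fun k ↦ ((contDiff_wave n).continuous.measurable.mul (hgm k)).aestronglyMeasurable
    · refine (lt_of_le_of_lt (ENNReal.tsum_le_tsum fun k ↦ ?_) hsum'.lt_top).ne
      have h2 : ∀ x, ‖wave n x * g k x‖ₑ = ‖g k x‖ₑ := fun x ↦ by
        rw [enorm_mul, ← ofReal_norm, norm_wave, ENNReal.ofReal_one, one_mul]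
      simp only [h2]
      rw [← eLpNorm_one_eq_lintegral_enorm]
      exact eLpNorm_le_eLpNorm_of_exponent_le (by norm_num) (hgm k).aestronglyMeasurable
  have hfF : f =ᵐ[torusMeasure d] F := by
    have hFL2 : MemLp F 2 (torusMeasure d) := hFL.mono_exponent (by norm_num)
    have := ae_eq_zero_of_coef_eq_zero' (hf2.sub hFL2) fun n ↦ by
      have h := coef_sub hfi (hFL.integrable (by norm_num)) n
      rw [hcoef, sub_self] at h
      exact h
    filter_upwards [this] with x hx
    simpa [sub_eq_zero] using hx
  have hfs : ∀ᵐ x ∂(torusMeasure d), HasSum (fun k ↦ g k x) (f x) := by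
    filter_upwards [hF, hfF] with x h1 h2
    rwa [h2]
  refine ⟨fun y ↦ ?_, ?_⟩
  · have hinv : (torusSystem d).Inv fun x ↦ HasSum (fun k ↦ g k x) (f x) := by
      intro x y
      have h1 : ∀ k, g k ((torusSystem d).wrap x + y) = g k (x + y) := fun k ↦
        (torusSystem_inv.2 (hgp k)) x y
      simp only [h1, (torusSystem_inv.2 hfp) x y]
    have hfs' := hinv.ae_sub hfs y
    have hmy : ∀ k, AEStronglyMeasurable (fun x ↦ g k (x - y) - g k x) (torusMeasure d) := fun k ↦
      (((hgm k).comp (measurable_sub_const y)).sub (hgm k)).aestronglyMeasurable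
    calc eLpNorm (fun x ↦ f (x - y) - f x) 3 (torusMeasure d)
        ≤ ∑' k, eLpNorm (fun x ↦ g k (x - y) - g k x) 3 (torusMeasure d) := by
          refine eLpNorm_le_tsum (by norm_num) hmy ?_
          filter_upwards [hfs, hfs'] with x h1 h2 using h2.sub h1
      _ ≤ ∑' k : ℕ, C₁ * ENNReal.ofReal (‖y‖ ^ θ) *
            (ENNReal.ofReal ((2 : ℝ) ^ (-((k : ℝ) * (σ - θ)))) * B) := by
          refine ENNReal.tsum_le_tsum fun k ↦ ?_
          refine (eLpNorm_conv_sub_le (by norm_num) (by norm_num) (integrable_dil k X.integrable)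
            (hbm k) (hbp k) (hbi k) y).trans ?_
          rw [lintegral_enorm_dil_sub k X.continuous]
          refine (mul_le_mul' (hXy _) (hb3 k)).trans (le_of_eq ?_)
          rw [norm_smul, norm_pow, Real.norm_ofNat, Real.mul_rpow (by positivity) (norm_nonneg y),
            ENNReal.ofReal_mul (by positivity)]
          have : ENNReal.ofReal ((2 : ℝ) ^ (-((k : ℝ) * (σ - θ)))) =
              ENNReal.ofReal (((2 : ℝ) ^ k) ^ θ) * ENNReal.ofReal ((2 : ℝ) ^ (-((k : ℝ) * σ))) := by
            rw [← ENNReal.ofReal_mul (by positivity), ← Real.rpow_natCast,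
                ← Real.rpow_mul (by norm_num),
              ← Real.rpow_add (by norm_num)]
            congr 2
            ring
          rw [this]
          ring
      _ = C₁ * S₁ * ENNReal.ofReal (‖y‖ ^ θ) * B := by
          rw [ENNReal.tsum_mul_left, ENNReal.tsum_mul_right]
          ring
      _ ≤ _ := by
          gcongr
          exact le_add_self
  · rw [eLpNorm_congr_ae hfF]
    refine hF3.trans ?_
    gcongr
    rw [add_right_comm]
    exact le_add_self

end LittlewoodPaley

end Besov

/-! ### Jointly measurable representatives -/

section Representative

variable {d : ℕ} {T : ℝ}

lemma spaceTime_eq_restrict : spaceTime d T = (cylinder d).restrict (Ioo 0 T ×ˢ univ) := by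
  rw [cylinder, ← Measure.prod_restrict, Measure.restrict_univ, spaceTime]

lemma eLpNorm_spaceTime {F : Type*} [NormedAddCommGroup F] {f : ℝ × E d → F}
    (hf : ∀ t ∉ Ioo 0 T, ∀ x, f (t, x) = 0) (p : ℝ≥0∞) :
    eLpNorm f p (spaceTime d T) = eLpNorm f p (cylinder d) := by
  rw [spaceTime_eq_restrict]
  refine eLpNorm_restrict_eq_of_support_subset fun z hz ↦ ?_
  by_contra hc
  exact hz (hf z.1 (fun h ↦ hc ⟨h, trivial⟩) z.2)

lemma memLp_cylinder_iff {F : Type*} [NormedAddCommGroup F] {f : ℝ × E d → F}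
    (hm : AEStronglyMeasurable f (cylinder d)) (hf : ∀ t ∉ Ioo 0 T, ∀ x, f (t, x) = 0) {p : ℝ≥0∞} :
    MemLp f p (cylinder d) ↔ MemLp f p (spaceTime d T) := by
  refine ⟨fun h ↦ ?_, fun h ↦ ⟨hm, ?_⟩⟩
  · rw [spaceTime_eq_restrict]
    exact h.restrict _
  · rw [← eLpNorm_spaceTime hf]
    exact h.2

lemma integral_spaceTime {F : Type*} [NormedAddCommGroup F] [NormedSpace ℝ F] {f : ℝ × E d → F}
    (hf : ∀ t ∉ Ioo 0 T, ∀ x, f (t, x) = 0) :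
    ∫ z, f z ∂(spaceTime d T) = ∫ z, f z ∂(cylinder d) := by
  rw [spaceTime_eq_restrict]
  refine setIntegral_eq_integral_of_forall_compl_eq_zero fun z hz ↦ ?_
  exact hf z.1 (fun h ↦ hz ⟨h, trivial⟩) z.2

lemma ae_mem_cell : ∀ᵐ z ∂(spaceTime d T), z.1 ∈ Ioo 0 T ∧ z.2 ∈ cell d := by
  rw [spaceTime, torusMeasure, Measure.prod_restrict]
  exact ae_restrict_mem (measurableSet_Ioo.prod measurableSet_cell)

/-- A measurable field on space-time has a Borel representative which is periodic at all times and
vanishes outside the time interval. -/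
lemma exists_representative {F : Type*} [NormedAddCommGroup F] [MeasurableSpace F] [BorelSpace F]
    {v : ℝ → E d → F} (hv : AEStronglyMeasurable (Function.uncurry v) (spaceTime d T)) :
    ∃ V : ℝ × E d → F, Measurable V ∧ (∀ t, IsPeriodic fun x ↦ V (t, x)) ∧
      (∀ t ∉ Ioo 0 T, ∀ x, V (t, x) = 0) ∧ V =ᵐ[spaceTime d T] Function.uncurry v := by
  classical
  refine ⟨(Ioo 0 T ×ˢ univ).indicator fun z ↦ hv.mk _ (z.1, torusWrap z.2), ?_, ?_, ?_, ?_⟩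
  · refine Measurable.indicator ?_ (measurableSet_Ioo.prod MeasurableSet.univ)
    exact hv.stronglyMeasurable_mk.measurable.comp
      (measurable_fst.prodMk (measurable_torusWrap.comp measurable_snd))
  · intro t
    have := isPeriodic_comp_torusWrap fun x ↦
      (Ioo 0 T ×ˢ univ).indicator (fun z ↦ hv.mk _ (z.1, z.2)) (t, x)
    exact this
  · intro t ht x
    exact indicator_of_notMem (fun h ↦ ht h.1) _
  · filter_upwards [hv.ae_eq_mk, ae_mem_cell] with z hz hc
    rw [indicator_of_mem (show z ∈ Ioo 0 T ×ˢ univ from ⟨hc.1, trivial⟩), torusWrap_of_mem_cell hc.2, hz]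

/-- Periodic functions which agree almost everywhere on the cell agree almost everywhere. -/
lemma ae_eq_volume_of_ae_eq_torus {F : Type*} {f g : E d → F} (hf : IsPeriodic f)
    (hg : IsPeriodic g) (h : f =ᵐ[torusMeasure d] g) : f =ᵐ[volume] g := by
  have : Countable (Submodule.span ℤ (range (stdBasis d))).toAddSubgroup :=
    inferInstanceAs (Countable (Submodule.span ℤ (range (stdBasis d))))
  have hD := ZSpan.isAddFundamentalDomain' (stdBasis d) (volume : Measure (E d))
  rw [← cell_eq_fundamentalDomain] at hD
  refine hD.measure_zero_of_invariant _ (fun γ ↦ ?_) ?_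
  · ext x
    rw [Set.mem_vadd_set_iff_neg_vadd_mem, AddSubgroup.vadd_def, vadd_eq_add, add_comm]
    change ¬ (f (x + (-γ : (Submodule.span ℤ (range (stdBasis d))).toAddSubgroup)) =
      g (x + (-γ : (Submodule.span ℤ (range (stdBasis d))).toAddSubgroup))) ↔ ¬ (f x = g x)
    rw [hf.add_mem_span (-γ).2, hg.add_mem_span (-γ).2]
  · have h' := h
    rw [torusMeasure, Filter.EventuallyEq, ae_iff, Measure.restrict_apply₀'
      measurableSet_cell.nullMeasurableSet] at h'
    exact h'

/-- Fubini for `L³` norms bounded slice by slice; the bound need not be measurable. -/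
lemma eLpNorm_spaceTime_le_of_slices {F : Type*} [NormedAddCommGroup F] {H : ℝ × E d → F}
    (hH : AEStronglyMeasurable H (spaceTime d T)) {c : ℝ≥0∞} (hc : c ≠ ⊤) {b : ℝ → ℝ≥0∞}
    (h : ∀ᵐ t ∂(volume.restrict (Ioo 0 T)),
      eLpNorm (fun x ↦ H (t, x)) 3 (torusMeasure d) ≤ c * b t) :
    eLpNorm H 3 (spaceTime d T) ≤ c * eLpNorm b 3 (volume.restrict (Ioo 0 T)) := by
  have h3 : (3 : ℝ≥0∞).toReal = 3 := by norm_num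
  rw [eLpNorm_eq_lintegral_rpow_enorm_toReal (by norm_num) (by norm_num),
    eLpNorm_eq_lintegral_rpow_enorm_toReal (by norm_num) (by norm_num), h3]
  simp only [enorm_eq_self]
  calc (∫⁻ z, ‖H z‖ₑ ^ (3 : ℝ) ∂(spaceTime d T)) ^ (1 / (3 : ℝ))
      ≤ (∫⁻ t in Ioo 0 T, c ^ (3 : ℝ) * b t ^ (3 : ℝ)) ^ (1 / (3 : ℝ)) := by
        gcongr
        rw [spaceTime, lintegral_prod _ (hH.enorm.pow_const _)]
        refine lintegral_mono_ae ?_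
        filter_upwards [h] with t ht
        rw [← ENNReal.mul_rpow_of_nonneg _ _ (by norm_num)]
        rw [eLpNorm_eq_lintegral_rpow_enorm_toReal (by norm_num) (by norm_num), h3] at ht
        calc ∫⁻ x, ‖H (t, x)‖ₑ ^ (3 : ℝ) ∂(torusMeasure d)
            = ((∫⁻ x, ‖H (t, x)‖ₑ ^ (3 : ℝ) ∂(torusMeasure d)) ^ (1 / (3 : ℝ))) ^ (3 : ℝ) := by
              rw [← ENNReal.rpow_mul, one_div_mul_cancel (by norm_num), ENNReal.rpow_one]
          _ ≤ _ := by gcongr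
    _ = _ := by
        rw [lintegral_const_mul' _ _ (by finiteness),
          ENNReal.mul_rpow_of_nonneg _ _ (by norm_num), ← ENNReal.rpow_mul,
          mul_one_div_cancel (by norm_num), ENNReal.rpow_one]

lemma eLpNorm_le_sum_components {α : Type*} [MeasurableSpace α] {μ : Measure α} {f : α → E d}
    {p : ℝ≥0∞} (hp : 1 ≤ p) (hf : Measurable f) :
    eLpNorm f p μ ≤ ∑ i, eLpNorm (fun x ↦ ((f x i : ℝ) : ℂ)) p μ := by
  have h1 : f = ∑ i, fun x ↦ f x i • (EuclideanSpace.single i (1 : ℝ) : E d) := by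
    ext x j
    simp [Finset.sum_apply, Pi.single_apply]
  calc eLpNorm f p μ = eLpNorm (∑ i, fun x ↦
      f x i • (EuclideanSpace.single i (1 : ℝ) : E d)) p μ := by
        rw [← h1]
    _ ≤ ∑ i, eLpNorm (fun x ↦ f x i • (EuclideanSpace.single i (1 : ℝ) : E d)) p μ := by
        refine eLpNorm_sum_le (fun i _ ↦ ?_) hp
        have : Measurable fun x ↦ f x i := by fun_prop
        exact this.aestronglyMeasurable.smul_const _
    _ = _ := by
        refine Finset.sum_congr rfl fun i _ ↦
            eLpNorm_congr_norm_ae (Filter.Eventually.of_forall fun x ↦ ?_)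
        simp [norm_smul]

end Representative

/-- The properties of the velocity field on which the regularity argument relies: `U` is a
Borel periodic field in `L³`, supported in the time interval `(0,T)`, whose spatial increments are
of order `θ` in `L³`. -/
structure HolderField {d : ℕ} (T θ : ℝ) (U : ℝ × E d → E d) : Prop where
  measurable : Measurable U
  periodic : ∀ t, IsPeriodic fun x ↦ U (t, x)
  eq_zero : ∀ t ∉ Ioo 0 T, ∀ x, U (t, x) = 0
  memLp : MemLp U 3 (cylinder d)
  increment : ∃ C : ℝ≥0∞, C ≠ ⊤ ∧ ∀ y : E d,
    eLpNorm (fun z ↦ U (z - (0, y)) - U z) 3 (cylinder d) ≤ C * ENNReal.ofReal (‖y‖ ^ θ)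

lemma besovNormVec_congr {d : ℕ} (Φ : LittlewoodPaley d) (σ : ℝ) (p : ℝ≥0∞) {f g : E d → E d}
    (h : f =ᵐ[volume] g) : Φ.besovNormVec σ p f = Φ.besovNormVec σ p g := by
  have h1 : ∀ i : Fin d, (fun x ↦ ((f x i : ℝ) : ℂ)) =ᵐ[volume] fun x ↦ ((g x i : ℝ) : ℂ) :=
      fun i ↦ by
    filter_upwards [h] with x hx
    rw [hx]
  have h2 : ∀ (i : Fin d) (K : E d → ℂ),
      ((fun x ↦ ((f x i : ℝ) : ℂ)) ⋆[ContinuousLinearMap.mul ℂ ℂ, volume] K) =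
      ((fun x ↦ ((g x i : ℝ) : ℂ)) ⋆[ContinuousLinearMap.mul ℂ ℂ, volume] K) := fun i K ↦
    convolution_congr _ (h1 i) Filter.EventuallyEq.rfl
  simp only [LittlewoodPaley.besovNormVec, LittlewoodPaley.besovNorm, h2]

/-- The velocity field of the theorem has a representative with Hölder increments in `L³`. -/
lemma exists_holderField {d : ℕ} {T σ θ : ℝ} (Φ : LittlewoodPaley d) (hθ : 0 ≤ θ) (hθ1 : θ ≤ 1)
    (hσ : θ < σ) {u : ℝ → E d → E d} (hup : ∀ t ∈ Ioo 0 T, IsPeriodic (u t))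
    (hu2 : MemLp (Function.uncurry u) 2 (spaceTime d T)) (huB : Φ.MemLpBesov T σ 3 u) :
    ∃ U : ℝ × E d → E d, HolderField T θ U ∧ U =ᵐ[spaceTime d T] Function.uncurry u := by
  obtain ⟨U, hUm, hUp, hU0, hUu⟩ := exists_representative huB.1
  obtain ⟨C, hC, hinc⟩ := Φ.exists_increment_le hθ hθ1 hσ
  have hslice : ∀ᵐ t ∂(volume.restrict (Ioo 0 T)), (fun x ↦ U (t, x)) =ᵐ[torusMeasure d] u t :=
    Measure.ae_ae_of_ae_prod hUu
  have hU2 : MemLp U 2 (spaceTime d T) := (memLp_congr_ae hUu).2 hu2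
  have hslice2 : ∀ᵐ t ∂(volume.restrict (Ioo 0 T)),
      MemLp (fun x ↦ U (t, x)) 2 (torusMeasure d) := by
    have h := hU2.2
    rw [eLpNorm_lt_top_iff_lintegral_rpow_enorm_lt_top (by norm_num) (by norm_num), spaceTime,
      lintegral_prod _ (hUm.enorm.pow_const _).aemeasurable] at h
    have h' := ae_lt_top (Measurable.lintegral_prod_right' (hUm.enorm.pow_const _)) h.ne
    filter_upwards [h'] with t ht
    refine ⟨(hUm.comp measurable_prodMk_left).aestronglyMeasurable, ?_⟩
    rw [eLpNorm_lt_top_iff_lintegral_rpow_enorm_lt_top (by norm_num) (by norm_num)]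
    exact ht
  -- the Besov norm is defined by convolutions, hence does not see the choice of representative
  have hbesov : ∀ᵐ t ∂(volume.restrict (Ioo 0 T)),
      Φ.besovNormVec σ 3 (fun x ↦ U (t, x)) = Φ.besovNormVec σ 3 (u t) := by
    filter_upwards [hslice, ae_restrict_mem measurableSet_Ioo] with t ht hI
    exact besovNormVec_congr Φ σ 3 (ae_eq_volume_of_ae_eq_torus (hUp t) (hup t hI) ht)
  have hB := huB.2
  set N := eLpNorm (fun t ↦ Φ.besovNormVec σ 3 (u t)) 3 (volume.restrict (Ioo 0 T)) with hN
  -- the components of a time slice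
  have hcomp : ∀ᵐ t ∂(volume.restrict (Ioo 0 T)), ∀ i : Fin d,
      (∀ y, eLpNorm (fun x ↦ ((U (t, x - y) i : ℝ) : ℂ) -
          ((U (t, x) i : ℝ) : ℂ)) 3 (torusMeasure d) ≤
        C * ENNReal.ofReal (‖y‖ ^ θ) * Φ.besovNorm σ 3 fun x ↦ ((U (t, x) i : ℝ) : ℂ)) ∧
      eLpNorm (fun x ↦ ((U (t, x) i : ℝ) : ℂ)) 3 (torusMeasure d) ≤
        C * Φ.besovNorm σ 3 fun x ↦ ((U (t, x) i : ℝ) : ℂ) := by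
    filter_upwards [hslice2] with t ht i
    have hm : Measurable fun x ↦ U (t, x) := hUm.comp measurable_prodMk_left
    refine hinc (fun x ↦ ((U (t, x) i : ℝ) : ℂ)) ?_ ?_ ?_
    · exact Complex.measurable_ofReal.comp (by fun_prop)
    · intro j x
      have := hUp t j x
      simp only at this ⊢
      rw [this]
    · refine MemLp.of_le ht ?_ (Filter.Eventually.of_forall fun x ↦ ?_)
      · exact (Complex.measurable_ofReal.comp (by fun_prop)).aestronglyMeasurable
      · simpa using PiLp.norm_apply_le (U (t, x)) i
  refine ⟨U, ⟨hUm, hUp, hU0, ⟨hUm.aestronglyMeasurable, ?_⟩, C * N, by finiteness, fun y ↦ ?_⟩, hUu⟩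
  · rw [← eLpNorm_spaceTime hU0]
    refine (eLpNorm_spaceTime_le_of_slices (c := C) (b := fun t ↦ Φ.besovNormVec σ 3 (u t))
      hUm.aestronglyMeasurable hC ?_).trans_lt (by finiteness)
    filter_upwards [hcomp, hbesov] with t h1 h2
    rw [← h2]
    refine (eLpNorm_le_sum_components (by norm_num) (hUm.comp measurable_prodMk_left)).trans ?_
    rw [LittlewoodPaley.besovNormVec, Finset.mul_sum]
    exact Finset.sum_le_sum fun i _ ↦ (h1 i).2
  · have hmy : Measurable fun z : ℝ × E d ↦ U (z - (0, y)) - U z :=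
      (hUm.comp (measurable_sub_const _)).sub hUm
    rw [← eLpNorm_spaceTime (T := T)]
    · refine (eLpNorm_spaceTime_le_of_slices (c := C * ENNReal.ofReal (‖y‖ ^ θ))
        (b := fun t ↦ Φ.besovNormVec σ 3 (u t)) hmy.aestronglyMeasurable (by finiteness) ?_).trans
        (le_of_eq (by rw [← hN]; ring))
      filter_upwards [hcomp, hbesov] with t h1 h2
      rw [← h2]
      refine (eLpNorm_le_sum_components (by norm_num) (hmy.comp measurable_prodMk_left)).trans ?_
      rw [LittlewoodPaley.besovNormVec, Finset.mul_sum]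
      refine Finset.sum_le_sum fun i _ ↦ le_trans (le_of_eq ?_) ((h1 i).1 y)
      congr 1
      ext x
      simp
    · intro t ht x
      simp [hU0 t ht]

/-! ### Test functions on space-time -/

section Test

variable {d : ℕ} {F : Type} [NormedAddCommGroup F] [NormedSpace ℝ F] {a b : ℝ}

/-- Smooth functions on space-time, periodic in space and vanishing outside the time
interval `[a,b]`. -/
structure CylTest (a b : ℝ) (h : ℝ × E d → F) : Prop where
  smooth : ContDiff ℝ ∞ h
  periodic : ∀ t, IsPeriodic fun x ↦ h (t, x)
  eq_zero : ∀ t ∉ Icc a b, ∀ x, h (t, x) = 0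

/-- The derivative of a function on space-time in the direction `v`. -/
noncomputable def pd (v : ℝ × E d) (h : ℝ × E d → F) (z : ℝ × E d) : F := fderiv ℝ h z v

/-- The `i`-th spatial direction in space-time. -/
noncomputable def ex (i : Fin d) : ℝ × E d := (0, EuclideanSpace.single i 1)

/-- The time direction in space-time. -/
def et : ℝ × E d := (1, 0)

lemma norm_le_of_mem_cell {x : E d} (hx : x ∈ cell d) : ‖x‖ ≤ √d := by
  rw [EuclideanSpace.norm_eq]
  refine Real.sqrt_le_sqrt ?_
  calc ∑ i, ‖x i‖ ^ 2 ≤ ∑ i : Fin d, (1 : ℝ) := by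
        refine Finset.sum_le_sum fun i _ ↦ ?_
        have := hx i
        rw [Real.norm_of_nonneg this.1]
        nlinarith [this.1, this.2]
    _ = d := by simp

namespace CylTest

variable {h : ℝ × E d → F}

lemma inv (hh : CylTest a b h) : (cylinderSystem d).Inv h := cylinderSystem_inv.2 hh.periodic

lemma exists_bound (hh : CylTest a b h) : ∃ C, ∀ z, ‖h z‖ ≤ C := by
  have hK : IsCompact (Icc a b ×ˢ Metric.closedBall (0 : E d) (√d)) :=
    isCompact_Icc.prod (isCompact_closedBall _ _)
  obtain ⟨C, hC⟩ := hK.exists_bound_of_continuousOn hh.smooth.continuous.continuousOn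
  refine ⟨max C 0, fun z ↦ ?_⟩
  by_cases ht : z.1 ∈ Icc a b
  · have h1 := hh.inv.wrap z
    rw [← h1]
    refine (hC ((cylinderSystem d).wrap z) ⟨ht, ?_⟩).trans (le_max_left _ _)
    rw [mem_closedBall_zero_iff]
    exact norm_le_of_mem_cell (torusWrap_mem_cell z.2)
  · rw [show h z = 0 from hh.eq_zero z.1 ht z.2, norm_zero]
    exact le_max_right _ _

lemma fderiv (hh : CylTest a b h) : CylTest a b (fderiv ℝ h) where
  smooth := hh.smooth.fderiv_right (by simp)
  periodic t i x := by
    have h1 : (fun z ↦ h (z + ex i)) = h := by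
      ext z
      have := hh.periodic z.1 i z.2
      simp only at this
      rw [← this]
      congr 1
      ext <;> simp [ex]
    have h2 := fderiv_comp_add_right (𝕜 := ℝ) (f := h) (x := (t, x)) (ex i)
    rw [h1] at h2
    simp only
    rw [h2]
    congr 1
    ext <;> simp [ex]
  eq_zero t ht x := by
    have h1 : h =ᶠ[nhds (t, x)] fun _ ↦ 0 := by
      filter_upwards [(isClosed_Icc.isOpen_compl.preimage continuous_fst).mem_nhds ht] with z hz
      exact hh.eq_zero z.1 hz z.2
    rw [h1.fderiv_eq, fderiv_fun_const]
    rfl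

lemma clm_comp {F' : Type} [NormedAddCommGroup F'] [NormedSpace ℝ F'] (hh : CylTest a b h)
    (L : F →L[ℝ] F') : CylTest a b fun z ↦ L (h z) where
  smooth := L.contDiff.comp hh.smooth
  periodic t i x := by
    have := hh.periodic t i x
    simp only at this ⊢
    rw [this]
  eq_zero t ht x := by rw [hh.eq_zero t ht x, map_zero]

lemma pd (hh : CylTest a b h) (v : ℝ × E d) : CylTest a b (pd v h) :=
  hh.fderiv.clm_comp (ContinuousLinearMap.apply ℝ F v)

lemma add {g : ℝ × E d → F} (hh : CylTest a b h) (hg : CylTest a b g) :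
    CylTest a b fun z ↦ h z + g z where
  smooth := hh.smooth.add hg.smooth
  periodic t i x := by
    have h1 := hh.periodic t i x
    have h2 := hg.periodic t i x
    simp only at h1 h2 ⊢
    rw [h1, h2]
  eq_zero t ht x := by rw [hh.eq_zero t ht x, hg.eq_zero t ht x, add_zero]

lemma sum {ι : Type*} {s : Finset ι} {h : ι → ℝ × E d → F} (hh : ∀ i, CylTest a b (h i)) :
    CylTest a b fun z ↦ ∑ i ∈ s, h i z where
  smooth := ContDiff.sum fun i _ ↦ (hh i).smooth
  periodic t j x := by
    have h1 : ∀ i, _ := fun i ↦ (hh i).periodic t j x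
    simp only at h1 ⊢
    simp only [h1]
  eq_zero t ht x := by simp only [fun i ↦ (hh i).eq_zero t ht x, Finset.sum_const_zero]

lemma measurable [MeasurableSpace F] [BorelSpace F] (hh : CylTest a b h) : Measurable h :=
  hh.smooth.continuous.measurable

lemma aestronglyMeasurable_comp {α : Type*} [MeasurableSpace α] {ν : Measure α} (hh : CylTest a b h)
    {g : α → ℝ × E d} (hg : Measurable g) : AEStronglyMeasurable (fun x ↦ h (g x)) ν :=
  (hh.smooth.continuous.stronglyMeasurable.comp_measurable hg).aestronglyMeasurable

lemma pd_comm (hh : CylTest a b h) (v w : ℝ × E d) :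
    EulerTorus.pd v (EulerTorus.pd w h) = EulerTorus.pd w (EulerTorus.pd v h) := by
  have hs : ∀ v w z, EulerTorus.pd v (EulerTorus.pd w h) z =
      _root_.fderiv ℝ (_root_.fderiv ℝ h) z v w := by
    intro v w z
    have hd : DifferentiableAt ℝ (_root_.fderiv ℝ h) z :=
      (hh.fderiv.smooth.differentiable (by simp)) z
    change _root_.fderiv ℝ (fun z ↦ _root_.fderiv ℝ h z w) z v = _
    rw [fderiv_clm_apply hd (differentiableAt_const _)]
    simp
  ext z
  rw [hs, hs]
  have : IsSymmSndFDerivAt ℝ h z :=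
      (hh.smooth.contDiffAt).isSymmSndFDerivAt (by simp; exact WithTop.coe_le_coe.2 le_top)
  exact this v w

lemma integrable_smul (hh : CylTest a b h) {N : E d → ℝ} (hN : Integrable N) (z : ℝ × E d) :
    Integrable fun y ↦ N y • h (z - (0, y)) := by
  obtain ⟨C, hC⟩ := hh.exists_bound
  exact hN.smul_bdd C (hh.aestronglyMeasurable_comp (by fun_prop))
    (Filter.Eventually.of_forall fun y ↦ hC _)

end CylTest

/-- Convolution in the space variable with a kernel on `ℝᵈ`. -/
noncomputable def spConv (N : E d → ℝ) (h : ℝ × E d → F) (z : ℝ × E d) : F :=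
  ∫ y, N y • h (z - (0, y))

namespace CylTest

variable {h : ℝ × E d → F} {N : E d → ℝ}

lemma hasFDerivAt_spConv (hh : CylTest a b h) (hN : Integrable N) (z : ℝ × E d) :
    HasFDerivAt (spConv N h) (spConv N (_root_.fderiv ℝ h) z) z := by
  obtain ⟨C, hC⟩ := hh.fderiv.exists_bound
  refine hasFDerivAt_integral_of_dominated_of_fderiv_le (s := univ)
    (F := fun z y ↦ N y • h (z - (0, y))) (F' := fun z y ↦ N y • _root_.fderiv ℝ h (z - (0, y)))
    (bound := fun y ↦ ‖N y‖ * C) Filter.univ_mem ?_ ?_ ?_ ?_ ?_ ?_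
  · exact Filter.Eventually.of_forall fun z ↦ (hh.integrable_smul hN z).1
  · exact hh.integrable_smul hN z
  · exact (hh.fderiv.integrable_smul hN z).1
  · refine Filter.Eventually.of_forall fun y z _ ↦ ?_
    rw [norm_smul]
    gcongr
    exact hC _
  · exact hN.norm.mul_const C
  · refine Filter.Eventually.of_forall fun y z _ ↦ ?_
    have h1 : HasFDerivAt (fun z : ℝ × E d ↦ z - (0, y)) (ContinuousLinearMap.id ℝ _) z :=
      (hasFDerivAt_id z).sub_const _
    have h2 := ((hh.smooth.differentiable (by simp)) (z - (0, y))).hasFDerivAt.comp z h1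
    exact h2.const_smul (N y)

lemma contDiff_spConv_nat (hN : Integrable N) (n : ℕ) : ∀ {F : Type} [NormedAddCommGroup F]
    [NormedSpace ℝ F] {h : ℝ × E d → F}, CylTest a b h → ContDiff ℝ n (spConv N h) := by
  induction n with
  | zero =>
    intro F _ _ h hh
    rw [Nat.cast_zero, contDiff_zero, continuous_iff_continuousAt]
    exact fun z ↦ (hh.hasFDerivAt_spConv hN z).continuousAt
  | succ n ih =>
    intro F _ _ h hh
    rw [Nat.cast_succ, contDiff_succ_iff_fderiv]
    refine ⟨fun z ↦ (hh.hasFDerivAt_spConv hN z).differentiableAt, by simp, ?_⟩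
    rw [funext fun z ↦ (hh.hasFDerivAt_spConv hN z).fderiv]
    exact ih hh.fderiv

/-- Spatial convolution with an integrable kernel preserves test functions. -/
lemma spConv (hh : CylTest a b h) (hN : Integrable N) : CylTest a b (spConv N h) where
  smooth := contDiff_infty.2 fun n ↦ contDiff_spConv_nat hN n hh
  periodic t i x := by
    simp only [EulerTorus.spConv]
    congr 1
    ext y
    have := hh.periodic t i (x - y)
    simp only [Prod.mk_sub_mk, sub_zero, add_sub_right_comm] at this ⊢
    rw [this]
  eq_zero t ht x := by
    simp [EulerTorus.spConv, hh.eq_zero t ht]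

lemma pd_spConv (hh : CylTest a b h) (hN : Integrable N) (v : ℝ × E d) :
    EulerTorus.pd v (EulerTorus.spConv N h) = EulerTorus.spConv N (EulerTorus.pd v h) := by
  ext z
  rw [EulerTorus.pd, (hh.hasFDerivAt_spConv hN z).fderiv, EulerTorus.spConv,
    ContinuousLinearMap.integral_apply (hh.fderiv.integrable_smul hN z)]
  rfl

end CylTest

end Test

/-! ### Derivatives and Fourier coefficients -/

section FourierDeriv

variable {d : ℕ}

lemma exists_bound_of_periodic {F : Type*} [NormedAddCommGroup F] {g : E d → F}
    (hg : Continuous g) (hp : IsPeriodic g) : ∃ C, ∀ x, ‖g x‖ ≤ C := by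
  obtain ⟨C, hC⟩ := (isCompact_closedBall (0 : E d) (√d)).exists_bound_of_continuousOn hg.continuousOn
  refine ⟨C, fun x ↦ ?_⟩
  rw [← (torusSystem_inv.2 hp).wrap x]
  apply hC
  rw [mem_closedBall_zero_iff]
  exact norm_le_of_mem_cell (torusWrap_mem_cell x)

lemma IsPeriodic.fderiv {F : Type*} [NormedAddCommGroup F] [NormedSpace ℝ F] {g : E d → F}
    (hp : IsPeriodic g) : IsPeriodic (fderiv ℝ g) := by
  intro i x
  have h2 := fderiv_comp_add_right (𝕜 := ℝ) (f := g) (x := x) (EuclideanSpace.single i 1)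
  rw [show (fun x ↦ g (x + EuclideanSpace.single i 1)) = g from funext (hp i)] at h2
  exact h2.symm

lemma memLp_of_periodic {F : Type*} [NormedAddCommGroup F] {g : E d → F}
    (hg : Continuous g) (hp : IsPeriodic g) (p : ℝ≥0∞) : MemLp g p (torusMeasure d) := by
  obtain ⟨C, hC⟩ := exists_bound_of_periodic hg hp
  exact (memLp_top_of_bound hg.aestronglyMeasurable C (Filter.Eventually.of_forall hC)).mono_exponent
    le_top

lemma integrable_of_periodic {F : Type*} [NormedAddCommGroup F] {g : E d → F}
    (hg : Continuous g) (hp : IsPeriodic g) : Integrable g (torusMeasure d) :=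
  memLp_one_iff_integrable.1 (memLp_of_periodic hg hp 1)

/-- The derivatives of a periodic function have mean zero. -/
lemma integral_fderiv_eq_zero {F : Type*} [NormedAddCommGroup F] [NormedSpace ℝ F] [CompleteSpace F]
    {g : E d → F} (hg : ContDiff ℝ 1 g) (hp : IsPeriodic g) (v : E d) :
    ∫ x, fderiv ℝ g x v ∂(torusMeasure d) = 0 := by
  have hc : Continuous fun x ↦ fderiv ℝ g x v :=
      (hg.continuous_fderiv (by simp)).clm_apply continuous_const
  have hpv : IsPeriodic fun x ↦ fderiv ℝ g x v := fun i x ↦ by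
    have := hp.fderiv i x
    simp only [this]
  obtain ⟨C, hC⟩ := exists_bound_of_periodic hc hpv
  have hpt : ∀ x, g (x + v) - g x = ∫ s in Ioc (0 : ℝ) 1, fderiv ℝ g (x + s • v) v := by
    intro x
    have hd : ∀ s : ℝ, HasDerivAt (fun s : ℝ ↦ g (x + s • v)) (fderiv ℝ g (x + s • v) v) s := by
      intro s
      have h1 : HasDerivAt (fun s : ℝ ↦ x + s • v) v s := by
        simpa using ((hasDerivAt_id s).smul_const v).const_add x
      exact ((hg.differentiable (by simp)) (x + s • v)).hasFDerivAt.comp_hasDerivAt s h1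
    have hi := intervalIntegral.integral_eq_sub_of_hasDerivAt (a := 0) (b := 1) (fun s _ ↦ hd s)
      ((hc.comp (by fun_prop : Continuous fun s : ℝ ↦ x + s • v)).intervalIntegrable 0 1)
    rw [intervalIntegral.integral_of_le zero_le_one] at hi
    simpa using hi.symm
  have h0 : ∫ x, (g (x + v) - g x) ∂(torusMeasure d) = 0 := by
    have hgi := integrable_of_periodic hg.continuous hp
    have hinv := torusSystem_inv.2 hp
    rw [integral_sub (hinv.integrable_add hgi v) hgi, hinv.integral_add hgi.1 v, sub_self]
  simp only [hpt] at h0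
  rw [integral_integral_swap] at h0
  · have h1 : ∀ s : ℝ, ∫ x, fderiv ℝ g (x + s • v) v ∂(torusMeasure d) =
        ∫ x, fderiv ℝ g x v ∂(torusMeasure d) := fun s ↦
      (torusSystem_inv.2 hpv).integral_add hc.aestronglyMeasurable (s • v)
    simp only [h1] at h0
    simpa using h0
  · have hm : Continuous fun z : E d × ℝ ↦ fderiv ℝ g (z.1 + z.2 • v) v :=
      hc.comp (by fun_prop : Continuous fun z : E d × ℝ ↦ z.1 + z.2 • v)
    exact Integrable.of_bound hm.aestronglyMeasurable C (Filter.Eventually.of_forall fun z ↦ hC _)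

lemma hasFDerivAt_wave (n : Fin d → ℤ) (x v : E d) :
    fderiv ℝ (wave n) x v = -(2 * Real.pi * inner ℝ v (freq n) : ℝ) * Complex.I * wave n x := by
  have h1 : HasFDerivAt (fun x : E d ↦
      (((-(2 * Real.pi * inner ℝ x (freq n)) : ℝ) : ℂ) * Complex.I))
      ((Complex.ofRealCLM.comp
        (-((2 * Real.pi) • (innerSL ℝ (freq n))))).smulRight Complex.I) x := by
    have h2 : HasFDerivAt (fun x : E d ↦ -(2 * Real.pi * inner ℝ x (freq n)))
        (-((2 * Real.pi) • (innerSL ℝ (freq n)))) x := by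
      have h3 := ((innerSL ℝ (freq n)).hasFDerivAt (x := x)).const_smul (2 * Real.pi)
      refine h3.neg.congr_of_eventuallyEq (Filter.Eventually.of_forall fun y ↦ ?_)
      simp [real_inner_comm]
    have h4 := (Complex.ofRealCLM.hasFDerivAt.comp x h2).smul_const Complex.I
    exact h4
  have h5 := h1.cexp
  rw [← funext (wave_eq_exp n)] at h5
  rw [h5.fderiv, ← wave_eq_exp]
  simp [real_inner_comm]
  ring

/-- Integration by parts for Fourier coefficients. -/
lemma coef_fderiv {g : E d → ℂ} (hg : ContDiff ℝ 1 g) (hp : IsPeriodic g) (v : E d)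
    (n : Fin d → ℤ) :
    coef (fun x ↦ fderiv ℝ g x v) n =
        (2 * Real.pi * inner ℝ v (freq n) : ℝ) * Complex.I * coef g n := by
  have hw : ContDiff ℝ 1 (wave n) := (contDiff_wave n).of_le (by simp)
  have h0 := integral_fderiv_eq_zero (hw.mul hg) (fun i x ↦ by
    simp only [wave_periodic n i x, hp i x]) v
  have hc : Continuous fun x ↦ fderiv ℝ g x v :=
      (hg.continuous_fderiv (by simp)).clm_apply continuous_const
  have hpv : IsPeriodic fun x ↦ fderiv ℝ g x v := fun i x ↦ by
    have := hp.fderiv i x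
    simp only [this]
  have h1 : ∀ x, fderiv ℝ (fun x ↦ wave n x * g x) x v = wave n x * fderiv ℝ g x v -
      (2 * Real.pi * inner ℝ v (freq n) : ℝ) * Complex.I * (wave n x * g x) := by
    intro x
    rw [fderiv_fun_mul ((hw.differentiable (by simp)) x) ((hg.differentiable (by simp)) x)]
    simp only [add_apply, smul_apply, smul_eq_mul,
      hasFDerivAt_wave]
    ring
  simp only [h1] at h0
  rw [integral_sub (integrable_wave_mul (integrable_of_periodic hc hpv) n)
    ((integrable_wave_mul (integrable_of_periodic hg.continuous hp) n).const_mul _),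
    integral_const_mul, sub_eq_zero] at h0
  exact h0

end FourierDeriv

/-! ### The Green kernel of the periodic Laplacian -/

section Green

variable {d : ℕ}

/-- The spatial Laplacian of a function on space-time. -/
noncomputable def spLap (h : ℝ × E d → ℝ) (z : ℝ × E d) : ℝ := ∑ i, pd (ex i) (pd (ex i) h) z

/-- The `k`-th dyadic block of a kernel which is homogeneous of order `-2` in frequency. -/
noncomputable def greenBlock {F : Type*} [NormedAddCommGroup F] [NormedSpace ℝ F] (N₀ : E d → F)
    (k : ℕ) (x : E d) : F := ((4 : ℝ) ^ k)⁻¹ • dil k N₀ x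

lemma integrable_greenBlock {F : Type*} [NormedAddCommGroup F] [NormedSpace ℝ F] {N₀ : E d → F}
    (h : Integrable N₀) (k : ℕ) : Integrable (greenBlock N₀ k) :=
  (integrable_dil k h).smul _

lemma eLpNorm_greenBlock {F : Type*} [NormedAddCommGroup F] [NormedSpace ℝ F] {N₀ : E d → F}
    (h : Integrable N₀) (k : ℕ) :
    eLpNorm (greenBlock N₀ k) 1 volume = ENNReal.ofReal (((4 : ℝ) ^ k)⁻¹) * ∫⁻ x, ‖N₀ x‖ₑ := by
  rw [← lintegral_enorm_dil k h.1]
  have : greenBlock N₀ k = ((4 : ℝ) ^ k)⁻¹ • dil k N₀ := rfl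
  rw [this, eLpNorm_const_smul, eLpNorm_one_eq_lintegral_enorm,
      Real.enorm_of_nonneg (by positivity)]

lemma tsum_eLpNorm_greenBlock_ne_top {F : Type*} [NormedAddCommGroup F] [NormedSpace ℝ F]
    {N₀ : E d → F} (h : Integrable N₀) : ∑' k, eLpNorm (greenBlock N₀ k) 1 volume ≠ ⊤ := by
  simp only [eLpNorm_greenBlock h, ENNReal.tsum_mul_right]
  refine ENNReal.mul_ne_top ?_ h.2.ne
  have := tsum_ofReal_two_rpow_ne_top (s := 2) (by norm_num)
  convert this using 4 with k
  rw [Real.rpow_neg (by norm_num), mul_comm, Real.rpow_mul (by norm_num), Real.rpow_natCast]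
  norm_num

lemma memLp_tsum_greenBlock {F : Type*} [NormedAddCommGroup F] [NormedSpace ℝ F] [CompleteSpace F]
    {N₀ : E d → F} (h : Integrable N₀) :
    (∀ᵐ x, HasSum (fun k ↦ greenBlock N₀ k x) (∑' k, greenBlock N₀ k x)) ∧
      Integrable fun x ↦ ∑' k, greenBlock N₀ k x := by
  have := memLp_tsum le_rfl (fun k ↦ (integrable_greenBlock h k).1)
    (tsum_eLpNorm_greenBlock_ne_top h)
  exact ⟨this.1, memLp_one_iff_integrable.1 this.2⟩

lemma summable_integral_norm_greenBlock {F : Type*} [NormedAddCommGroup F] [NormedSpace ℝ F]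
    {N₀ : E d → F} (h : Integrable N₀) : Summable fun k ↦ ∫ x, ‖greenBlock N₀ k x‖ := by
  have h1 : ∀ k, ∫ x, ‖greenBlock N₀ k x‖ = (eLpNorm (greenBlock N₀ k) 1 volume).toReal :=
      fun k ↦ by
    rw [eLpNorm_one_eq_lintegral_enorm,
        integral_norm_eq_lintegral_enorm (integrable_greenBlock h k).1]
  simp only [h1]
  exact ENNReal.summable_toReal (tsum_eLpNorm_greenBlock_ne_top h)

lemma fourier_smul' (c : ℝ) (K : E d → ℂ) (ξ : E d) : 𝓕 (fun x ↦ c • K x) ξ = c • 𝓕 K ξ := by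
  rw [Real.fourier_eq, Real.fourier_eq, ← integral_smul]
  congr 1
  ext x
  rw [smul_comm]

lemma fourier_tsum_greenBlock {K₀ : E d → ℂ} (h : Integrable K₀) (ξ : E d) :
    HasSum (fun k : ℕ ↦ ((4 : ℝ) ^ k)⁻¹ • 𝓕 K₀ (((2 : ℝ) ^ k)⁻¹ • ξ))
      (𝓕 (fun x ↦ ∑' k, greenBlock K₀ k x) ξ) := by
  have h1 : ∀ k : ℕ, ((4 : ℝ) ^ k)⁻¹ • 𝓕 K₀ (((2 : ℝ) ^ k)⁻¹ • ξ) = 𝓕 (greenBlock K₀ k) ξ :=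
      fun k ↦ by
    rw [← fourier_dil, ← fourier_smul']
    rfl
  rw [funext h1]
  have hi : ∀ k, Integrable fun x : E d ↦ Real.fourierChar (-inner ℝ x ξ) • greenBlock K₀ k x :=
      fun k ↦
    (Real.fourierIntegral_convergent_iff ξ).2 (integrable_greenBlock h k)
  have := hasSum_integral_of_summable_integral_norm hi (by
    simpa using summable_integral_norm_greenBlock h)
  simp only [← Real.fourier_eq] at this
  refine (congrArg (HasSum _) ?_).mp this
  rw [Real.fourier_eq]
  refine integral_congr_ae ?_
  filter_upwards [(memLp_tsum_greenBlock h).1] with x hx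
  simp only [Circle.smul_def]
  exact (hx.const_smul (Real.fourierChar (-inner ℝ x ξ) : ℂ)).tsum_eq

end Green

section Symbol

variable {d : ℕ}

lemma LittlewoodPaley.contDiff_greenSymbol (Φ : LittlewoodPaley d) :
    ContDiff ℝ ∞ fun ξ ↦ ((-(Φ.ϕ ξ) / (4 * Real.pi ^ 2 * ‖ξ‖ ^ 2) : ℝ) : ℂ) := by
  refine Complex.ofRealCLM.contDiff.comp (contDiff_iff_contDiffAt.2 fun ξ ↦ ?_)
  rcases lt_or_ge ‖ξ‖ (1 / 2) with h | h
  · refine (contDiffAt_const (c := (0 : ℝ))).congr_of_eventuallyEq ?_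
    filter_upwards [(isOpen_lt continuous_norm continuous_const).mem_nhds h] with η hη
    rw [Φ.phi_eq_zero_of_le (le_of_lt hη), neg_zero]
    exact zero_div _
  · have hξ : ξ ≠ 0 := by rintro rfl; norm_num at h
    refine Φ.smooth.neg.contDiffAt.div (contDiff_const.mul (contDiff_norm_sq ℝ)).contDiffAt ?_
    have := norm_pos_iff.2 hξ
    positivity

lemma one_le_norm_freq {n : Fin d → ℤ} (hn : n ≠ 0) : 1 ≤ ‖freq n‖ := by
  obtain ⟨i, hi⟩ := Function.ne_iff.1 hn
  refine le_trans ?_ (PiLp.norm_apply_le (freq n) i)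
  rw [freq_apply, Real.norm_eq_abs]
  exact_mod_cast Int.one_le_abs hi

/-- There is a kernel, a sum of dyadic blocks of a Schwartz function, whose Fourier
transform is `-1 / (4π²|n|²)` at nonzero integer frequencies. -/
lemma LittlewoodPaley.exists_complex_green (Φ : LittlewoodPaley d) :
    ∃ K₀ : SchwartzMap (E d) ℂ, ∀ n : Fin d → ℤ, n ≠ 0 →
    𝓕 (fun x ↦ ∑' k, greenBlock K₀ k x) (freq n) = (-(4 * Real.pi ^ 2 * ‖freq n‖ ^ 2)⁻¹ : ℝ) := by
  obtain ⟨K₀, -, hK⟩ := exists_schwartz_fourierInv (h := fun ξ ↦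
      ((-(Φ.ϕ ξ) / (4 * Real.pi ^ 2 * ‖ξ‖ ^ 2) : ℝ) : ℂ))
    (HasCompactSupport.intro (isCompact_closedBall (0 : E d) 2) fun ξ hξ ↦ by
      rw [Φ.phi_eq_zero_of_ge (not_le.1 (by simpa using hξ)).le]
      simp) Φ.contDiff_greenSymbol
  refine ⟨K₀, fun n hn ↦ ?_⟩
  have h1 := one_le_norm_freq hn
  refine (fourier_tsum_greenBlock K₀.integrable (freq n)).unique ?_
  have h2 := (Φ.hasSum_phi_nat h1).mul_left (-(4 * Real.pi ^ 2 * ‖freq n‖ ^ 2)⁻¹)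
  rw [mul_one] at h2
  have h3 := h2.mapL Complex.ofRealCLM
  simp only [Complex.ofRealCLM_apply] at h3
  convert h3 using 2 with k
  rw [hK, Complex.real_smul]
  simp only [zpow_neg, zpow_natCast]
  rw [← Complex.ofReal_mul]
  congr 1
  rw [norm_smul, norm_inv, norm_pow, Real.norm_ofNat, mul_pow, inv_pow, ← pow_mul, mul_comm k 2,
      pow_mul]
  norm_num
  field_simp

end Symbol

section Inverse

variable {d : ℕ} {a b : ℝ}

lemma fderiv_slice {F : Type} [NormedAddCommGroup F] [NormedSpace ℝ F] {h : ℝ × E d → F}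
    (hh : Differentiable ℝ h) (t : ℝ) (x v : E d) :
    fderiv ℝ (fun x ↦ h (t, x)) x v = pd (0, v) h (t, x) := by
  have h1 : HasFDerivAt (fun x : E d ↦ (t, x)) (ContinuousLinearMap.inr ℝ ℝ (E d)) x :=
    hasFDerivAt_prodMk_right t x
  have h2 : HasFDerivAt (fun x ↦ h (t, x)) _ x := (hh (t, x)).hasFDerivAt.comp x h1
  rw [h2.fderiv]
  simp [pd]

lemma CylTest.differentiable {F : Type} [NormedAddCommGroup F] [NormedSpace ℝ F] {h : ℝ × E d → F}
    (hh : CylTest a b h) : Differentiable ℝ h := hh.smooth.differentiable (by simp)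

lemma CylTest.contDiff_slice {F : Type} [NormedAddCommGroup F] [NormedSpace ℝ F] {h : ℝ × E d → F}
    (hh : CylTest a b h) (t : ℝ) : ContDiff ℝ ∞ fun x ↦ h (t, x) :=
  hh.smooth.comp (contDiff_const.prodMk contDiff_id)

lemma inner_single_freq (i : Fin d) (n : Fin d → ℤ) :
    inner ℝ (EuclideanSpace.single i (1 : ℝ) : E d) (freq n) = n i := by
  simp [EuclideanSpace.inner_single_left]

lemma CylTest.coef_pd {h : ℝ × E d → ℝ} (hh : CylTest a b h) (t : ℝ) (i : Fin d) (n : Fin d → ℤ) :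
    coef (fun x ↦ ((EulerTorus.pd (ex i) h (t, x) : ℝ) : ℂ)) n =
      (2 * Real.pi * n i : ℝ) * Complex.I * coef (fun x ↦ ((h (t, x) : ℝ) : ℂ)) n := by
  have hc := hh.clm_comp Complex.ofRealCLM
  have h1 := coef_fderiv (g := fun x ↦ ((h (t, x) : ℝ) : ℂ)) ((hc.contDiff_slice t).of_le (by simp))
    (hc.periodic t) (EuclideanSpace.single i 1) n
  rw [inner_single_freq] at h1
  rw [← h1]
  congr 1
  ext x
  have h2 := fderiv_slice hc.differentiable t x (EuclideanSpace.single i 1)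
  refine Eq.trans ?_ h2.symm
  rw [EulerTorus.pd, EulerTorus.pd]
  have := (Complex.ofRealCLM.hasFDerivAt.comp (t, x) (hh.differentiable (t, x)).hasFDerivAt).fderiv
  rw [Function.comp_def] at this
  rw [this]
  rfl

lemma norm_freq_sq (n : Fin d → ℤ) : ‖freq n‖ ^ 2 = ∑ i, (n i : ℝ) ^ 2 := by
  simp [EuclideanSpace.norm_sq_eq]

lemma CylTest.spLap {h : ℝ × E d → ℝ} (hh : CylTest a b h) : CylTest a b (spLap h) :=
  CylTest.sum fun i ↦ (hh.pd (ex i)).pd (ex i)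

lemma CylTest.memLp_slice {F : Type} [NormedAddCommGroup F] [NormedSpace ℝ F] {h : ℝ × E d → F}
    (hh : CylTest a b h) (t : ℝ) (p : ℝ≥0∞) : MemLp (fun x ↦ h (t, x)) p (torusMeasure d) :=
  memLp_of_periodic (hh.contDiff_slice t).continuous (hh.periodic t) p

lemma CylTest.integrable_slice {F : Type} [NormedAddCommGroup F] [NormedSpace ℝ F] {h : ℝ × E d → F}
    (hh : CylTest a b h) (t : ℝ) : Integrable (fun x ↦ h (t, x)) (torusMeasure d) :=
  memLp_one_iff_integrable.1 (hh.memLp_slice t 1)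

lemma CylTest.coef_spLap {h : ℝ × E d → ℝ} (hh : CylTest a b h) (t : ℝ) (n : Fin d → ℤ) :
    coef (fun x ↦ ((EulerTorus.spLap h (t, x) : ℝ) : ℂ)) n =
      (-(4 * Real.pi ^ 2 * ‖freq n‖ ^ 2) : ℝ) * coef (fun x ↦ ((h (t, x) : ℝ) : ℂ)) n := by
  have h1 : coef (fun x ↦ ((EulerTorus.spLap h (t, x) : ℝ) : ℂ)) n =
      ∑ i, coef (fun x ↦ ((EulerTorus.pd (ex i) (EulerTorus.pd (ex i) h) (t, x) : ℝ) : ℂ)) n := by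
    simp only [coef, EulerTorus.spLap, Complex.ofReal_sum, Finset.mul_sum]
    exact integral_finsetSum _ fun i _ ↦ integrable_wave_mul
      (((hh.pd (ex i)).pd (ex i)).integrable_slice t).ofReal n
  simp only [h1, (hh.pd _).coef_pd, hh.coef_pd, norm_freq_sq, Finset.mul_sum,
    ← Finset.sum_neg_distrib, Complex.ofReal_sum, Finset.sum_mul]
  refine Finset.sum_congr rfl fun i _ ↦ ?_
  push_cast
  linear_combination (2 * Real.pi * n i : ℂ) ^ 2 * coef (fun x ↦ ((h (t, x) : ℝ) : ℂ)) n *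
      Complex.I_sq

/-- The dyadic blocks of the Green kernel, and the fact that convolution with the Green kernel
inverts the Laplacian on periodic test functions whose spatial means vanish. -/
lemma LittlewoodPaley.exists_green (Φ : LittlewoodPaley d) :
    ∃ (N₀ : SchwartzMap (E d) ℝ) (N : E d → ℝ), Integrable N ∧
      (∀ᵐ x, HasSum (fun k ↦ greenBlock N₀ k x) (N x)) ∧
      ∀ (a b : ℝ) (h : ℝ × E d → ℝ), CylTest a b h →
        (∀ t, ∫ x, h (t, x) ∂(torusMeasure d) = 0) → spConv N (EulerTorus.spLap h) = h := by
  obtain ⟨K₀, hK⟩ := Φ.exists_complex_green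
  obtain ⟨hs, hi⟩ := memLp_tsum_greenBlock K₀.integrable
  set K : E d → ℂ := fun x ↦ ∑' k, greenBlock K₀ k x with hKdef
  refine ⟨SchwartzMap.postcompCLM Complex.reCLM K₀, fun x ↦ (K x).re, hi.re, ?_, ?_⟩
  · filter_upwards [hs] with x hx
    refine (hx.mapL Complex.reCLM).congr_fun ?_
    intro k
    simp only [greenBlock, dil, SchwartzMap.postcompCLM_apply, Complex.reCLM_apply, Complex.smul_re]
  intro a b h hh h0
  have hL := hh.spLap
  ext ⟨t, x⟩
  have hm : Measurable fun x ↦ ((EulerTorus.spLap h (t, x) : ℝ) : ℂ) :=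
    (hL.clm_comp Complex.ofRealCLM).measurable.comp measurable_prodMk_left
  have hp : IsPeriodic fun x ↦ ((EulerTorus.spLap h (t, x) : ℝ) : ℂ) :=
    (hL.clm_comp Complex.ofRealCLM).periodic t
  have hL2 := (hL.clm_comp Complex.ofRealCLM).memLp_slice t 2
  have hD : MemLp (conv K fun x ↦ ((EulerTorus.spLap h (t, x) : ℝ) : ℂ)) 2 (torusMeasure d) := by
    refine ⟨?_, (eLpNorm_conv_le (by norm_num) (by norm_num) hi hm hp).trans_lt ?_⟩
    · exact (PeriodSystem.integrable_kernel hi (hL.integrable_slice t).ofReal hm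
        (torusSystem_inv.2 hp)).integral_prod_left.1
    · exact ENNReal.mul_lt_top hi.2 hL2.2
  have hz := ae_eq_zero_of_coef_eq_zero' (f := fun x ↦
      conv K (fun x ↦ ((EulerTorus.spLap h (t, x) : ℝ) : ℂ)) x - ((h (t, x) : ℝ) : ℂ))
    (hD.sub ((hh.clm_comp Complex.ofRealCLM).memLp_slice t 2)) fun n ↦ by
      refine (coef_sub (hD.integrable (by norm_num)) (hh.integrable_slice t).ofReal n).trans ?_
      change coef (conv K fun x ↦ ((EulerTorus.spLap h (t, x) : ℝ) : ℂ)) n -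
        coef (fun x ↦ ((h (t, x) : ℝ) : ℂ)) n = 0
      have h1 : coef (conv K fun x ↦ ((EulerTorus.spLap h (t, x) : ℝ) : ℂ)) n =
          𝓕 K (freq n) * coef (fun x ↦ ((EulerTorus.spLap h (t, x) : ℝ) : ℂ)) n :=
        coef_convolution hi (hL.integrable_slice t).ofReal hm hp n
      rw [h1, hh.coef_spLap]
      by_cases hn : n = 0
      -- the Fourier multiplier `𝓕 K 0` plays no role, since both means vanish
      · have : coef (fun x ↦ ((h (t, x) : ℝ) : ℂ)) n = 0 := by
          have hw : ∀ x : E d, wave n x = 1 := fun x ↦ by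
            rw [wave_eq_exp, inner_freq]
            simp [hn]
          simp only [coef, hw, one_mul]
          rw [integral_complex_ofReal, h0, Complex.ofReal_zero]
        rw [this]
        simp
      · rw [hK n hn, ← mul_assoc, ← Complex.ofReal_mul]
        have := one_le_norm_freq hn
        have h2 : -(4 * Real.pi ^ 2 * ‖freq n‖ ^ 2)⁻¹ * -(4 * Real.pi ^ 2 * ‖freq n‖ ^ 2) = 1 := by
          have hpi := Real.pi_pos
          field_simp
        rw [h2, Complex.ofReal_one, one_mul, sub_self]
  have hC := hL.spConv hi.re
  have hre : (fun x ↦ spConv (fun x ↦ (K x).re) (EulerTorus.spLap h) (t, x)) =ᵐ[torusMeasure d]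
      fun x ↦ h (t, x) := by
    filter_upwards [hz] with x hx
    have h1 : spConv (fun x ↦ (K x).re) (EulerTorus.spLap h) (t, x) =
        (conv K (fun x ↦ ((EulerTorus.spLap h (t, x) : ℝ) : ℂ)) x).re := by
      rw [conv, spConv]
      have hint : Integrable fun z ↦ K z * ((EulerTorus.spLap h (t, x - z) : ℝ) : ℂ) := by
        obtain ⟨C, hC⟩ := (hL.clm_comp Complex.ofRealCLM).exists_bound
        exact hi.mul_bdd (c := C) ((hL.clm_comp Complex.ofRealCLM).aestronglyMeasurable_comp
          (g := fun z ↦ (t, x - z)) (by fun_prop)) (Filter.Eventually.of_forall fun y ↦ hC _)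
      refine Eq.trans ?_ (integral_re hint)
      refine integral_congr_ae (Filter.Eventually.of_forall fun y ↦ ?_)
      simp
    rw [h1]
    have := sub_eq_zero.1 hx
    rw [this, Complex.ofReal_re]
  have h2 := ae_eq_volume_of_ae_eq_torus (hC.periodic t) (hh.periodic t) hre
  exact congrFun ((Continuous.ae_eq_iff_eq volume (hC.contDiff_slice t).continuous
    (hh.contDiff_slice t).continuous).1 h2) x

end Inverse

/-! ### Duality for convolutions -/

namespace PeriodSystem

variable {G : Type*} [AddCommGroup G] [MeasurableSpace G] [MeasurableSub₂ G] {μ ν : Measure G}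
  [SFinite μ] [SFinite ν] {S : PeriodSystem μ}

/-- Pairing with a convolution is an average of correlations. -/
lemma integral_mul_kernel (p q : ℝ≥0∞) [ENNReal.HolderTriple p q 1] {K A B : G → ℝ}
    (hK : Integrable K ν) (hA : MemLp A p μ) (hB : MemLp B q μ) (hBm : Measurable B)
    (hBi : S.Inv B) :
    ∫ z, A z * ∫ ζ, K ζ * B (z - ζ) ∂ν ∂μ = ∫ ζ, K ζ * ∫ z, A z * B (z - ζ) ∂μ ∂ν := by
  simp only [← integral_const_mul]
  rw [integral_integral_swap]
  · simp only [mul_left_comm]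
  · have := integrable_kernel_mul p q hK hA hB hBm hBi
    refine this.congr (Filter.Eventually.of_forall fun z ↦ ?_)
    simp only [Function.uncurry]
    ring

end PeriodSystem

section Duality

variable {d : ℕ}

lemma spConv_eq_integral_map (K : E d → ℝ) (B : ℝ × E d → ℝ) (z : ℝ × E d) :
    spConv K B z = ∫ ζ, K ζ.2 * B (z - ζ) ∂(volume.map fun y : E d ↦ ((0 : ℝ), y)) := by
  rw [MeasurableEmbedding.integral_map (measurableEmbedding_prodMk_left 0)]
  rfl

lemma integral_mul_spConv (p q : ℝ≥0∞) [ENNReal.HolderTriple p q 1] {K : E d → ℝ}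
    (hK : Integrable K) {A B : ℝ × E d → ℝ} (hA : MemLp A p (cylinder d))
    (hB : MemLp B q (cylinder d)) (hBm : Measurable B) (hBi : (cylinderSystem d).Inv B) :
    ∫ z, A z * spConv K B z ∂(cylinder d) = ∫ y, K y * ∫ z, A z * B (z - (0, y)) ∂(cylinder d) := by
  simp only [spConv_eq_integral_map]
  have hK' : Integrable (fun ζ : ℝ × E d ↦ K ζ.2) (volume.map fun y : E d ↦ ((0 : ℝ), y)) :=
    (MeasurableEmbedding.integrable_map_iff (measurableEmbedding_prodMk_left 0)).2 hK
  rw [PeriodSystem.integral_mul_kernel p q hK' hA hB hBm hBi,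
    MeasurableEmbedding.integral_map (measurableEmbedding_prodMk_left 0)]

/-- The adjoint of a spatial convolution is the convolution with the reflected kernel. -/
lemma integral_spConv_mul (p q : ℝ≥0∞) [ENNReal.HolderTriple p q 1] [ENNReal.HolderTriple q p 1]
    {K : E d → ℝ}
    (hK : Integrable K) {A B : ℝ × E d → ℝ} (hA : MemLp A p (cylinder d))
    (hB : MemLp B q (cylinder d)) (hAm : Measurable A) (hBm : Measurable B)
    (hAi : (cylinderSystem d).Inv A) (hBi : (cylinderSystem d).Inv B) :
    ∫ z, spConv (fun y ↦ K (-y)) A z * B z ∂(cylinder d) =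
      ∫ z, A z * spConv K B z ∂(cylinder d) := by
  rw [integral_mul_spConv p q hK hA hB hBm hBi]
  have h1 := integral_mul_spConv q p hK.comp_neg hB hA hAm hAi
  simp only [mul_comm (B _)] at h1
  rw [h1, ← integral_neg_eq_self (fun y ↦ K y * ∫ z, A z * B (z - (0, y)) ∂(cylinder d))]
  refine integral_congr_ae (Filter.Eventually.of_forall fun y ↦ ?_)
  simp only
  congr 1
  have := (hBi.mul (hAi.shift_sub (0, y))).integral_add
    (hBm.mul (hAm.comp (measurable_sub_const _))).aestronglyMeasurable ((0 : ℝ), y)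
  simp only [mul_comm (B _)] at this
  rw [← this]
  refine integral_congr_ae (Filter.Eventually.of_forall fun z ↦ ?_)
  simp only [add_sub_cancel_right]
  rw [show z - (0, -y) = z + (0, y) by ext <;> simp]

end Duality

/-! ### Kernels of mean zero acting on Hölder continuous functions -/

section Riesz

variable {d : ℕ} {T θ : ℝ}

/-- Scalar functions in `L^{3/2}`, supported in the time interval `(0,T)`, whose spatial increments
are of order `θ` in `L^{3/2}`. -/
structure HolderScalar (T θ : ℝ) (W : ℝ × E d → ℝ) : Prop where
  measurable : Measurable W
  periodic : ∀ t, IsPeriodic fun x ↦ W (t, x)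
  eq_zero : ∀ t ∉ Ioo 0 T, ∀ x, W (t, x) = 0
  memLp : MemLp W (3 / 2) (cylinder d)
  increment : ∃ C : ℝ≥0∞, C ≠ ⊤ ∧ ∀ y : E d,
    eLpNorm (fun z ↦ W (z - (0, y)) - W z) (3 / 2) (cylinder d) ≤ C * ENNReal.ofReal (‖y‖ ^ θ)

lemma measurable_spConv {K : E d → ℝ} (hK : Measurable K) {W : ℝ × E d → ℝ} (hW : Measurable W) :
    Measurable (spConv K W) := by
  have : Measurable fun z : (ℝ × E d) × E d ↦ K z.2 * W (z.1 - (0, z.2)) :=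
    (hK.comp measurable_snd).mul (hW.comp (by fun_prop))
  exact this.stronglyMeasurable.integral_prod_right.measurable

lemma isPeriodic_spConv (K : E d → ℝ) {W : ℝ × E d → ℝ} (hW : ∀ t, IsPeriodic fun x ↦ W (t, x))
    (t : ℝ) : IsPeriodic fun x ↦ spConv K W (t, x) := by
  intro i x
  simp only [spConv]
  congr 1
  ext y
  have := hW t i (x - y)
  simp only [Prod.mk_sub_mk, sub_zero, add_sub_right_comm] at this ⊢
  rw [this]

lemma integral_dil_eq_zero {K : E d → ℝ} (h0 : ∫ y, K y = 0) (k : ℕ) : ∫ y, dil k K y = 0 := by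
  simp only [dil]
  rw [integral_smul, Measure.integral_comp_smul, h0, smul_zero, smul_zero]

lemma one_le_three_halves : (1 : ℝ≥0∞) ≤ 3 / 2 := by
  rw [ENNReal.le_div_iff_mul_le (by simp) (by simp)]
  norm_num

/-- A dilated kernel of mean zero gains the factor `2^{-kθ}` on functions with increments of
order `θ`. -/
lemma HolderScalar.exists_eLpNorm_spConv_le {W : ℝ × E d → ℝ} (hW : HolderScalar T θ W)
    {K : E d → ℝ} (hKi : Integrable K) (h0 : ∫ y, K y = 0)
    (hK : ∫⁻ y, ‖K y‖ₑ * ENNReal.ofReal (‖y‖ ^ (θ * (3 / 2))) ≠ ⊤) :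
    ∃ C : ℝ≥0∞, C ≠ ⊤ ∧ ∀ k, eLpNorm (spConv (dil k K) W) (3 / 2) (cylinder d) ≤
      C * ENNReal.ofReal ((2 : ℝ) ^ (-((k : ℝ) * θ))) := by
  obtain ⟨C, hC, hinc⟩ := hW.increment
  have h32 : (3 / 2 : ℝ≥0∞).toReal = 3 / 2 := by simp
  have hp1 := one_le_three_halves
  have hp2 : (3 / 2 : ℝ≥0∞) ≠ ⊤ := ENNReal.div_ne_top (by simp) (by simp)
  refine ⟨((∫⁻ y, ‖K y‖ₑ) ^ (1 / 2 : ℝ) *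
    ((∫⁻ y, ‖K y‖ₑ * ENNReal.ofReal (‖y‖ ^ (θ * (3 / 2)))) * C ^ (3 / 2 : ℝ))) ^ (2 / 3 : ℝ),
        ?_, ?_⟩
  · have := hKi.2.ne
    finiteness
  intro k
  have hdi := integrable_dil k hKi
  have hd0 := integral_dil_eq_zero h0 k
  have hpt : spConv (dil k K) W = fun z ↦ ∫ y, dil k K y • (W (z - (0, y)) - W z) := by
    ext z
    have hc : Integrable fun y ↦ dil k K y • W z := hdi.smul_const _
    by_cases hi : Integrable fun y ↦ dil k K y • W (z - (0, y))
    · simp only [smul_sub]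
      rw [integral_sub hi hc, integral_smul_const, hd0, zero_smul, sub_zero]
      rfl
    -- where the convolution diverges, both integrals are zero by convention
    · rw [spConv, integral_undef hi, integral_undef]
      intro h
      apply hi
      refine (h.add hc).congr (Filter.Eventually.of_forall fun y ↦ ?_)
      simp only [Pi.add_apply, smul_sub, sub_add_cancel]
  rw [hpt]
  refine (eLpNorm_integral_smul_le hp1 hp2 hdi.1 (F := fun z y ↦ W (z - (0, y)) - W z) ?_
    hinc).trans (le_of_eq ?_)
  · exact ((hW.measurable.comp (by fun_prop)).sub (hW.measurable.comp measurable_fst)).enorm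
  rw [h32]
  have e1 : ∀ y : E d, (C * ENNReal.ofReal (‖y‖ ^ θ)) ^ (3 / 2 : ℝ) =
      C ^ (3 / 2 : ℝ) * ENNReal.ofReal (‖y‖ ^ (θ * (3 / 2))) := fun y ↦ by
    rw [ENNReal.mul_rpow_of_nonneg _ _ (by norm_num), ENNReal.ofReal_rpow_of_nonneg (by positivity)
      (by norm_num), ← Real.rpow_mul (norm_nonneg y)]
  simp only [e1]
  rw [lintegral_enorm_dil k hKi.1, lintegral_enorm_dil_mul k hKi.1 (by fun_prop)]
  have e2 : ∀ y : E d, ‖K y‖ₑ * (C ^ (3 / 2 : ℝ) *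
      ENNReal.ofReal (‖((2 : ℝ) ^ k)⁻¹ • y‖ ^ (θ * (3 / 2)))) =
      (C ^ (3 / 2 : ℝ) * ENNReal.ofReal (((2 : ℝ) ^ (-((k : ℝ) * θ))) ^ (3 / 2 : ℝ))) *
        (‖K y‖ₑ * ENNReal.ofReal (‖y‖ ^ (θ * (3 / 2)))) := fun y ↦ by
    rw [norm_smul, Real.mul_rpow (by positivity) (by positivity),
        ENNReal.ofReal_mul (by positivity)]
    have : ‖((2 : ℝ) ^ k)⁻¹‖ ^ (θ * (3 / 2)) = ((2 : ℝ) ^ (-((k : ℝ) * θ))) ^ (3 / 2 : ℝ) := by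
      rw [norm_inv, norm_pow, Real.norm_ofNat, ← Real.rpow_natCast, ← Real.rpow_neg (by norm_num),
        ← Real.rpow_mul (by norm_num), ← Real.rpow_mul (by norm_num)]
      congr 1
      ring
    rw [this]
    ring
  simp only [e2]
  rw [lintegral_const_mul' _ _ (by finiteness)]
  have e3 : ENNReal.ofReal ((2 : ℝ) ^ (-((k : ℝ) * θ))) =
      (ENNReal.ofReal (((2 : ℝ) ^ (-((k : ℝ) * θ))) ^ (3 / 2 : ℝ))) ^ (2 / 3 : ℝ) := by
    rw [ENNReal.ofReal_rpow_of_nonneg (by positivity) (by norm_num),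
        ← Real.rpow_mul (by positivity)]
    norm_num
  rw [e3, ← ENNReal.mul_rpow_of_nonneg _ _ (by norm_num)]
  congr 1
  · rw [show (3 / 2 - 1 : ℝ) = 1 / 2 by norm_num]
    ring
  · norm_num

instance : IsFiniteMeasure (spaceTime d T) := by
  unfold spaceTime
  infer_instance

/-- On a bounded time interval the `Lᵖ` norms control the `L¹` norm. -/
lemma exists_eLpNorm_one_le (d : ℕ) (T : ℝ) {p : ℝ≥0∞} (hp : 1 ≤ p) : ∃ c : ℝ≥0∞, c ≠ ⊤ ∧
    ∀ f : ℝ × E d → ℝ, AEStronglyMeasurable f (cylinder d) →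
      (∀ t ∉ Ioo 0 T, ∀ x, f (t, x) = 0) →
      eLpNorm f 1 (cylinder d) ≤ c * eLpNorm f p (cylinder d) := by
  refine ⟨spaceTime d T univ ^ (1 / (1 : ℝ≥0∞).toReal - 1 / p.toReal), ?_, fun f hf h0 ↦ ?_⟩
  · refine (ENNReal.rpow_lt_top_of_nonneg ?_ (measure_ne_top _ _)).ne
    rw [ENNReal.toReal_one, div_one, sub_nonneg]
    by_cases hp' : p = ⊤
    · simp [hp']
    have : 1 ≤ p.toReal := by simpa using ENNReal.toReal_mono hp' hp
    exact (div_le_one (by linarith)).2 this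
  · rw [← eLpNorm_spaceTime h0, ← eLpNorm_spaceTime h0, mul_comm]
    refine eLpNorm_le_eLpNorm_mul_rpow_measure_univ hp ?_
    rw [spaceTime_eq_restrict]
    exact hf.restrict

lemma MemLp.integrable_cylinder {p : ℝ≥0∞} (hp : 1 ≤ p) {f : ℝ × E d → ℝ}
    (hf : MemLp f p (cylinder d)) (h0 : ∀ t ∉ Ioo 0 T, ∀ x, f (t, x) = 0) :
    Integrable f (cylinder d) := by
  obtain ⟨c, hc, h⟩ := exists_eLpNorm_one_le d T hp
  exact memLp_one_iff_integrable.1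
    ⟨hf.1, (h f hf.1 h0).trans_lt (ENNReal.mul_lt_top hc.lt_top hf.2)⟩

open LineDeriv in
lemma fderiv_dil (N : SchwartzMap (E d) ℝ) (k : ℕ) (y v : E d) :
    fderiv ℝ (dil k N) y v = (2 : ℝ) ^ k * dil k (⇑(∂_{v} N : SchwartzMap (E d) ℝ)) y := by
  have h1 : HasFDerivAt (fun y : E d ↦ (2 : ℝ) ^ k • y)
      ((2 : ℝ) ^ k • ContinuousLinearMap.id ℝ (E d)) y :=
    (hasFDerivAt_id (𝕜 := ℝ) y).const_smul ((2 : ℝ) ^ k)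
  have h2 : HasFDerivAt (dil k N) _ y :=
    ((N.differentiableAt (x := (2 : ℝ) ^ k • y)).hasFDerivAt.comp y h1).const_smul
      (((2 : ℝ) ^ k) ^ d)
  rw [h2.fderiv]
  simp only [dil, SchwartzMap.lineDerivOp_apply_eq_fderiv]
  simp
  ring

open LineDeriv in
/-- Integration by parts moves derivatives from the kernel onto the test function. -/
lemma CylTest.spConv_dil_lineDeriv {a b : ℝ} {g : ℝ × E d → ℝ} (hg : CylTest a b g)
    (N : SchwartzMap (E d) ℝ) (k : ℕ) (v : E d) :
    EulerTorus.spConv (dil k (⇑(∂_{v} N : SchwartzMap (E d) ℝ))) g =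
      fun z ↦ ((2 : ℝ) ^ k)⁻¹ * EulerTorus.spConv (dil k N) (EulerTorus.pd (0, v) g) z := by
  ext z
  have hd : ∀ y, HasFDerivAt (fun y : E d ↦ g (z - (0, y)))
      ((_root_.fderiv ℝ g (z - (0, y))).comp (-(ContinuousLinearMap.inr ℝ ℝ (E d)))) y := fun y ↦ by
    have h1 : HasFDerivAt (fun y : E d ↦ z - ((0 : ℝ), y))
        (-(ContinuousLinearMap.inr ℝ ℝ (E d))) y :=
      (hasFDerivAt_prodMk_right (0 : ℝ) y).const_sub z
    exact (hg.differentiable _).hasFDerivAt.comp y h1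
  have hv : ∀ y, _root_.fderiv ℝ (fun y : E d ↦ g (z - (0, y))) y v =
      -EulerTorus.pd (0, v) g (z - (0, y)) := fun y ↦ by
    rw [(hd y).fderiv]
    simp [EulerTorus.pd]
  have hN := integrable_dil k (N.integrable (μ := volume))
  have hN' := integrable_dil k ((∂_{v} N : SchwartzMap (E d) ℝ).integrable (μ := volume))
  have h := integral_mul_fderiv_eq_neg_fderiv_mul_of_integrable (μ := (volume : Measure (E d)))
    (f := dil k N) (g := fun y ↦ g (z - (0, y))) (v := v) ?_ ?_ ?_ ?_ ?_
  · simp only [hv, fderiv_dil, mul_neg, mul_assoc, integral_neg, neg_inj] at h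
    rw [integral_const_mul] at h
    rw [EulerTorus.spConv, EulerTorus.spConv]
    simp only [smul_eq_mul]
    rw [h, inv_mul_cancel_left₀ (by positivity)]
  · simp only [fderiv_dil, mul_assoc]
    exact (hg.integrable_smul hN' z).const_mul _
  · simp only [hv, mul_neg]
    exact ((hg.pd _).integrable_smul hN z).neg
  · exact hg.integrable_smul hN z
  · exact fun y _ ↦ ((N.differentiable.comp (by fun_prop : Differentiable ℝ fun y : E d ↦
      (2 : ℝ) ^ k • y)).const_smul (((2 : ℝ) ^ k) ^ d)) y
  · exact fun y _ ↦ (hd y).differentiableAt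

open LineDeriv in
lemma integral_lineDeriv (N : SchwartzMap (E d) ℝ) (v : E d) :
    ∫ y, (∂_{v} N : SchwartzMap (E d) ℝ) y = 0 := by
  have h := integral_mul_fderiv_eq_neg_fderiv_mul_of_integrable (μ := (volume : Measure (E d)))
    (f := fun _ ↦ 1) (g := N) (v := v) (by simp) ?_ (by simpa using N.integrable) (by fun_prop)
    (fun y _ ↦ N.differentiableAt)
  · simpa [SchwartzMap.lineDerivOp_apply_eq_fderiv] using h
  · simp only [one_mul, ← SchwartzMap.lineDerivOp_apply_eq_fderiv]
    exact (∂_{v} N : SchwartzMap (E d) ℝ).integrable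

lemma lintegral_schwartz_mul_rpow_ne_top (N : SchwartzMap (E d) ℝ) {s : ℝ} (hs : 0 ≤ s)
    (hs2 : s ≤ 2) : ∫⁻ y, ‖N y‖ₑ * ENNReal.ofReal (‖y‖ ^ s) ≠ ⊤ := by
  have h1 : Integrable fun y ↦ ‖y‖ ^ 0 * ‖N y‖ + ‖y‖ ^ 2 * ‖N y‖ :=
    (N.integrable_pow_mul volume 0).add (N.integrable_pow_mul volume 2)
  refine ne_top_of_le_ne_top h1.2.ne (lintegral_mono fun y ↦ ?_)
  rw [← ofReal_norm, ← ofReal_norm, ← ENNReal.ofReal_mul (norm_nonneg _)]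
  refine ENNReal.ofReal_le_ofReal ?_
  have h2 : 0 ≤ ‖y‖ ^ 0 * ‖N y‖ + ‖y‖ ^ 2 * ‖N y‖ := by positivity
  rw [Real.norm_of_nonneg h2, ← add_mul, mul_comm]
  refine mul_le_mul_of_nonneg_right ?_ (norm_nonneg _)
  rcases le_total ‖y‖ 1 with h | h
  · have := Real.rpow_le_one (norm_nonneg y) h hs
    nlinarith [sq_nonneg ‖y‖]
  · have := Real.rpow_le_rpow_of_exponent_le h hs2
    rw [Real.rpow_two] at this
    simp only [pow_zero]
    linarith

lemma CylTest.memLp_top {a b : ℝ} {F : Type} [NormedAddCommGroup F] [NormedSpace ℝ F]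
    {h : ℝ × E d → F} (hh : CylTest a b h) : MemLp h ⊤ (cylinder d) := by
  obtain ⟨C, hC⟩ := hh.exists_bound
  exact memLp_top_of_bound (hh.aestronglyMeasurable_comp measurable_id) C
    (Filter.Eventually.of_forall hC)

lemma spLap_pd_pd {a b : ℝ} {φ : ℝ × E d → ℝ} (hφ : CylTest a b φ) (v w : ℝ × E d) :
    spLap (pd v (pd w φ)) = pd v (pd w (spLap φ)) := by
  have h1 : ∀ v {φ : ℝ × E d → ℝ}, CylTest a b φ → pd v (spLap φ) = spLap (pd v φ) := by
    intro v φ hφ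
    ext z
    have h2 : HasFDerivAt (spLap φ) (∑ i, fderiv ℝ (pd (ex i) (pd (ex i) φ)) z) z :=
      HasFDerivAt.fun_sum fun i _ ↦ (((hφ.pd _).pd _).differentiable z).hasFDerivAt
    rw [pd, h2.fderiv, spLap, FunLike.coe_sum, Finset.sum_apply]
    refine Finset.sum_congr rfl fun i _ ↦ ?_
    change pd v (pd (ex i) (pd (ex i) φ)) z = _
    rw [(hφ.pd (ex i)).pd_comm v (ex i), hφ.pd_comm v (ex i)]
  rw [h1 w hφ, h1 v (hφ.pd w)]

/-- Slices of convolutions with kernels of mean zero have mean zero. -/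
lemma integral_slice_spConv_eq_zero {K : E d → ℝ} (hK : Integrable K) (h0 : ∫ y, K y = 0)
    {W : ℝ × E d → ℝ} (hWm : Measurable W) (hW : ∀ t, IsPeriodic fun x ↦ W (t, x)) {t : ℝ}
    (hi : Integrable (fun x ↦ W (t, x)) (torusMeasure d)) :
    ∫ x, spConv K W (t, x) ∂(torusMeasure d) = 0 := by
  have hm : Measurable fun x ↦ W (t, x) := hWm.comp measurable_prodMk_left
  have h := PeriodSystem.integrable_kernel hK hi hm (torusSystem_inv.2 (hW t))
  have h1 : ∀ x, spConv K W (t, x) = ∫ y, K y * W (t, x - y) := fun x ↦ by simp [spConv]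
  simp only [h1]
  rw [integral_integral_swap h]
  have h2 : ∀ y, ∫ x, K y * W (t, x - y) ∂(torusMeasure d) =
      K y * ∫ x, W (t, x) ∂(torusMeasure d) := fun y ↦ by
    rw [integral_const_mul, (torusSystem_inv.2 (hW t)).integral_sub hm.aestronglyMeasurable]
  simp only [h2]
  rw [integral_mul_const, h0, zero_mul]

open LineDeriv in
/-- The double Riesz transform `∂ᵢ∂ⱼΔ⁻¹` of a function with increments of order `θ`, assembled from
dyadic blocks. -/
lemma LittlewoodPaley.exists_riesz (Φ : LittlewoodPaley d) (hθ : 0 < θ) (hθ1 : θ ≤ 1)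
    {W : ℝ × E d → ℝ} (hW : HolderScalar T θ W) (i j : Fin d) :
    ∃ R : ℝ × E d → ℝ, (∀ t, IsPeriodic fun x ↦ R (t, x)) ∧ (∀ t ∉ Ioo 0 T, ∀ x, R (t, x) = 0) ∧
      MemLp R (3 / 2) (cylinder d) ∧ (∀ᵐ t, ∫ x, R (t, x) ∂(torusMeasure d) = 0) ∧
      ∀ (a b : ℝ) (φ : ℝ × E d → ℝ), CylTest a b φ →
        ∫ z, R z * spLap φ z ∂(cylinder d) =
          ∫ z, W z * pd (ex i) (pd (ex j) φ) z ∂(cylinder d) := by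
  obtain ⟨N₀, N, hNi, hNs, hN⟩ := Φ.exists_green
  set M : SchwartzMap (E d) ℝ := ∂_{(EuclideanSpace.single i (1 : ℝ) : E d)}
    (∂_{(EuclideanSpace.single j (1 : ℝ) : E d)} N₀ : SchwartzMap (E d) ℝ) with hM
  have hp1 := one_le_three_halves
  have hMi : Integrable (fun y ↦ M (-y)) := (M.integrable (μ := volume)).comp_neg
  have hM0 : ∫ y, M (-y) = 0 := by
    rw [integral_neg_eq_self (fun y ↦ M y)]
    exact integral_lineDeriv _ _
  obtain ⟨C, hC, hRk⟩ := hW.exists_eLpNorm_spConv_le hMi hM0 (by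
    have h := lintegral_schwartz_mul_rpow_ne_top M (s := θ * (3 / 2)) (by positivity) (by linarith)
    rw [← lintegral_neg_eq_self] at h
    simpa using h)
  set R : ℕ → ℝ × E d → ℝ := fun k ↦ spConv (dil k fun y ↦ M (-y)) W with hR
  have hdi : ∀ k, Integrable (dil k fun y ↦ M (-y)) := fun k ↦ integrable_dil k hMi
  have hRm : ∀ k, Measurable (R k) := fun k ↦ measurable_spConv (by
    have := M.continuous
    unfold dil
    fun_prop) hW.measurable
  have hR0 : ∀ k, ∀ t ∉ Ioo 0 T, ∀ x, R k (t, x) = 0 := fun k t ht x ↦ by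
    simp [hR, spConv, hW.eq_zero t ht]
  have hsum : ∑' k, eLpNorm (R k) (3 / 2) (cylinder d) ≠ ⊤ := by
    refine ne_top_of_le_ne_top ?_ (ENNReal.tsum_le_tsum hRk)
    rw [ENNReal.tsum_mul_left]
    exact ENNReal.mul_ne_top hC (tsum_ofReal_two_rpow_ne_top hθ)
  have hsum1 : ∑' k, ∫⁻ z, ‖R k z‖ₑ ∂(cylinder d) ≠ ⊤ := by
    obtain ⟨c, hc, h⟩ := exists_eLpNorm_one_le d T hp1
    have h1 : ∀ k, ∫⁻ z, ‖R k z‖ₑ ∂(cylinder d) ≤ c * eLpNorm (R k) (3 / 2) (cylinder d) :=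
        fun k ↦ by
      rw [← eLpNorm_one_eq_lintegral_enorm]
      exact h _ (hRm k).aestronglyMeasurable (hR0 k)
    refine ne_top_of_le_ne_top ?_ (ENNReal.tsum_le_tsum h1)
    rw [ENNReal.tsum_mul_left]
    exact ENNReal.mul_ne_top hc hsum
  obtain ⟨hRs, hRL⟩ := memLp_tsum hp1 (fun k ↦ (hRm k).aestronglyMeasurable) hsum
  have hWi : Integrable W (cylinder d) := MemLp.integrable_cylinder hp1 hW.memLp hW.eq_zero
  refine ⟨fun z ↦ ∑' k, R k z, ?_, ?_, hRL, ?_, ?_⟩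
  · intro t n x
    exact tsum_congr fun k ↦ isPeriodic_spConv (dil k fun y ↦ M (-y)) hW.periodic t n x
  · intro t ht x
    simp [fun k ↦ hR0 k t ht x]
  · have h1 : ∀ᵐ t, ∑' k, ∫⁻ x, ‖R k (t, x)‖ₑ ∂(torusMeasure d) ≠ ⊤ := by
      have h2 : ∫⁻ t, ∑' k, ∫⁻ x, ‖R k (t, x)‖ₑ ∂(torusMeasure d) ≠ ⊤ := by
        rw [lintegral_tsum fun k ↦ ((hRm k).enorm.lintegral_prod_right').aemeasurable]
        convert hsum1 using 3 with k
        exact (lintegral_prod _ (hRm k).enorm.aemeasurable).symm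
      filter_upwards [ae_lt_top (Measurable.tsum fun k ↦ (hRm k).enorm.lintegral_prod_right') h2]
        with t ht using ht.ne
    filter_upwards [h1, hWi.prod_right_ae] with t ht hWt
    have hm : ∀ k, AEStronglyMeasurable (fun x ↦ R k (t, x)) (torusMeasure d) := fun k ↦
      ((hRm k).comp measurable_prodMk_left).aestronglyMeasurable
    rw [integral_tsum hm ht]
    have h3 : ∀ k, ∫ x, R k (t, x) ∂(torusMeasure d) = 0 := fun k ↦
      integral_slice_spConv_eq_zero (hdi k) (integral_dil_eq_zero hM0 k)
        hW.measurable hW.periodic hWt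
    simp [h3]
  · intro a b φ hφ
    have hL := hφ.spLap
    have hD := (hL.pd (ex j)).pd (ex i)
    obtain ⟨c, hc⟩ := hL.exists_bound
    -- each block of the transform is dual to a block of the Green kernel
    have h1 : ∀ k, ∫ z, R k z * spLap φ z ∂(cylinder d) =
        ∫ y, greenBlock N₀ k y *
          ∫ z, W z * pd (ex i) (pd (ex j) (spLap φ)) (z - (0, y)) ∂(cylinder d) := by
      intro k
      have h2 := integral_spConv_mul 1 ⊤ (integrable_dil k (M.integrable (μ := volume)))
        (memLp_one_iff_integrable.2 hWi) hL.memLp_top hW.measurable hL.measurable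
        (cylinderSystem_inv.2 hW.periodic) hL.inv
      have h3 : (fun y ↦ dil k M (-y)) = dil k fun y ↦ M (-y) := by
        ext y
        simp [dil]
      rw [h3] at h2
      have h4 : spConv (dil k M) (spLap φ) =
          spConv (greenBlock N₀ k) (pd (ex i) (pd (ex j) (spLap φ))) := by
        rw [hM, hL.spConv_dil_lineDeriv, (hL.pd _).spConv_dil_lineDeriv]
        ext z
        simp only [spConv, greenBlock, smul_eq_mul, mul_assoc]
        rw [integral_const_mul, ← mul_assoc, ← mul_inv, ← mul_pow]
        norm_num
        have h5 := hL.pd_comm (0, EuclideanSpace.single j 1) (0, EuclideanSpace.single i 1)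
        rw [h5]
        rfl
      rw [h2, h4, integral_mul_spConv 1 ⊤ (integrable_greenBlock N₀.integrable k)
        (memLp_one_iff_integrable.2 hWi) hD.memLp_top hD.measurable hD.inv]
    -- summation of both sides over the blocks
    have h5 : HasSum (fun k ↦ ∫ z, R k z * spLap φ z ∂(cylinder d))
        (∫ z, (∑' k, R k z) * spLap φ z ∂(cylinder d)) := by
      have hRi : ∀ k, Integrable (R k) (cylinder d) := fun k ↦
        ⟨(hRm k).aestronglyMeasurable, (ENNReal.ne_top_of_tsum_ne_top hsum1 k).lt_top⟩
      have h2 : ∀ k, Integrable (fun z ↦ R k z * spLap φ z) (cylinder d) := fun k ↦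
        (hRi k).mul_bdd (c := c) hL.measurable.aestronglyMeasurable (Filter.Eventually.of_forall hc)
      have h3 := hasSum_integral_of_summable_integral_norm h2 ?_
      · simpa only [tsum_mul_right] using h3
      have h4 : Summable fun k ↦ (∫⁻ z, ‖R k z‖ₑ ∂(cylinder d)).toReal * c :=
        (ENNReal.summable_toReal hsum1).mul_right c
      refine h4.of_nonneg_of_le (fun k ↦ by positivity) fun k ↦ ?_
      rw [← integral_norm_eq_lintegral_enorm (hRm k).aestronglyMeasurable, ← integral_mul_const]
      refine integral_mono (h2 k).norm ((hRi k).norm.mul_const c) fun z ↦ ?_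
      simp only [norm_mul]
      exact mul_le_mul_of_nonneg_left (hc z) (norm_nonneg _)
    have h6 : HasSum (fun k ↦ ∫ y, greenBlock N₀ k y *
          ∫ z, W z * pd (ex i) (pd (ex j) (spLap φ)) (z - (0, y)) ∂(cylinder d))
        (∫ y, N y * ∫ z, W z * pd (ex i) (pd (ex j) (spLap φ)) (z - (0, y)) ∂(cylinder d)) := by
      obtain ⟨c', hc'⟩ := hD.exists_bound
      have hcm : Measurable fun y : E d ↦
          ∫ z, W z * pd (ex i) (pd (ex j) (spLap φ)) (z - (0, y)) ∂(cylinder d) := by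
        have : Measurable fun z : E d × (ℝ × E d) ↦
            W z.2 * pd (ex i) (pd (ex j) (spLap φ)) (z.2 - (0, z.1)) :=
          (hW.measurable.comp measurable_snd).mul (hD.measurable.comp (by fun_prop))
        exact this.stronglyMeasurable.integral_prod_right.measurable
      have hcb : ∀ y : E d,
          ‖∫ z, W z * pd (ex i) (pd (ex j) (spLap φ)) (z - (0, y)) ∂(cylinder d)‖ ≤
          ∫ z, ‖W z‖ * c' ∂(cylinder d) := fun y ↦
        norm_integral_le_of_norm_le (hWi.norm.mul_const c') (Filter.Eventually.of_forall fun z ↦ by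
          rw [norm_mul]
          exact mul_le_mul_of_nonneg_left (hc' _) (norm_nonneg _))
      have hgi := fun k ↦ integrable_greenBlock (N₀.integrable (μ := volume)) k
      have h2 := fun k ↦ (hgi k).mul_bdd hcm.aestronglyMeasurable (Filter.Eventually.of_forall hcb)
      have h3 := hasSum_integral_of_summable_integral_norm h2 ?_
      · refine (congrArg (HasSum _) (integral_congr_ae ?_)).mp h3
        filter_upwards [hNs] with y hy
        exact (hy.mul_right _).tsum_eq
      refine ((summable_integral_norm_greenBlock (N₀.integrable (μ := volume))).mul_right
        (∫ z, ‖W z‖ * c' ∂(cylinder d))).of_nonneg_of_le (fun k ↦ by positivity) fun k ↦ ?_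
      rw [← integral_mul_const]
      refine integral_mono (h2 k).norm ((hgi k).norm.mul_const _) fun y ↦ ?_
      simp only [norm_mul]
      exact mul_le_mul_of_nonneg_left (hcb y) (norm_nonneg _)
    simp only [← h1] at h6
    rw [h5.unique h6, ← integral_mul_spConv 1 ⊤ hNi (memLp_one_iff_integrable.2 hWi) hD.memLp_top
      hD.measurable hD.inv, ← spLap_pd_pd hφ, hN a b _ ((hφ.pd _).pd _)]
    intro t
    have h7 := fderiv_slice (hφ.pd (ex j)).differentiable t
    refine (integral_congr_ae (Filter.Eventually.of_forall fun x ↦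
        (h7 x (EuclideanSpace.single i 1)).symm)).trans ?_
    exact integral_fderiv_eq_zero (((hφ.pd _).contDiff_slice t).of_le (by simp))
      ((hφ.pd _).periodic t) _

end Riesz

/-! ### The Euler equations on space-time -/

section Bridge

variable {d : ℕ} {T a b : ℝ}

lemma IsTest.cylTest {F : Type} [NormedAddCommGroup F] [NormedSpace ℝ F] {φ : ℝ → E d → F}
    (h : IsTest T φ) : ∃ a b, 0 < a ∧ b < T ∧ CylTest a b (Function.uncurry φ) := by
  obtain ⟨a, b, ha, hb, h0⟩ := h.compact_time
  exact ⟨a, b, ha, hb, h.smooth, h.periodic, h0⟩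

lemma CylTest.isTest {F : Type} [NormedAddCommGroup F] [NormedSpace ℝ F] {h : ℝ × E d → F}
    (hh : CylTest a b h) (ha : 0 < a) (hb : b < T) : IsTest T fun t x ↦ h (t, x) :=
  ⟨hh.smooth, hh.periodic, a, b, ha, hb, hh.eq_zero⟩

lemma CylTest.eq_zero_of_notMem {F : Type} [NormedAddCommGroup F] [NormedSpace ℝ F]
    {h : ℝ × E d → F} (hh : CylTest a b h) (ha : 0 < a) (hb : b < T) (t : ℝ) (ht : t ∉ Ioo 0 T)
    (x : E d) : h (t, x) = 0 :=
  hh.eq_zero t (fun hc ↦ ht ⟨ha.trans_le hc.1, hc.2.trans_lt hb⟩) x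

lemma deriv_slice {F : Type} [NormedAddCommGroup F] [NormedSpace ℝ F] {h : ℝ × E d → F}
    (hh : Differentiable ℝ h) (t : ℝ) (x : E d) :
    deriv (fun s ↦ h (s, x)) t = pd et h (t, x) := by
  have h1 : HasDerivAt (fun s : ℝ ↦ (s, x)) et t := (hasDerivAt_id t).prodMk (hasDerivAt_const t x)
  have h2 : HasDerivAt (fun s ↦ h (s, x)) _ t := (hh (t, x)).hasFDerivAt.comp_hasDerivAt t h1
  exact h2.deriv

lemma pd_eq_sum {F : Type} [NormedAddCommGroup F] [NormedSpace ℝ F] (h : ℝ × E d → F) (v : E d)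
    (z : ℝ × E d) : pd (0, v) h z = ∑ i, v i • pd (ex i) h z := by
  have h1 : ((0 : ℝ), v) = ∑ i, v i • (ex i : ℝ × E d) := by
    refine Prod.ext ?_ ?_
    · simp [Prod.fst_sum, ex]
    · ext j
      simp [Prod.snd_sum, ex, Pi.single_apply]
  rw [pd, h1, map_sum]
  simp only [map_smul, pd]

lemma fderiv_fderiv_slice {h : ℝ × E d → ℝ} (hh : CylTest a b h) (t : ℝ) (x v w : E d) :
    fderiv ℝ (fderiv ℝ fun x ↦ h (t, x)) x v w =
      pd (0, v) (pd (0, w) h) (t, x) := by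
  have h1 : DifferentiableAt ℝ (fderiv ℝ fun x ↦ h (t, x)) x :=
    (((hh.contDiff_slice t).fderiv_right (m := ∞) (by simp)).differentiable (by simp)) x
  rw [← fderiv_slice (hh.pd (0, w)).differentiable t x v]
  have h2 : (fun x ↦ pd (0, w) h (t, x)) = fun x ↦ fderiv ℝ (fun x ↦ h (t, x)) x w := by
    ext x
    exact (fderiv_slice hh.differentiable t x w).symm
  rw [h2, fderiv_clm_apply h1 (differentiableAt_const _)]
  simp

lemma fderiv_fderiv_slice_eq_sum {h : ℝ × E d → ℝ} (hh : CylTest a b h) (t : ℝ) (x v : E d) :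
    fderiv ℝ (fderiv ℝ fun x ↦ h (t, x)) x v v =
      ∑ i, ∑ j, v i * v j * pd (ex i) (pd (ex j) h) (t, x) := by
  rw [fderiv_fderiv_slice hh, pd_eq_sum]
  refine Finset.sum_congr rfl fun i _ ↦ ?_
  rw [hh.pd_comm, pd_eq_sum, Finset.smul_sum]
  refine Finset.sum_congr rfl fun j _ ↦ ?_
  rw [hh.pd_comm (ex i)]
  simp only [smul_eq_mul]
  ring

lemma laplacian_slice {h : ℝ × E d → ℝ} (hh : CylTest a b h) (t : ℝ) (x : E d) :
    Laplacian.laplacian (fun x ↦ h (t, x)) x = spLap h (t, x) := by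
  rw [InnerProductSpace.laplacian_eq_iteratedFDeriv_orthonormalBasis _ (EuclideanSpace.basisFun (Fin d) ℝ)]
  simp only [spLap]
  refine Finset.sum_congr rfl fun i _ ↦ ?_
  rw [iteratedFDeriv_two_apply]
  simp [fderiv_fderiv_slice hh, ex]

lemma CylTest.const_mul {h : ℝ × E d → ℝ} (hh : CylTest a b h) (c : ℝ) :
    CylTest a b fun z ↦ c * h z := hh.clm_comp (c • ContinuousLinearMap.id ℝ ℝ)

lemma CylTest.sub {h g : ℝ × E d → ℝ} (hh : CylTest a b h) (hg : CylTest a b g) :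
    CylTest a b fun z ↦ h z - g z := by
  have := hh.add (hg.const_mul (-1))
  simpa [sub_eq_add_neg] using this

lemma CylTest.pd_const_mul_sub {h g : ℝ × E d → ℝ} (hh : CylTest a b h) (hg : CylTest a b g) (c : ℝ)
    (v z : ℝ × E d) : EulerTorus.pd v (fun z ↦ c * h z - g z) z =
      c * EulerTorus.pd v h z - EulerTorus.pd v g z := by
  have h1 : HasFDerivAt (fun z ↦ c * h z - g z) (c • _root_.fderiv ℝ h z - _root_.fderiv ℝ g z) z :=
    ((hh.differentiable z).hasFDerivAt.const_mul c).sub (hg.differentiable z).hasFDerivAt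
  rw [EulerTorus.pd, h1.fderiv]
  rfl

/-- The vector field with given components. -/
noncomputable def ofComponents (w : Fin d → ℝ × E d → ℝ) (z : ℝ × E d) : E d :=
  WithLp.toLp 2 fun l ↦ w l z

lemma CylTest.ofComponents {w : Fin d → ℝ × E d → ℝ} (hw : ∀ l, CylTest a b (w l)) :
    CylTest a b (ofComponents w) where
  smooth := contDiff_euclidean.2 fun l ↦ (hw l).smooth
  periodic t i x := by
    ext l
    exact (hw l).periodic t i x
  eq_zero t ht x := by
    ext l
    exact (hw l).eq_zero t ht x

lemma pd_apply {h : ℝ × E d → E d} (hh : Differentiable ℝ h) (v z : ℝ × E d) (l : Fin d) :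
    pd v h z l = pd v (fun z ↦ h z l) z := by
  have h1 : HasFDerivAt (fun z ↦ h z l) _ z :=
    (EuclideanSpace.proj (𝕜 := ℝ) l).hasFDerivAt.comp z (hh z).hasFDerivAt
  rw [pd, pd, h1.fderiv]
  rfl

end Bridge

section Products

variable {d : ℕ} {T θ : ℝ} {U : ℝ × E d → E d}

instance : ENNReal.HolderTriple 3 3 (3 / 2) := ⟨by
  rw [ENNReal.inv_div (by simp) (by simp), ← two_mul, ENNReal.div_eq_inv_mul, mul_comm]⟩

instance : ENNReal.HolderTriple 3 (3 / 2) 1 := ⟨by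
  rw [ENNReal.inv_div (by simp) (by simp), inv_one, ← ENNReal.div_eq_inv_mul.trans (mul_one _),
      ← ENNReal.add_div,
    show (1 + 2 : ℝ≥0∞) = 3 by norm_num, ENNReal.div_self (by simp) (by simp)]⟩

instance : ENNReal.HolderTriple (3 / 2) 3 1 := ENNReal.HolderTriple.symm

lemma HolderField.measurable_apply (hU : HolderField T θ U) (i : Fin d) :
    Measurable fun z ↦ U z i := by
  have := hU.measurable
  fun_prop

lemma HolderField.memLp_apply (hU : HolderField T θ U) (i : Fin d) :
    MemLp (fun z ↦ U z i) 3 (cylinder d) :=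
  hU.memLp.of_le (hU.measurable_apply i).aestronglyMeasurable
    (Filter.Eventually.of_forall fun z ↦ PiLp.norm_apply_le (U z) i)

lemma HolderField.inv (hU : HolderField T θ U) : (cylinderSystem d).Inv U :=
  cylinderSystem_inv.2 hU.periodic

lemma HolderField.holderScalar_mul (hU : HolderField T θ U) (i j : Fin d) :
    HolderScalar T θ fun z ↦ U z i * U z j where
  measurable := (hU.measurable_apply i).mul (hU.measurable_apply j)
  periodic t n x := by
    have := hU.periodic t n x
    simp only at this
    simp only [this]
  eq_zero t ht x := by simp [hU.eq_zero t ht x]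
  memLp := (hU.memLp_apply j).mul (hU.memLp_apply i)
  increment := by
    obtain ⟨C, hC, h⟩ := hU.increment
    refine ⟨2 * (C * eLpNorm U 3 (cylinder d)), ?_, fun y ↦ ?_⟩
    · have := hU.memLp.2.ne
      finiteness
    have hle : ∀ i, eLpNorm (fun z ↦ U z i) 3 (cylinder d) ≤ eLpNorm U 3 (cylinder d) := fun i ↦
      eLpNorm_mono fun z ↦ PiLp.norm_apply_le (U z) i
    have hinc : ∀ i, eLpNorm (fun z ↦ U (z - (0, y)) i - U z i) 3 (cylinder d) ≤
        C * ENNReal.ofReal (‖y‖ ^ θ) := fun i ↦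
      (eLpNorm_mono fun z ↦ PiLp.norm_apply_le (U (z - (0, y)) - U z) i).trans (h y)
    have hm := hU.measurable_apply
    have hms : ∀ i, Measurable fun z ↦ U (z - (0, y)) i := fun i ↦
      (hm i).comp (measurable_sub_const _)
    have hsh : eLpNorm (fun z ↦ U (z - (0, y)) j) 3 (cylinder d) ≤ eLpNorm U 3 (cylinder d) := by
      have := (hU.inv.comp fun v ↦ v j).eLpNorm_sub (hm j).aestronglyMeasurable 3 (0, y)
      exact this.le.trans (hle j)
    have e1 : (fun z ↦ U (z - (0, y)) i * U (z - (0, y)) j - U z i * U z j) =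
        (fun z ↦ (U (z - (0, y)) i - U z i) • U (z - (0, y)) j) +
        fun z ↦ U z i • (U (z - (0, y)) j - U z j) := by
      ext z
      simp only [Pi.add_apply, smul_eq_mul]
      ring
    rw [e1]
    refine (eLpNorm_add_le (((hms i).sub (hm i)).mul (hms j)).aestronglyMeasurable
      ((hm i).mul ((hms j).sub (hm j))).aestronglyMeasurable one_le_three_halves).trans ?_
    have h1 := eLpNorm_smul_le_mul_eLpNorm (p := 3) (q := 3) (r := 3 / 2) (μ := cylinder d)
      (hms j).aestronglyMeasurable ((hms i).sub (hm i)).aestronglyMeasurable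
    have h2 := eLpNorm_smul_le_mul_eLpNorm (p := 3) (q := 3) (r := 3 / 2) (μ := cylinder d)
      ((hms j).sub (hm j)).aestronglyMeasurable (hm i).aestronglyMeasurable
    calc _ ≤ (C * ENNReal.ofReal (‖y‖ ^ θ)) * eLpNorm U 3 (cylinder d) +
          eLpNorm U 3 (cylinder d) * (C * ENNReal.ofReal (‖y‖ ^ θ)) :=
        add_le_add (h1.trans (mul_le_mul' (hinc i) hsh)) (h2.trans (mul_le_mul' (hle i) (hinc j)))
      _ = _ := by ring

lemma HolderField.integrable_apply (hU : HolderField T θ U) (i : Fin d) :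
    Integrable (fun z ↦ U z i) (cylinder d) :=
  MemLp.integrable_cylinder (T := T) (by norm_num) (hU.memLp_apply i) fun t ht x ↦ by
    simp [hU.eq_zero t ht x]

lemma HolderScalar.integrable {W : ℝ × E d → ℝ} (hW : HolderScalar T θ W) :
    Integrable W (cylinder d) :=
  MemLp.integrable_cylinder one_le_three_halves hW.memLp hW.eq_zero

lemma CylTest.integrable_mul {a b : ℝ} {g : ℝ × E d → ℝ} (hg : CylTest a b g) {f : ℝ × E d → ℝ}
    (hf : Integrable f (cylinder d)) : Integrable (fun z ↦ f z * g z) (cylinder d) := by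
  obtain ⟨c, hc⟩ := hg.exists_bound
  exact hf.mul_bdd (c := c) hg.measurable.aestronglyMeasurable (Filter.Eventually.of_forall hc)

end Products

/-! ### The pressure -/

section Pressure

variable {d : ℕ} {T θ a b : ℝ} {u : ℝ → E d → E d} {q : ℝ → E d → ℝ} {U : ℝ × E d → E d}
  {Q : ℝ × E d → ℝ}

lemma integral_congr_cylinder {f g : ℝ × E d → ℝ} (hfg : f =ᵐ[spaceTime d T] g)
    (hg : ∀ t ∉ Ioo 0 T, ∀ x, g (t, x) = 0) :
    ∫ z, f z ∂(spaceTime d T) = ∫ z, g z ∂(cylinder d) := by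
  rw [integral_congr_ae hfg, integral_spaceTime hg]

lemma IsWeakEuler.divFree_cylinder (hu : IsWeakEuler T u) (hU : HolderField T θ U)
    (hUu : U =ᵐ[spaceTime d T] Function.uncurry u) (ha : 0 < a) (hb : b < T) {φ : ℝ × E d → ℝ}
    (hφ : CylTest a b φ) : ∑ i, ∫ z, U z i * pd (ex i) φ z ∂(cylinder d) = 0 := by
  rw [← integral_finsetSum _ fun i _ ↦ (hφ.pd (ex i)).integrable_mul (hU.integrable_apply i),
    ← hu.divFree _ (hφ.isTest ha hb)]
  symm
  refine integral_congr_cylinder (T := T) ?_ ?_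
  · filter_upwards [hUu] with z hz
    rw [fderiv_slice hφ.differentiable, pd_eq_sum, hz]
    rfl
  · intro t ht x
    simp [hU.eq_zero t ht x]

lemma HolderField.integrable_mul_apply (hU : HolderField T θ U) (i j : Fin d) :
    Integrable (fun z ↦ U z i * U z j) (cylinder d) := (hU.holderScalar_mul i j).integrable

lemma IsWeakEuler.momentum_cylinder (hu : IsWeakEuler T u) (hU : HolderField T θ U)
    (hUu : U =ᵐ[spaceTime d T] Function.uncurry u) (ha : 0 < a) (hb : b < T)
    {w : Fin d → ℝ × E d → ℝ} (hw : ∀ l, CylTest a b (w l))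
    (hdiv : ∀ z, ∑ l, pd (ex l) (w l) z = 0) :
    ∑ l, (∫ z, U z l * pd et (w l) z ∂(cylinder d) +
      ∑ i, ∫ z, U z i * U z l * pd (ex i) (w l) z ∂(cylinder d)) = 0 := by
  have hW := CylTest.ofComponents hw
  have hc : ∀ v z l, pd v (ofComponents w) z l = pd v (w l) z := fun v z l ↦
    pd_apply hW.differentiable v z l
  have h := hu.momentum _ (hW.isTest ha hb) fun t x ↦ by
    rw [← hdiv (t, x)]
    refine Finset.sum_congr rfl fun i _ ↦ ?_
    rw [fderiv_slice hW.differentiable]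
    exact hc (ex i) (t, x) i
  rw [← h]
  have hi1 : ∀ l, Integrable (fun z ↦ U z l * pd et (w l) z) (cylinder d) := fun l ↦
    ((hw l).pd et).integrable_mul (hU.integrable_apply l)
  have hi2 : ∀ l i, Integrable (fun z ↦ U z i * U z l * pd (ex i) (w l) z) (cylinder d) := fun l i ↦
    ((hw l).pd (ex i)).integrable_mul (hU.integrable_mul_apply i l)
  simp only [← integral_finsetSum _ fun i _ ↦ hi2 _ i]
  simp only [← integral_add (hi1 _) (integrable_finsetSum _ fun i _ ↦ hi2 _ i)]
  have hi3 : ∀ l, Integrable (fun z ↦ U z l * pd et (w l) z +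
      ∑ i, U z i * U z l * pd (ex i) (w l) z) (cylinder d) := fun l ↦
    (hi1 l).add (integrable_finsetSum _ fun i _ ↦ hi2 l i)
  rw [← integral_finsetSum _ fun l _ ↦ hi3 l]
  symm
  refine integral_congr_cylinder (T := T) ?_ ?_
  · filter_upwards [hUu] with z hz
    have hz' : u z.1 z.2 = U z := hz.symm
    rw [fderiv_slice hW.differentiable, deriv_slice hW.differentiable, pd_eq_sum, hz',
      ← inner_add_right, PiLp.inner_apply]
    refine Finset.sum_congr rfl fun l _ ↦ ?_
    have e1 : (∑ i, U z i • pd (ex i) (ofComponents w) (z.1, z.2)) l =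
        ∑ i, U z i * pd (ex i) (w l) z := by
      simp [hc]
    rw [PiLp.add_apply, e1, hc]
    simp only [RCLike.inner_apply, conj_trivial, add_mul, Finset.sum_mul]
    congr 1
    · ring
    · exact Finset.sum_congr rfl fun i _ ↦ by ring
  · intro t ht x
    simp [hU.eq_zero t ht x]

/-- The right side of the pressure equation on the cylinder. -/
lemma integral_fderiv_fderiv_eq (hU : HolderField T θ U)
    (hUu : U =ᵐ[spaceTime d T] Function.uncurry u) {φ : ℝ × E d → ℝ} (hφ : CylTest a b φ) :
    ∫ z, fderiv ℝ (fderiv ℝ fun x ↦ φ (z.1, x)) z.2 (u z.1 z.2) (u z.1 z.2) ∂(spaceTime d T) =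
      ∑ i, ∑ j, ∫ z, U z i * U z j * pd (ex i) (pd (ex j) φ) z ∂(cylinder d) := by
  have hi : ∀ i j, Integrable (fun z ↦ U z i * U z j * pd (ex i) (pd (ex j) φ) z) (cylinder d) :=
    fun i j ↦ ((hφ.pd (ex j)).pd (ex i)).integrable_mul (hU.integrable_mul_apply i j)
  simp only [← integral_finsetSum _ fun j _ ↦ hi _ j]
  rw [← integral_finsetSum _ fun i _ ↦ integrable_finsetSum _ fun j _ ↦ hi i j]
  refine integral_congr_cylinder (T := T) ?_ ?_
  · filter_upwards [hUu] with z hz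
    have hz' : u z.1 z.2 = U z := hz.symm
    rw [fderiv_fderiv_slice_eq_sum hφ, hz']
  · intro t ht x
    simp [hU.eq_zero t ht x]

lemma integral_laplacian_eq (hQ0 : ∀ t ∉ Ioo 0 T, ∀ x, Q (t, x) = 0)
    (hQq : Q =ᵐ[spaceTime d T] Function.uncurry q) {φ : ℝ × E d → ℝ} (hφ : CylTest a b φ) :
    ∫ z, q z.1 z.2 * Laplacian.laplacian (fun x ↦ φ (z.1, x)) z.2 ∂(spaceTime d T) =
      ∫ z, Q z * spLap φ z ∂(cylinder d) := by
  refine integral_congr_cylinder (T := T) ?_ ?_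
  · filter_upwards [hQq] with z hz
    have hz' : q z.1 z.2 = Q z := hz.symm
    rw [laplacian_slice hφ, hz']
  · intro t ht x
    simp [hQ0 t ht x]

/-- The pressure exists: it is `-∑ᵢⱼ ∂ᵢ∂ⱼΔ⁻¹(uᵢuⱼ)`. -/
lemma exists_isPressure (Φ : LittlewoodPaley d) (hθ : 0 < θ) (hθ1 : θ ≤ 1) (hU : HolderField T θ U)
    (hUu : U =ᵐ[spaceTime d T] Function.uncurry u) : ∃ q : ℝ → E d → ℝ, IsPressure T u q := by
  choose R hRp hR0 hRL hRz hR using fun i j ↦ Φ.exists_riesz hθ hθ1 (hU.holderScalar_mul i j) i j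
  have hRi : ∀ i j, Integrable (R i j) (cylinder d) := fun i j ↦
    MemLp.integrable_cylinder one_le_three_halves (hRL i j) (hR0 i j)
  have hQL : MemLp (fun z ↦ -∑ i, ∑ j, R i j z) (3 / 2) (cylinder d) :=
    (memLp_finsetSum _ fun i _ ↦ memLp_finsetSum _ fun j _ ↦ hRL i j).neg
  have hQ0 : ∀ t ∉ Ioo 0 T, ∀ x, (fun z ↦ -∑ i, ∑ j, R i j z) (t, x) = 0 := fun t ht x ↦ by
    simp [fun i j ↦ hR0 i j t ht x]
  refine ⟨fun t x ↦ -∑ i, ∑ j, R i j (t, x), ?_, (memLp_cylinder_iff hQL.1 hQ0).1 hQL, ?_, ?_⟩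
  · intro t _ n x
    have h1 : ∀ i j, R i j (t, x + EuclideanSpace.single n 1) = R i j (t, x) := fun i j ↦
      hRp i j t n x
    simp only [h1]
  · have h1 : ∀ᵐ t, ∀ i j, ∫ x, R i j (t, x) ∂(torusMeasure d) = 0 :=
      ae_all_iff.2 fun i ↦ ae_all_iff.2 fun j ↦ hRz i j
    have h2 : ∀ᵐ t, ∀ i j, Integrable (fun x ↦ R i j (t, x)) (torusMeasure d) :=
      ae_all_iff.2 fun i ↦ ae_all_iff.2 fun j ↦ (hRi i j).prod_right_ae
    filter_upwards [ae_restrict_of_ae h1, ae_restrict_of_ae h2] with t ht hti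
    rw [integral_neg, integral_finsetSum _ fun i _ ↦ integrable_finsetSum _ fun j _ ↦ hti i j]
    simp only [integral_finsetSum _ fun j _ ↦ hti _ j, ht, Finset.sum_const_zero, neg_zero]
  · intro φ hφ
    obtain ⟨a, b, -, -, hc⟩ := hφ.cylTest
    refine Eq.trans ?_ (integral_fderiv_fderiv_eq hU hUu hc).symm
    refine (congrArg Neg.neg (integral_laplacian_eq (q := fun t x ↦ -∑ i, ∑ j, R i j (t, x))
      (Q := fun z ↦ -∑ i, ∑ j, R i j z) hQ0 Filter.EventuallyEq.rfl hc)).trans ?_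
    simp only [neg_mul, integral_neg, neg_neg, Finset.sum_mul]
    have hi : ∀ i j, Integrable (fun z ↦ R i j z * spLap (Function.uncurry φ) z) (cylinder d) :=
      fun i j ↦ hc.spLap.integrable_mul (hRi i j)
    rw [integral_finsetSum _ fun i _ ↦ integrable_finsetSum _ fun j _ ↦ hi i j]
    simp only [integral_finsetSum _ fun j _ ↦ hi _ j]
    exact Finset.sum_congr rfl fun i _ ↦ Finset.sum_congr rfl fun j _ ↦ hR i j a b _ hc

/-- The Euler equations in space-time with pressure `Q`. Unlike in the weak formulation with
divergence-free test fields, the momentum equation holds for each component `j` and arbitrary scalar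
test functions. -/
structure EulerSystem (T θ : ℝ) (U : ℝ × E d → E d) (Q : ℝ × E d → ℝ) : Prop where
  field : HolderField T θ U
  measurable_pressure : Measurable Q
  periodic_pressure : ∀ t, IsPeriodic fun x ↦ Q (t, x)
  eq_zero_pressure : ∀ t ∉ Ioo 0 T, ∀ x, Q (t, x) = 0
  memLp_pressure : MemLp Q (3 / 2) (cylinder d)
  divFree : ∀ (a b : ℝ) (φ : ℝ × E d → ℝ), 0 < a → b < T → CylTest a b φ →
    ∑ i, ∫ z, U z i * pd (ex i) φ z ∂(cylinder d) = 0
  momentum : ∀ (a b : ℝ) (ψ : ℝ × E d → ℝ) (j : Fin d), 0 < a → b < T → CylTest a b ψ →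
    ∫ z, U z j * pd et ψ z ∂(cylinder d) + ∑ i, ∫ z, U z i * U z j * pd (ex i) ψ z ∂(cylinder d) +
      ∫ z, Q z * pd (ex j) ψ z ∂(cylinder d) = 0

lemma CylTest.integral_pd_slice {F : Type} [NormedAddCommGroup F] [NormedSpace ℝ F]
    [CompleteSpace F]
    {h : ℝ × E d → F} (hh : CylTest a b h) (i : Fin d) (t : ℝ) :
    ∫ x, EulerTorus.pd (ex i) h (t, x) ∂(torusMeasure d) = 0 := by
  refine (integral_congr_ae (Filter.Eventually.of_forall fun x ↦
    (fderiv_slice hh.differentiable t x (EuclideanSpace.single i 1)).symm)).trans ?_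
  exact integral_fderiv_eq_zero ((hh.contDiff_slice t).of_le (by simp)) (hh.periodic t) _

/-- Every pressure of `u` completes it to a solution of the system with pressure. The gradient part
of the test field `ψ eⱼ` is removed with the Green kernel; by the Poisson equation the pressure
accounts for its contribution. -/
lemma exists_eulerSystem (Φ : LittlewoodPaley d) (hu : IsWeakEuler T u) (hU : HolderField T θ U)
    (hUu : U =ᵐ[spaceTime d T] Function.uncurry u) (hq : IsPressure T u q) :
    ∃ Q, EulerSystem T θ U Q ∧ Q =ᵐ[spaceTime d T] Function.uncurry q := by
  obtain ⟨Q, hQm, hQp, hQ0, hQq⟩ := exists_representative hq.memLp.1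
  have hQL : MemLp Q (3 / 2) (cylinder d) :=
    (memLp_cylinder_iff hQm.aestronglyMeasurable hQ0).2 ((memLp_congr_ae hQq).2 hq.memLp)
  refine ⟨Q, ⟨hU, hQm, hQp, hQ0, hQL, fun a b φ ha hb hφ ↦ hu.divFree_cylinder hU hUu ha hb hφ, ?_⟩,
      hQq⟩
  intro a b ψ j ha hb hψ
  obtain ⟨-, N, hNi, -, hN⟩ := Φ.exists_green
  have hψj := hψ.pd (ex j)
  set p := spConv N (pd (ex j) ψ) with hp
  have hpt : CylTest a b p := hψj.spConv hNi
  have hLp : spLap p = pd (ex j) ψ := by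
    rw [← hN a b _ hψj (hψ.integral_pd_slice j)]
    ext z
    have h1 : ∀ i, pd (ex i) (pd (ex i) p) z = spConv N (pd (ex i) (pd (ex i) (pd (ex j) ψ))) z :=
      fun i ↦ by rw [hp, hψj.pd_spConv hNi, (hψj.pd _).pd_spConv hNi]
    simp only [spLap, h1]
    have h2 : ∀ y, N y • spLap (pd (ex j) ψ) (z - (0, y)) =
        ∑ i, N y • pd (ex i) (pd (ex i) (pd (ex j) ψ)) (z - (0, y)) := fun y ↦ by
      rw [spLap, Finset.smul_sum]
    simp only [spConv, h2]
    exact (integral_finsetSum _ fun i _ ↦ ((hψj.pd (ex i)).pd (ex i)).integrable_smul hNi z).symm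
  -- the divergence-free part `ψ eⱼ - ∇ Δ⁻¹ ∂ⱼψ` of the test field
  let w : Fin d → ℝ × E d → ℝ := fun l z ↦ (if l = j then 1 else 0) * ψ z - pd (ex l) p z
  have hw : ∀ l, CylTest a b (w l) := fun l ↦ (hψ.const_mul _).sub (hpt.pd _)
  have hwv : ∀ v l z, pd v (w l) z = (if l = j then 1 else 0) * pd v ψ z - pd v (pd (ex l) p) z :=
    fun v l z ↦ hψ.pd_const_mul_sub (hpt.pd _) _ v z
  have hm := hu.momentum_cylinder hU hUu ha hb hw fun z ↦ by
    simp only [hwv, Finset.sum_sub_distrib, ite_mul, one_mul, zero_mul, Finset.sum_ite_eq',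
      Finset.mem_univ, if_true]
    rw [← hLp, spLap, sub_self]
  have hpois := hq.poisson _ (hpt.isTest ha hb)
  rw [integral_laplacian_eq hQ0 hQq hpt, integral_fderiv_fderiv_eq hU hUu hpt, hLp] at hpois
  have hdiv := hu.divFree_cylinder hU hUu ha hb (hpt.pd et)
  have hU1 := hU.integrable_apply
  have hU2 := hU.integrable_mul_apply
  have e1 : ∀ l, ∫ z, U z l * pd et (w l) z ∂(cylinder d) =
      (if l = j then 1 else 0) * (∫ z, U z l * pd et ψ z ∂(cylinder d)) -
        ∫ z, U z l * pd (ex l) (pd et p) z ∂(cylinder d) := fun l ↦ by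
    rw [← integral_const_mul, ← integral_sub (((hψ.pd et).integrable_mul (hU1 l)).const_mul _)
      (((hpt.pd et).pd (ex l)).integrable_mul (hU1 l))]
    congr 1
    ext z
    rw [hwv, hpt.pd_comm et]
    ring
  have e2 : ∀ l i, ∫ z, U z i * U z l * pd (ex i) (w l) z ∂(cylinder d) =
      (if l = j then 1 else 0) * (∫ z, U z i * U z l * pd (ex i) ψ z ∂(cylinder d)) -
        ∫ z, U z i * U z l * pd (ex i) (pd (ex l) p) z ∂(cylinder d) := fun l i ↦ by
    rw [← integral_const_mul, ← integral_sub (((hψ.pd (ex i)).integrable_mul (hU2 i l)).const_mul _)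
      (((hpt.pd (ex l)).pd (ex i)).integrable_mul (hU2 i l))]
    congr 1
    ext z
    rw [hwv]
    ring
  simp only [e1, e2, Finset.sum_add_distrib, Finset.sum_sub_distrib, ite_mul, one_mul,
    zero_mul, Finset.sum_ite_eq', Finset.mem_univ, if_true, hdiv, sub_zero] at hm
  rw [Finset.sum_comm (f := fun l i ↦ ∫ z, U z i * U z l * pd (ex i) (pd (ex l) p) z ∂(cylinder d)),
    ← hpois, Finset.sum_comm] at hm
  simp only [Finset.sum_ite_eq', Finset.mem_univ, if_true] at hm
  linarith

/-- The Duchon--Robert distribution in terms of the representatives. -/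
lemma duchonRobert_eq (hU : HolderField T θ U) (hUu : U =ᵐ[spaceTime d T] Function.uncurry u)
    (hQq : Q =ᵐ[spaceTime d T] Function.uncurry q) {φ : ℝ → E d → ℝ}
    (hφ : CylTest a b (Function.uncurry φ)) :
    duchonRobert T u q φ = ∫ z, (‖U z‖ ^ 2 / 2 * pd et (Function.uncurry φ) z +
      (‖U z‖ ^ 2 / 2 + Q z) * ∑ i, U z i * pd (ex i) (Function.uncurry φ) z) ∂(cylinder d) := by
  refine integral_congr_cylinder (T := T) ?_ ?_
  · filter_upwards [hUu, hQq] with z hz hz'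
    have hz1 : u z.1 z.2 = U z := hz.symm
    have hz2 : q z.1 z.2 = Q z := hz'.symm
    have h1 := fderiv_slice hφ.differentiable z.1 z.2 (U z)
    have h2 := deriv_slice hφ.differentiable z.1 z.2
    simp only [Function.uncurry] at h1 h2
    rw [hz1, hz2, h2]
    refine congrArg₂ (· + ·) rfl (congrArg _ (h1.trans ?_))
    rw [pd_eq_sum]
    rfl
  · intro t ht x
    simp [hU.eq_zero t ht x]

end Pressure

/-! ### Periodic functions on space-time: local integrability and continuity of translations -/

section Translation

variable {d : ℕ} {F : Type*} [NormedAddCommGroup F]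

instance : (volume : Measure (ℝ × E d)).IsAddHaarMeasure :=
  Measure.prod.instIsAddHaarMeasure (volume : Measure ℝ) (volume : Measure (E d))

lemma volume_restrict_strip :
    (volume : Measure (ℝ × E d)).restrict (univ ×ˢ cell d) = cylinder d := by
  rw [Measure.volume_eq_prod, ← Measure.prod_restrict, Measure.restrict_univ, cylinder,
      torusMeasure]

lemma locallyIntegrable_of_periodic {f : ℝ × E d → F} (hf : Integrable f (cylinder d))
    (hi : (cylinderSystem d).Inv f) : LocallyIntegrable f volume := by
  intro z
  set c : E d := z.2 - WithLp.toLp 2 fun _ ↦ (1 / 2 : ℝ) with hc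
  have h1 : IntegrableOn (fun z : ℝ × E d ↦ f (z + (0, c))) (univ ×ˢ cell d) := by
    rw [IntegrableOn, volume_restrict_strip]
    exact hi.integrable_add hf _
  have h2 : IntegrableOn f ((fun z : ℝ × E d ↦ z - (0, c)) ⁻¹' (univ ×ˢ cell d)) := by
    have h3 := (measurePreserving_sub_right (volume : Measure (ℝ × E d))
      (0, c)).integrableOn_comp_preimage
      (MeasurableEquiv.subRight ((0 : ℝ), c)).measurableEmbedding (s := univ ×ˢ cell d)
      (f := fun z : ℝ × E d ↦ f (z + (0, c)))
    have h4 := h3.2 h1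
    simpa only [Function.comp_def, sub_add_cancel] using h4
  refine ⟨_, ?_, h2⟩
  have ho : IsOpen {x : E d | ∀ i, x i ∈ Ioo (0 : ℝ) 1} := by
    simp only [ofPred_forall]
    exact isOpen_iInter_of_finite fun i ↦ isOpen_Ioo.preimage (by fun_prop)
  have hcont : Continuous fun z : ℝ × E d ↦ z.2 - c := by fun_prop
  refine Filter.mem_of_superset ((ho.preimage hcont).mem_nhds ?_) fun w hw ↦ ⟨trivial, fun i ↦
    Ioo_subset_Ico_self (hw i)⟩
  intro i
  simp [hc]
  norm_num

/-- Cutting off in space: near the fundamental cell, a function and its translates by small vectors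
agree with those of its restriction to a ball. -/
lemma memLp_indicator_ball [MeasurableSpace F] [BorelSpace F] [SecondCountableTopology F] {T : ℝ}
    {f : ℝ × E d → F} (hm : Measurable f)
    (hi : (cylinderSystem d).Inv f) (h0 : ∀ t ∉ Ioo 0 T, ∀ x, f (t, x) = 0) {p : ℝ≥0∞} (hp0 : p ≠ 0)
    (hp : p ≠ ⊤) (hf : MemLp f p (cylinder d)) (r : ℝ) :
    MemLp ((univ ×ˢ Metric.closedBall (0 : E d) r).indicator f) p volume := by
  have h1 : Integrable (fun z ↦ ‖f z‖ ^ p.toReal) (cylinder d) := hf.integrable_norm_rpow hp0 hp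
  have h2 := locallyIntegrable_of_periodic h1 (hi.comp fun v ↦ ‖v‖ ^ p.toReal)
  have h3 := h2.integrableOn_isCompact (isCompact_Icc (a := 0) (b := T) |>.prod
    (isCompact_closedBall (0 : E d) r))
  have hs : MeasurableSet (univ ×ˢ Metric.closedBall (0 : E d) r : Set (ℝ × E d)) :=
    MeasurableSet.univ.prod measurableSet_closedBall
  have hs' : MeasurableSet (Icc 0 T ×ˢ Metric.closedBall (0 : E d) r : Set (ℝ × E d)) :=
    measurableSet_Icc.prod measurableSet_closedBall
  have hm' := hm.indicator hs
  rw [← integrable_norm_rpow_iff hm'.aestronglyMeasurable hp0 hp]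
  have h4 : (fun z ↦ ‖(univ ×ˢ Metric.closedBall (0 : E d) r).indicator f z‖ ^ p.toReal) =
      (Icc 0 T ×ˢ Metric.closedBall (0 : E d) r).indicator fun z ↦ ‖f z‖ ^ p.toReal := by
    ext z
    have hpp : 0 < p.toReal := ENNReal.toReal_pos hp0 hp
    by_cases hx : z.2 ∈ Metric.closedBall (0 : E d) r
    · by_cases ht : z.1 ∈ Icc 0 T
      · rw [indicator_of_mem (show z ∈ univ ×ˢ Metric.closedBall (0 : E d) r from ⟨trivial, hx⟩),
          indicator_of_mem (show z ∈ Icc 0 T ×ˢ Metric.closedBall (0 : E d) r from ⟨ht, hx⟩)]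
      · rw [indicator_of_mem (show z ∈ univ ×ˢ Metric.closedBall (0 : E d) r from ⟨trivial, hx⟩),
          indicator_of_notMem (fun h ↦ ht h.1), show f z = 0 from
            h0 z.1 (fun h ↦ ht (Ioo_subset_Icc_self h)) z.2, norm_zero, Real.zero_rpow hpp.ne']
    · rw [indicator_of_notMem (fun h ↦ hx h.2), indicator_of_notMem (fun h ↦ hx h.2), norm_zero,
        Real.zero_rpow hpp.ne']
  rw [h4]
  exact h3.integrable_indicator hs'

lemma tendsto_eLpNorm_translate_volume {G : Type*} [NormedAddCommGroup G] [NormedSpace ℝ G]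
    [FiniteDimensional ℝ G] [MeasurableSpace G] [BorelSpace G] {μ : Measure G} [μ.IsAddHaarMeasure]
    {f : G → F} {p : ℝ≥0∞} (hp1 : 1 ≤ p) (hp : p ≠ ⊤) (hf : MemLp f p μ) :
    Filter.Tendsto (fun ζ ↦ eLpNorm (fun z ↦ f (z - ζ) - f z) p μ) (nhds 0) (nhds 0) := by
  have : Fact (1 ≤ p) := ⟨hp1⟩
  let g : G → C(G, G) := fun ζ ↦ ⟨fun z ↦ z - ζ, by fun_prop⟩
  have hg : Continuous g := ContinuousMap.continuous_of_continuous_uncurry _ (by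
    change Continuous fun z : G × G ↦ z.2 - z.1
    fun_prop)
  have hgm : ∀ ζ, MeasurePreserving (g ζ) μ μ := fun ζ ↦ measurePreserving_sub_right μ ζ
  have h := ((continuous_const (y := hf.toLp f)).compMeasurePreservingLp hg hgm hp).tendsto 0
  have h2 := (tendsto_iff_edist_tendsto_0.1 h)
  refine h2.congr fun ζ ↦ ?_
  have h0 : g 0 = ContinuousMap.id G := by
    ext z
    simp [g]
  rw [Lp.edist_def]
  refine eLpNorm_congr_ae ?_
  have e1 := Lp.coeFn_compMeasurePreserving (hf.toLp f) (hgm ζ)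
  have e2 := Lp.coeFn_compMeasurePreserving (hf.toLp f) (hgm 0)
  have e3 := (hgm ζ).quasiMeasurePreserving.ae_eq_comp hf.coeFn_toLp
  have e4 := (hgm 0).quasiMeasurePreserving.ae_eq_comp hf.coeFn_toLp
  filter_upwards [e1, e2, e3, e4] with z h1 h2 h3 h4
  simp only [Pi.sub_apply]
  rw [h1, h2, h3, h4]
  simp [g]

/-- Translations act continuously on periodic functions in `Lᵖ` of space-time. -/
lemma tendsto_eLpNorm_translate [MeasurableSpace F] [BorelSpace F] [SecondCountableTopology F]
    {T : ℝ} {f : ℝ × E d → F} (hm : Measurable f) (hi : (cylinderSystem d).Inv f)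
    (h0 : ∀ t ∉ Ioo 0 T, ∀ x, f (t, x) = 0) {p : ℝ≥0∞} (hp1 : 1 ≤ p) (hp : p ≠ ⊤)
    (hf : MemLp f p (cylinder d)) :
    Filter.Tendsto (fun ζ ↦ eLpNorm (fun z ↦ f (z - ζ) - f z) p (cylinder d))
      (nhds 0) (nhds 0) := by
  set g := (univ ×ˢ Metric.closedBall (0 : E d) (√d + 1)).indicator f with hg
  have h1 := tendsto_eLpNorm_translate_volume hp1 hp
    (memLp_indicator_ball hm hi h0 (one_pos.trans_le hp1).ne' hp hf (√d + 1))
  refine tendsto_of_tendsto_of_tendsto_of_le_of_le' tendsto_const_nhds h1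
    (Filter.Eventually.of_forall fun _ ↦ bot_le) ?_
  filter_upwards [Metric.ball_mem_nhds (0 : ℝ × E d) one_pos] with ζ hζ
  refine le_trans (le_of_eq ?_)
    (eLpNorm_mono_measure _ (Measure.restrict_le_self (s := univ ×ˢ cell d)))
  rw [volume_restrict_strip]
  refine eLpNorm_congr_ae ?_
  have hcell : ∀ᵐ z ∂(cylinder d), z.2 ∈ cell d := by
    rw [← volume_restrict_strip]
    filter_upwards [ae_restrict_mem (MeasurableSet.univ.prod measurableSet_cell)] with z hz using hz.2
  filter_upwards [hcell] with z hz
  have hn := norm_le_of_mem_cell hz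
  have hζ2 : ‖ζ.2‖ ≤ 1 := (norm_snd_le ζ).trans (mem_ball_zero_iff.1 hζ).le
  rw [indicator_of_mem (show z - ζ ∈ univ ×ˢ Metric.closedBall (0 : E d) (√d + 1) from ⟨trivial, by
      rw [mem_closedBall_zero_iff]; exact (norm_sub_le z.2 ζ.2).trans (add_le_add hn hζ2)⟩),
    indicator_of_mem (show z ∈ univ ×ˢ Metric.closedBall (0 : E d) (√d + 1) from ⟨trivial, by
      rw [mem_closedBall_zero_iff]; linarith⟩)]

end Translation

/-! ### Mollification and correlations -/

section Mollify

variable {d : ℕ} {T a b δ : ℝ} {p q r : ℝ≥0∞} {A B φ k ρ : ℝ × E d → ℝ}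

/-- Functions in `Lᵖ` of space-time, periodic in space and vanishing outside the time
interval `(0,T)`. -/
structure CylLp (T : ℝ) (p : ℝ≥0∞) (A : ℝ × E d → ℝ) : Prop where
  measurable : Measurable A
  inv : (cylinderSystem d).Inv A
  eq_zero : ∀ t ∉ Ioo 0 T, ∀ x, A (t, x) = 0
  memLp : MemLp A p (cylinder d)

namespace CylLp

lemma mul [ENNReal.HolderTriple p q r] (hA : CylLp T p A) (hB : CylLp T q B) :
    CylLp T r fun z ↦ A z * B z where
  measurable := hA.measurable.mul hB.measurable
  inv := hA.inv.mul hB.inv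
  eq_zero t ht x := by simp [hA.eq_zero t ht x]
  memLp := hB.memLp.mul hA.memLp

lemma mono (hB : CylLp T q B) (hpq : p ≤ q) : CylLp T p B where
  measurable := hB.measurable
  inv := hB.inv
  eq_zero := hB.eq_zero
  memLp := (memLp_cylinder_iff hB.measurable.aestronglyMeasurable hB.eq_zero).2
    (((memLp_cylinder_iff hB.measurable.aestronglyMeasurable hB.eq_zero).1 hB.memLp).mono_exponent hpq)

lemma integrable (hA : CylLp T p A) (hp : 1 ≤ p) : Integrable A (cylinder d) :=
  memLp_one_iff_integrable.1 (hA.mono hp).memLp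

lemma locallyIntegrable (hA : CylLp T p A) (hp : 1 ≤ p) : LocallyIntegrable A volume :=
  locallyIntegrable_of_periodic (hA.integrable hp) hA.inv

lemma mul_test (hA : CylLp T p A) (hφ : CylTest a b φ) : CylLp T p fun z ↦ A z * φ z where
  measurable := hA.measurable.mul hφ.measurable
  inv := hA.inv.mul hφ.inv
  eq_zero t ht x := by simp [hA.eq_zero t ht x]
  memLp := by
    have : ENNReal.HolderTriple p ⊤ p := ⟨by simp⟩
    exact hφ.memLp_top.mul hA.memLp

end CylLp

lemma CylTest.cylLp (hφ : CylTest a b φ) (ha : 0 < a) (hb : b < T) (p : ℝ≥0∞) : CylLp T p φ :=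
  CylLp.mono (q := ⊤) ⟨hφ.measurable, hφ.inv, hφ.eq_zero_of_notMem ha hb, hφ.memLp_top⟩ le_top

/-- Convolution over space-time. -/
noncomputable def mol (k B : ℝ × E d → ℝ) (z : ℝ × E d) : ℝ := ∫ ζ, k ζ * B (z - ζ)

/-- The correlation of `A` with the translates of `B`. -/
noncomputable def corr (A B : ℝ × E d → ℝ) (ζ : ℝ × E d) : ℝ := ∫ z, A z * B (z - ζ) ∂(cylinder d)

/-- The average of a correlation against a kernel: the bilinear form `∫ A (k * B)`. -/
noncomputable def bil (k A B : ℝ × E d → ℝ) : ℝ := ∫ ζ, k ζ * corr A B ζ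

section Pairing

variable [ENNReal.HolderTriple p q 1]

lemma integral_mul_mol (hk : Integrable k) (hA : CylLp T p A) (hB : CylLp T q B) :
    ∫ z, A z * mol k B z ∂(cylinder d) = bil k A B :=
  PeriodSystem.integral_mul_kernel p q hk hA.memLp hB.memLp hB.measurable hB.inv

lemma integrable_mul_mol (hk : Integrable k) (hA : CylLp T p A) (hB : CylLp T q B) :
    Integrable (fun z ↦ A z * mol k B z) (cylinder d) := by
  have h := (PeriodSystem.integrable_kernel_mul p q hk hA.memLp hB.memLp hB.measurable
    hB.inv).integral_prod_left
  refine h.congr (Filter.Eventually.of_forall fun z ↦ ?_)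
  simp only [mul_left_comm _ (A z), mol]
  exact integral_const_mul _ _

lemma integrable_mul_corr (hk : Integrable k) (hA : CylLp T p A) (hB : CylLp T q B) :
    Integrable (fun ζ ↦ k ζ * corr A B ζ) := by
  have h := (PeriodSystem.integrable_kernel_mul p q hk hA.memLp hB.memLp hB.measurable
    hB.inv).integral_prod_right
  refine h.congr (Filter.Eventually.of_forall fun z ↦ ?_)
  simp only [corr]
  exact integral_const_mul _ _

lemma integrable_corr_integrand (hA : CylLp T p A) (hB : CylLp T q B) (ζ : ℝ × E d) :
    Integrable (fun z ↦ A z * B (z - ζ)) (cylinder d) :=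
  memLp_one_iff_integrable.1 ((hB.inv.memLp_sub hB.memLp ζ).mul hA.memLp)

end Pairing

lemma corr_neg (hA : CylLp T p A) (hB : CylLp T q B) (ζ : ℝ × E d) :
    corr A B (-ζ) = corr B A ζ := by
  have h := (hB.inv.mul (hA.inv.shift_sub ζ)).integral_add
    (hB.measurable.mul (hA.measurable.comp (measurable_sub_const ζ))).aestronglyMeasurable ζ
  rw [corr, corr, ← h]
  refine integral_congr_ae (Filter.Eventually.of_forall fun z ↦ ?_)
  simp only [add_sub_cancel_right, sub_neg_eq_add]
  exact mul_comm _ _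

lemma bil_comm_of_even (hA : CylLp T p A) (hB : CylLp T q B) (hk : ∀ ζ, k (-ζ) = k ζ) :
    bil k A B = bil k B A := by
  rw [bil, bil, ← integral_neg_eq_self]
  simp only [hk, corr_neg hA hB]

lemma bil_comm_of_odd (hA : CylLp T p A) (hB : CylLp T q B) (hk : ∀ ζ, k (-ζ) = -k ζ) :
    bil k A B = -bil k B A := by
  rw [bil, bil, ← integral_neg_eq_self, ← integral_neg]
  simp only [hk, corr_neg hA hB, neg_mul]

/-- Even mollifiers with integral one, supported in `|s| ≤ δ`, `‖y‖ ≤ ε`. -/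
structure IsMollifier (δ ε : ℝ) (ρ : ℝ × E d → ℝ) : Prop where
  smooth : ContDiff ℝ ∞ ρ
  even : ∀ ζ, ρ (-ζ) = ρ ζ
  nonneg : ∀ ζ, 0 ≤ ρ ζ
  eq_zero : ∀ ζ, ρ ζ ≠ 0 → |ζ.1| ≤ δ ∧ ‖ζ.2‖ ≤ ε
  integral_eq_one : ∫ ζ, ρ ζ = 1

namespace IsMollifier

variable {ε : ℝ}

lemma hasCompactSupport (hρ : IsMollifier δ ε ρ) : HasCompactSupport ρ := by
  refine HasCompactSupport.intro ((isCompact_Icc (a := -δ) (b := δ)).prod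
    (isCompact_closedBall (0 : E d) ε)) fun ζ hζ ↦ ?_
  by_contra h
  obtain ⟨h1, h2⟩ := hρ.eq_zero ζ h
  exact hζ ⟨abs_le.1 h1, mem_closedBall_zero_iff.2 h2⟩

lemma integrable (hρ : IsMollifier δ ε ρ) : Integrable ρ :=
  hρ.smooth.continuous.integrable_of_hasCompactSupport hρ.hasCompactSupport

lemma contDiff_pd (hρ : IsMollifier δ ε ρ) (v : ℝ × E d) : ContDiff ℝ ∞ (pd v ρ) :=
  (hρ.smooth.fderiv_right (m := ∞) (by simp)).clm_apply contDiff_const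

lemma hasCompactSupport_pd (hρ : IsMollifier δ ε ρ) (v : ℝ × E d) : HasCompactSupport (pd v ρ) :=
  (hρ.hasCompactSupport.fderiv ℝ).comp_left (g := fun L : ℝ × E d →L[ℝ] ℝ ↦ L v) rfl

lemma integrable_pd (hρ : IsMollifier δ ε ρ) (v : ℝ × E d) : Integrable (pd v ρ) :=
  (hρ.contDiff_pd v).continuous.integrable_of_hasCompactSupport (hρ.hasCompactSupport_pd v)

lemma odd_pd (hρ : IsMollifier δ ε ρ) (v ζ : ℝ × E d) : pd v ρ (-ζ) = -pd v ρ ζ := by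
  have h1 : (fun ζ ↦ ρ (-ζ)) = ρ := funext hρ.even
  have h2 : HasFDerivAt (fun ζ ↦ ρ (-ζ)) _ ζ :=
    (hρ.smooth.differentiable (by simp) (-ζ)).hasFDerivAt.comp ζ (hasFDerivAt_id ζ).neg
  rw [h1] at h2
  simp only [pd]
  rw [h2.fderiv]
  simp

lemma integral_pd (hρ : IsMollifier δ ε ρ) (v : ℝ × E d) : ∫ ζ, pd v ρ ζ = 0 := by
  have h := integral_neg_eq_self (μ := (volume : Measure (ℝ × E d))) (pd v ρ)
  simp only [hρ.odd_pd, integral_neg] at h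
  linarith

lemma mol_eq_convolution (ρ B : ℝ × E d → ℝ) :
    mol ρ B = (ρ ⋆[ContinuousLinearMap.mul ℝ ℝ, volume] B) := by
  ext z
  simp [mol, convolution]

lemma pd_eq_zero (hρ : IsMollifier δ ε ρ) (v ζ : ℝ × E d) (h : pd v ρ ζ ≠ 0) :
    |ζ.1| ≤ δ ∧ ‖ζ.2‖ ≤ ε := by
  have h1 : ζ ∈ tsupport ρ := by
    by_contra hc
    exact h (by rw [pd, fderiv_of_notMem_tsupport (𝕜 := ℝ) hc]; rfl)
  have h2 : IsClosed {ζ : ℝ × E d | |ζ.1| ≤ δ ∧ ‖ζ.2‖ ≤ ε} :=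
    (isClosed_le continuous_fst.abs continuous_const).inter
      (isClosed_le continuous_snd.norm continuous_const)
  exact closure_minimal hρ.eq_zero h2 h1

lemma contDiff_mol (hρ : IsMollifier δ ε ρ) (hB : CylLp T p B) (hp : 1 ≤ p) :
    ContDiff ℝ ∞ (mol ρ B) := by
  rw [mol_eq_convolution]
  exact hρ.hasCompactSupport.contDiff_convolution_left _ hρ.smooth (hB.locallyIntegrable hp)

lemma pd_mol (hρ : IsMollifier δ ε ρ) (hB : CylLp T p B) (hp : 1 ≤ p) (v : ℝ × E d) :
    pd v (mol ρ B) = mol (pd v ρ) B := by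
  ext z
  have hl := hB.locallyIntegrable hp
  rw [pd, mol_eq_convolution, (hρ.hasCompactSupport.hasFDerivAt_convolution_left
    (ContinuousLinearMap.mul ℝ ℝ) (hρ.smooth.of_le (by simp)) hl z).fderiv, convolution]
  rw [ContinuousLinearMap.integral_apply]
  · rfl
  · exact (hρ.hasCompactSupport.fderiv ℝ).convolutionExists_left _
      (hρ.smooth.continuous_fderiv (by simp)) hl z

lemma inv_mol (hB : CylLp T p B) : (cylinderSystem d).Inv (mol ρ B) := fun z ζ ↦ by
  simp only [mol, add_sub_assoc]
  congr 1
  ext ξ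
  rw [hB.inv]

/-- The product of a test function with a mollified function is a test function. -/
lemma cylTest_mul_mol (hρ : IsMollifier δ ε ρ) (hφ : CylTest a b φ) (hB : CylLp T p B)
    (hp : 1 ≤ p) :
    CylTest a b fun z ↦ φ z * mol ρ B z where
  smooth := hφ.smooth.mul (hρ.contDiff_mol hB hp)
  periodic := cylinderSystem_inv.1 (hφ.inv.mul (inv_mol hB))
  eq_zero t ht x := by rw [hφ.eq_zero t ht x, zero_mul]

/-- The mollification of a localized function is a test function on a slightly larger time
interval. -/
lemma cylTest_mol_mul (hρ : IsMollifier δ ε ρ) (hφ : CylTest a b φ) (hB : CylLp T p B)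
    (hp : 1 ≤ p) :
    CylTest (a - δ) (b + δ) (mol ρ fun z ↦ B z * φ z) where
  smooth := hρ.contDiff_mol (hB.mul_test hφ) hp
  periodic := cylinderSystem_inv.1 (inv_mol (hB.mul_test hφ))
  eq_zero t ht x := by
    rw [mol]
    refine integral_eq_zero_of_ae (Filter.Eventually.of_forall fun ζ ↦ ?_)
    by_cases h : ρ ζ = 0
    · simp [h]
    · have h1 := abs_le.1 (hρ.eq_zero ζ h).1
      have h2 : φ ((t, x) - ζ) = 0 := hφ.eq_zero (t - ζ.1) (fun hc ↦ ht
        ⟨by linarith [hc.1], by linarith [hc.2]⟩) (x - ζ.2)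
      simp [h2]

variable [ENNReal.HolderTriple p q 1]

/-- A derivative of the test function `φ (ρ * B)` falls on `φ` or on the mollifier. -/
lemma integral_mul_pd_mul_mol (hρ : IsMollifier δ ε ρ) (hφ : CylTest a b φ) (hA : CylLp T p A)
    (hB : CylLp T q B) (hq : 1 ≤ q) (v : ℝ × E d) :
    ∫ z, A z * pd v (fun z ↦ φ z * mol ρ B z) z ∂(cylinder d) =
      bil ρ (fun z ↦ A z * pd v φ z) B + bil (pd v ρ) (fun z ↦ A z * φ z) B := by
  have h1 : ∀ z, A z * pd v (fun z ↦ φ z * mol ρ B z) z =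
      A z * pd v φ z * mol ρ B z + A z * φ z * mol (pd v ρ) B z := fun z ↦ by
    have h2 := (hφ.differentiable z).hasFDerivAt.mul
      (((hρ.contDiff_mol hB hq).differentiable (by simp)) z).hasFDerivAt
    rw [← hρ.pd_mol hB hq]
    simp only [pd]
    rw [show fderiv ℝ (fun z ↦ φ z * mol ρ B z) z = _ from h2.fderiv]
    simp only [add_apply, smul_apply, smul_eq_mul]
    ring
  simp only [h1]
  rw [integral_add (integrable_mul_mol hρ.integrable (hA.mul_test (hφ.pd v)) hB)
    (integrable_mul_mol (hρ.integrable_pd v) (hA.mul_test hφ) hB),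
    integral_mul_mol hρ.integrable (hA.mul_test (hφ.pd v)) hB,
    integral_mul_mol (hρ.integrable_pd v) (hA.mul_test hφ) hB]

lemma integral_mul_pd_mol (hρ : IsMollifier δ ε ρ) (hA : CylLp T p A)
    (hB : CylLp T q B) (hq : 1 ≤ q) (v : ℝ × E d) :
    ∫ z, A z * pd v (mol ρ B) z ∂(cylinder d) = bil (pd v ρ) A B := by
  rw [hρ.pd_mol hB hq, integral_mul_mol (hρ.integrable_pd v) hA hB]

end IsMollifier

end Mollify

/-! ### The mollified energy balance -/

section Balance

variable {d : ℕ} {T θ a b δ ε : ℝ} {U : ℝ × E d → E d} {Q A B φ ρ : ℝ × E d → ℝ}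

lemma IsMollifier.mol_pd (hρ : IsMollifier δ ε ρ) (hφ : CylTest a b φ) (v : ℝ × E d) :
    mol (pd v ρ) φ = mol ρ (pd v φ) := by
  funext z
  have hd : ∀ ζ, HasFDerivAt (fun ζ ↦ φ (z - ζ))
      ((fderiv ℝ φ (z - ζ)).comp (-(ContinuousLinearMap.id ℝ (ℝ × E d)))) ζ := fun ζ ↦
    (hφ.differentiable _).hasFDerivAt.comp ζ ((hasFDerivAt_id ζ).const_sub z)
  have hv : ∀ ζ, fderiv ℝ (fun ζ ↦ φ (z - ζ)) ζ v = -pd v φ (z - ζ) := fun ζ ↦ by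
    rw [(hd ζ).fderiv]
    simp [pd]
  have hi : ∀ {k ψ : ℝ × E d → ℝ}, Integrable k → CylTest a b ψ →
      Integrable fun ζ ↦ k ζ * ψ (z - ζ) := fun hk hψ ↦ by
    obtain ⟨C, hC⟩ := hψ.exists_bound
    exact hk.mul_bdd (c := C) (hψ.aestronglyMeasurable_comp (by fun_prop))
      (Filter.Eventually.of_forall fun ζ ↦ hC _)
  have h := integral_mul_fderiv_eq_neg_fderiv_mul_of_integrable (μ := (volume : Measure (ℝ × E d)))
    (f := ρ) (g := fun ζ ↦ φ (z - ζ)) (v := v) (hi (hρ.integrable_pd v) hφ) ?_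
    (hi hρ.integrable hφ) (fun ζ _ ↦ hρ.smooth.differentiable (by simp) ζ)
    (fun ζ _ ↦ (hd ζ).differentiableAt)
  · simp only [hv, mul_neg, integral_neg, neg_inj] at h
    exact h.symm
  · simp only [hv, mul_neg]
    exact (hi hρ.integrable (hφ.pd v)).neg

instance : ENNReal.HolderTriple ⊤ 1 1 := ⟨by simp⟩
instance : ENNReal.HolderTriple 1 ⊤ 1 := ⟨by simp⟩

lemma HolderField.cylLp (hU : HolderField T θ U) (i : Fin d) : CylLp T 3 fun z ↦ U z i :=
  ⟨hU.measurable_apply i, hU.inv.comp fun v ↦ v i, fun t ht x ↦ by simp [hU.eq_zero t ht x],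
    hU.memLp_apply i⟩

lemma HolderField.cylLp_mul (hU : HolderField T θ U) (i j : Fin d) :
    CylLp T (3 / 2) fun z ↦ U z i * U z j := (hU.cylLp i).mul (hU.cylLp j)

lemma HolderField.cylLp_sq (hU : HolderField T θ U) : CylLp T (3 / 2) fun z ↦ ‖U z‖ ^ 2 where
  measurable := hU.measurable.norm.pow_const 2
  inv := hU.inv.comp fun v ↦ ‖v‖ ^ 2
  eq_zero t ht x := by simp [hU.eq_zero t ht x]
  memLp := by
    have : (fun z ↦ ‖U z‖ ^ 2) = fun z ↦ ∑ i, U z i * U z i := funext fun z ↦ by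
      rw [EuclideanSpace.norm_sq_eq]
      exact Finset.sum_congr rfl fun i _ ↦ by rw [Real.norm_eq_abs, sq_abs, pow_two]
    rw [this]
    exact memLp_finsetSum _ fun i _ ↦ (hU.cylLp_mul i i).memLp

lemma HolderField.cylLp_mul_sq (hU : HolderField T θ U) (i : Fin d) :
    CylLp T 1 fun z ↦ U z i * ‖U z‖ ^ 2 := (hU.cylLp i).mul hU.cylLp_sq

lemma EulerSystem.cylLp_pressure (h : EulerSystem T θ U Q) : CylLp T (3 / 2) Q :=
  ⟨h.measurable_pressure, cylinderSystem_inv.2 h.periodic_pressure, h.eq_zero_pressure,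
    h.memLp_pressure⟩

lemma three_halves_le_three : (3 / 2 : ℝ≥0∞) ≤ 3 := by
  refine ENNReal.div_le_of_le_mul ?_
  norm_num

/-- The integral over `z` of the `i`-th component of the cubic increment `|δU|² δU`, where
`δU = U (z - ζ) - U z`, against the test function. -/
noncomputable def cubic (U : ℝ × E d → E d) (φ : ℝ × E d → ℝ) (i : Fin d) (ζ : ℝ × E d) : ℝ :=
  ∫ z, φ z * ((U (z - ζ) i - U z i) * ‖U (z - ζ) - U z‖ ^ 2) ∂(cylinder d)

namespace EulerSystem

/-- The divergence-free condition, tested with `ρ * (A φ)`. -/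
lemma sum_bil_pd_left (h : EulerSystem T θ U Q) (hρ : IsMollifier δ ε ρ) (ha : δ < a)
    (hb : b + δ < T) (hφ : CylTest a b φ)
    (hA : CylLp T (3 / 2) A) : ∑ i, bil (pd (ex i) ρ) (fun z ↦ A z * φ z) (fun z ↦ U z i) = 0 := by
  have hA' := hA.mul_test hφ
  have h1 := h.divFree _ _ _ (by linarith) hb (hρ.cylTest_mol_mul hφ hA one_le_three_halves)
  simp only [fun i ↦ hρ.integral_mul_pd_mol (h.field.cylLp i) hA' one_le_three_halves (ex i)] at h1
  rw [← neg_eq_zero, ← Finset.sum_neg_distrib, ← h1]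
  exact Finset.sum_congr rfl fun i _ ↦
    (bil_comm_of_odd (h.field.cylLp i) hA' (hρ.odd_pd (ex i))).symm

/-- The divergence-free condition, tested with `φ (ρ * B)`. -/
lemma sum_bil_pd_right (h : EulerSystem T θ U Q) (hρ : IsMollifier δ ε ρ) (ha : 0 < a) (hb : b < T)
    (hφ : CylTest a b φ)
    (hB : CylLp T (3 / 2) B) : ∑ i, bil (pd (ex i) ρ) (fun z ↦ U z i * φ z) B =
      -∑ i, bil ρ (fun z ↦ U z i * pd (ex i) φ z) B := by
  have h1 := h.divFree _ _ _ ha hb (hρ.cylTest_mul_mol hφ hB one_le_three_halves)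
  simp only [fun i ↦ hρ.integral_mul_pd_mul_mol hφ (h.field.cylLp i) hB one_le_three_halves (ex i),
    Finset.sum_add_distrib] at h1
  linarith

/-- The momentum equation tested with `φ (ρ * u) + ρ * (φ u)`. The time derivatives of the mollifier
cancel since it is even. -/
lemma balance (h : EulerSystem T θ U Q) (hρ : IsMollifier δ ε ρ) (hδ : 0 ≤ δ) (ha : δ < a)
    (hb : b + δ < T) (hφ : CylTest a b φ) :
    ∑ j, bil ρ (fun z ↦ U z j * pd et φ z) (fun z ↦ U z j) +
    ∑ j, ∑ i, bil ρ (fun z ↦ U z i * U z j * pd (ex i) φ z) (fun z ↦ U z j) +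
    ∑ j, bil ρ (fun z ↦ Q z * pd (ex j) φ z) (fun z ↦ U z j) +
    ∑ j, bil ρ (fun z ↦ U z j * pd (ex j) φ z) Q +
    ∑ j, ∑ i, (bil (pd (ex i) ρ) (fun z ↦ U z i * U z j * φ z) (fun z ↦ U z j) -
      bil (pd (ex i) ρ) (fun z ↦ U z j * φ z) (fun z ↦ U z i * U z j)) = 0 := by
  have hu := h.field.cylLp
  have huu := h.field.cylLp_mul
  have hQ := h.cylLp_pressure
  have hu' := fun j ↦ (hu j).mono three_halves_le_three
  have h3 : (1 : ℝ≥0∞) ≤ 3 := by norm_num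
  -- the equation for the `j`-th component tested with `φ (ρ * uⱼ)`
  have hE1 : ∀ j, bil ρ (fun z ↦ U z j * pd et φ z) (fun z ↦ U z j) +
      bil (pd et ρ) (fun z ↦ U z j * φ z) (fun z ↦ U z j) +
      ∑ i, (bil ρ (fun z ↦ U z i * U z j * pd (ex i) φ z) (fun z ↦ U z j) +
        bil (pd (ex i) ρ) (fun z ↦ U z i * U z j * φ z) (fun z ↦ U z j)) +
      (bil ρ (fun z ↦ Q z * pd (ex j) φ z) (fun z ↦ U z j) +
        bil (pd (ex j) ρ) (fun z ↦ Q z * φ z) (fun z ↦ U z j)) = 0 := fun j ↦ by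
    have h1 := h.momentum _ _ _ j (by linarith) (by linarith) (hρ.cylTest_mul_mol hφ (hu j) h3)
    rw [hρ.integral_mul_pd_mul_mol hφ (hu' j) (hu j) h3,
      hρ.integral_mul_pd_mul_mol hφ hQ (hu j) h3] at h1
    simp only [fun i ↦ hρ.integral_mul_pd_mul_mol hφ (huu i j) (hu j) h3] at h1
    exact h1
  -- the equation for the `j`-th component tested with `ρ * (φ uⱼ)`
  have hE2 : ∀ j, bil (pd et ρ) (fun z ↦ U z j) (fun z ↦ U z j * φ z) +
      ∑ i, bil (pd (ex i) ρ) (fun z ↦ U z i * U z j) (fun z ↦ U z j * φ z) +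
      bil (pd (ex j) ρ) Q (fun z ↦ U z j * φ z) = 0 := fun j ↦ by
    have hj := (hu j).mul_test hφ
    have h1 := h.momentum _ _ _ j (by linarith) hb (hρ.cylTest_mol_mul hφ (hu j) h3)
    rw [hρ.integral_mul_pd_mol (hu' j) hj h3, hρ.integral_mul_pd_mol hQ hj h3] at h1
    simp only [fun i ↦ hρ.integral_mul_pd_mol (huu i j) hj h3] at h1
    exact h1
  have hsum : ∑ j, _ = ∑ j, (0 : ℝ) := Finset.sum_congr rfl fun j _ ↦
    (congrArg₂ (· + ·) (hE1 j) (hE2 j)).trans (add_zero 0)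
  have e1 : ∀ j, bil (pd et ρ) (fun z ↦ U z j) (fun z ↦ U z j * φ z) =
      -bil (pd et ρ) (fun z ↦ U z j * φ z) (fun z ↦ U z j) := fun j ↦
    bil_comm_of_odd (hu j) ((hu j).mul_test hφ) (hρ.odd_pd et)
  have e2 : ∀ i j, bil (pd (ex i) ρ) (fun z ↦ U z i * U z j) (fun z ↦ U z j * φ z) =
      -bil (pd (ex i) ρ) (fun z ↦ U z j * φ z) (fun z ↦ U z i * U z j) := fun i j ↦
    bil_comm_of_odd (huu i j) ((hu j).mul_test hφ) (hρ.odd_pd (ex i))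
  have e3 : ∀ j, bil (pd (ex j) ρ) Q (fun z ↦ U z j * φ z) =
      -bil (pd (ex j) ρ) (fun z ↦ U z j * φ z) Q := fun j ↦
    bil_comm_of_odd hQ ((hu j).mul_test hφ) (hρ.odd_pd (ex j))
  have e4 := h.sum_bil_pd_left hρ ha hb hφ hQ
  have e5 := h.sum_bil_pd_right hρ (by linarith) (by linarith) hφ hQ
  simp only [e1, e2, e3, Finset.sum_add_distrib, Finset.sum_neg_distrib, Finset.sum_const_zero,
    e4] at hsum
  simp only [Finset.sum_sub_distrib]
  linarith

/-- Linearity of the integral for the terms that arise from multiplying out a cubic increment. -/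
lemma integral_cubic_expansion {α ι : Type*} [Fintype ι] [MeasurableSpace α] {μ : Measure α}
    {f₁ f₂ f₃ f₄ : α → ℝ} {g k : ι → α → ℝ} (h₁ : Integrable f₁ μ) (h₂ : Integrable f₂ μ)
    (h₃ : Integrable f₃ μ) (hg : ∀ j, Integrable (g j) μ) (hk : ∀ j, Integrable (k j) μ)
    (h₄ : Integrable f₄ μ) :
    ∫ x, (f₁ x + f₂ x - f₃ x + 2 * ∑ j, (g j x - k j x) - f₄ x) ∂μ =
      ∫ x, f₁ x ∂μ + ∫ x, f₂ x ∂μ - ∫ x, f₃ x ∂μ +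
        2 * ∑ j, (∫ x, g j x ∂μ - ∫ x, k j x ∂μ) - ∫ x, f₄ x ∂μ := by
  have i1 : Integrable (fun x ↦ f₁ x + f₂ x) μ := h₁.add h₂
  have i2 : Integrable (fun x ↦ f₁ x + f₂ x - f₃ x) μ := i1.sub h₃
  have i3 : ∀ j, Integrable (fun x ↦ g j x - k j x) μ := fun j ↦ (hg j).sub (hk j)
  have i4 : Integrable (fun x ↦ 2 * ∑ j, (g j x - k j x)) μ :=
    (integrable_finsetSum _ fun j _ ↦ i3 j).const_mul 2
  have i5 : Integrable (fun x ↦ f₁ x + f₂ x - f₃ x + 2 * ∑ j, (g j x - k j x)) μ := i2.add i4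
  rw [integral_sub i5 h₄, integral_add i2 i4, integral_sub i1 h₃, integral_add h₁ h₂,
    integral_const_mul, integral_finsetSum _ fun j _ ↦ i3 j]
  simp only [integral_sub (hg _) (hk _)]

/-- The cubic increments multiplied out. The term without a translate drops out, since the
derivative of the mollifier has mean zero. -/
lemma integral_pd_mul_cubic (h : EulerSystem T θ U Q) (hρ : IsMollifier δ ε ρ) (ha : 0 < a)
    (hb : b < T) (hφ : CylTest a b φ) (i : Fin d) :
    ∫ ζ, pd (ex i) ρ ζ * cubic U φ i ζ =
      bil (pd (ex i) ρ) φ (fun z ↦ U z i * ‖U z‖ ^ 2) +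
      bil (pd (ex i) ρ) (fun z ↦ ‖U z‖ ^ 2 * φ z) (fun z ↦ U z i) -
      bil (pd (ex i) ρ) (fun z ↦ U z i * φ z) (fun z ↦ ‖U z‖ ^ 2) +
      2 * ∑ j, (bil (pd (ex i) ρ) (fun z ↦ U z i * U z j * φ z) (fun z ↦ U z j) -
        bil (pd (ex i) ρ) (fun z ↦ U z j * φ z) (fun z ↦ U z i * U z j)) := by
  have hu := h.field.cylLp
  have huu := h.field.cylLp_mul
  have hsq := h.field.cylLp_sq
  have hφ1 := hφ.cylLp ha hb ⊤
  have hu3 := h.field.cylLp_mul_sq i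
  have hcub : ∀ ζ, cubic U φ i ζ = corr φ (fun z ↦ U z i * ‖U z‖ ^ 2) ζ +
      corr (fun z ↦ ‖U z‖ ^ 2 * φ z) (fun z ↦ U z i) ζ -
      corr (fun z ↦ U z i * φ z) (fun z ↦ ‖U z‖ ^ 2) ζ +
      2 * ∑ j, (corr (fun z ↦ U z i * U z j * φ z) (fun z ↦ U z j) ζ -
        corr (fun z ↦ U z j * φ z) (fun z ↦ U z i * U z j) ζ) -
      ∫ z, U z i * ‖U z‖ ^ 2 * φ z ∂(cylinder d) := fun ζ ↦ by
    have i1 := integrable_corr_integrand hφ1 hu3 ζ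
    have i2 := integrable_corr_integrand (hsq.mul_test hφ) (hu i) ζ
    have i3 := integrable_corr_integrand ((hu i).mul_test hφ) hsq ζ
    have i4 := fun j ↦ integrable_corr_integrand ((huu i j).mul_test hφ) (hu j) ζ
    have i5 := fun j ↦ integrable_corr_integrand ((hu j).mul_test hφ) (huu i j) ζ
    have i6 := (hu3.mul_test hφ).integrable le_rfl
    refine Eq.trans (integral_congr_ae (Filter.Eventually.of_forall fun z ↦ ?_))
      (integral_cubic_expansion i1 i2 i3 i4 i5 i6)
    have hn : ‖U (z - ζ) - U z‖ ^ 2 =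
        ‖U (z - ζ)‖ ^ 2 + ‖U z‖ ^ 2 - 2 * ∑ j, U z j * U (z - ζ) j := by
      rw [norm_sub_sq_real, PiLp.inner_apply]
      simp only [RCLike.inner_apply, conj_trivial]
      ring
    have hs : ∑ j, (U z i * U z j * φ z * U (z - ζ) j - U z j * φ z * (U (z - ζ) i * U (z - ζ) j)) =
        (U z i * φ z - φ z * U (z - ζ) i) * ∑ j, U z j * U (z - ζ) j := by
      rw [Finset.mul_sum]
      exact Finset.sum_congr rfl fun j _ ↦ by ring
    simp only [hn, hs]
    ring
  have hk := hρ.integrable_pd (ex i)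
  have j1 := integrable_mul_corr hk hφ1 hu3
  have j2 := integrable_mul_corr hk (hsq.mul_test hφ) (hu i)
  have j3 := integrable_mul_corr hk ((hu i).mul_test hφ) hsq
  have j4 := fun j ↦ integrable_mul_corr hk ((huu i j).mul_test hφ) (hu j)
  have j5 := fun j ↦ integrable_mul_corr hk ((hu j).mul_test hφ) (huu i j)
  have j6 := hk.mul_const (∫ z, U z i * ‖U z‖ ^ 2 * φ z ∂(cylinder d))
  have j6' : ∫ ζ, pd (ex i) ρ ζ * (∫ z, U z i * ‖U z‖ ^ 2 * φ z ∂(cylinder d)) = 0 := by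
    rw [integral_mul_const, hρ.integral_pd, zero_mul]
  refine Eq.trans (integral_congr_ae (Filter.Eventually.of_forall fun ζ ↦ ?_))
    ((integral_cubic_expansion j1 j2 j3 j4 j5 j6).trans (by rw [j6', sub_zero]; rfl))
  simp only [hcub, ← mul_sub, ← Finset.mul_sum]
  ring

/-- The energy balance of the mollified velocity: by the cubic identity of Duchon and Robert, the
commutators of the convection term are the average of the cubic increments. -/
lemma energy_balance (h : EulerSystem T θ U Q) (hρ : IsMollifier δ ε ρ) (hδ : 0 ≤ δ) (ha : δ < a)
    (hb : b + δ < T) (hφ : CylTest a b φ) :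
    ∑ j, bil ρ (fun z ↦ U z j * pd et φ z) (fun z ↦ U z j) +
    ∑ j, ∑ i, bil ρ (fun z ↦ U z i * U z j * pd (ex i) φ z) (fun z ↦ U z j) +
    ∑ j, bil ρ (fun z ↦ Q z * pd (ex j) φ z) (fun z ↦ U z j) +
    ∑ j, bil ρ (fun z ↦ U z j * pd (ex j) φ z) Q +
    2⁻¹ * ∑ i, bil ρ (pd (ex i) φ) (fun z ↦ U z i * ‖U z‖ ^ 2) -
    2⁻¹ * ∑ i, bil ρ (fun z ↦ U z i * pd (ex i) φ z) (fun z ↦ ‖U z‖ ^ 2) =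
      -(2⁻¹ * ∑ i, ∫ ζ, pd (ex i) ρ ζ * cubic U φ i ζ) := by
  have ha' : 0 < a := hδ.trans_lt ha
  have hb' : b < T := by linarith
  have hu3 := h.field.cylLp_mul_sq
  have e1 : ∀ i, bil (pd (ex i) ρ) φ (fun z ↦ U z i * ‖U z‖ ^ 2) =
      -bil ρ (pd (ex i) φ) (fun z ↦ U z i * ‖U z‖ ^ 2) := fun i ↦ by
    rw [bil_comm_of_odd (hφ.cylLp ha' hb' ⊤) (hu3 i) (hρ.odd_pd (ex i)),
      bil_comm_of_even ((hφ.pd (ex i)).cylLp ha' hb' ⊤) (hu3 i) hρ.even,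
      ← integral_mul_mol (hρ.integrable_pd (ex i)) (hu3 i) (hφ.cylLp ha' hb' ⊤),
      ← integral_mul_mol hρ.integrable (hu3 i) ((hφ.pd (ex i)).cylLp ha' hb' ⊤), hρ.mol_pd hφ]
  have h1 := h.balance hρ hδ ha hb hφ
  have h2 := h.sum_bil_pd_left hρ ha hb hφ h.field.cylLp_sq
  have h3 := h.sum_bil_pd_right hρ ha' hb' hφ h.field.cylLp_sq
  simp only [fun i ↦ h.integral_pd_mul_cubic hρ ha' hb' hφ i, e1, Finset.sum_add_distrib,
    Finset.sum_sub_distrib, Finset.sum_neg_distrib, h2, h3, ← Finset.mul_sum]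
  have h4 := Finset.sum_comm (s := Finset.univ) (t := Finset.univ)
    (f := fun i j ↦ bil (pd (ex i) ρ) (fun z ↦ U z i * U z j * φ z) fun z ↦ U z j)
  have h5 := Finset.sum_comm (s := Finset.univ) (t := Finset.univ)
    (f := fun i j ↦ bil (pd (ex i) ρ) (fun z ↦ U z j * φ z) fun z ↦ U z i * U z j)
  simp only [Finset.sum_sub_distrib] at h1
  linarith

end EulerSystem

end Balance

/-! ### Removing the mollification -/

section Limit

variable {d : ℕ} {T θ a b : ℝ} {U : ℝ × E d → E d} {Q A B φ : ℝ × E d → ℝ} {p q : ℝ≥0∞}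

lemma tendsto_corr [ENNReal.HolderTriple p q 1] (hA : CylLp T p A) (hB : CylLp T q B) (hq1 : 1 ≤ q)
    (hq : q ≠ ⊤) :
    Filter.Tendsto (corr A B) (nhds 0) (nhds (∫ z, A z * B z ∂(cylinder d))) := by
  have h1 := tendsto_eLpNorm_translate hB.measurable hB.inv hB.eq_zero hq1 hq hB.memLp
  have h2 := ENNReal.Tendsto.const_mul (a := eLpNorm A p (cylinder d)) h1 (Or.inr hA.memLp.2.ne)
  rw [mul_zero] at h2
  rw [tendsto_iff_edist_tendsto_0]
  refine tendsto_of_tendsto_of_tendsto_of_le_of_le tendsto_const_nhds h2 (fun _ ↦ bot_le)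
    fun ζ ↦ ?_
  have h3 : corr A B ζ - ∫ z, A z * B z ∂(cylinder d) =
      ∫ z, A z * (B (z - ζ) - B z) ∂(cylinder d) := by
    rw [corr, ← integral_sub (integrable_corr_integrand hA hB ζ)]
    · simp only [mul_sub]
    · simpa using integrable_corr_integrand hA hB 0
  rw [edist_eq_enorm_sub, h3]
  refine (enorm_integral_le_lintegral_enorm _).trans ?_
  rw [← eLpNorm_one_eq_lintegral_enorm]
  exact eLpNorm_smul_le_mul_eLpNorm (φ := A) (f := fun z ↦ B (z - ζ) - B z)
    ((hB.inv.memLp_sub hB.memLp ζ).sub hB.memLp).1 hA.memLp.1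

/-- Mollification converges weakly, for any dual pair of exponents of which the second is finite. -/
lemma tendsto_bil [ENNReal.HolderTriple p q 1] (hA : CylLp T p A) (hB : CylLp T q B) (hq1 : 1 ≤ q)
    (hq : q ≠ ⊤) {δ ε : ℕ → ℝ} {ρ : ℕ → ℝ × E d → ℝ} (hρ : ∀ n, IsMollifier (δ n) (ε n) (ρ n))
    (hδ : Filter.Tendsto δ Filter.atTop (nhds 0)) (hε : Filter.Tendsto ε Filter.atTop (nhds 0)) :
    Filter.Tendsto (fun n ↦ bil (ρ n) A B) Filter.atTop (nhds (∫ z, A z * B z ∂(cylinder d))) := by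
  rw [Metric.tendsto_nhds]
  intro η hη
  obtain ⟨r, hr, h⟩ := Metric.eventually_nhds_iff.1
    (Metric.tendsto_nhds.1 (tendsto_corr hA hB hq1 hq) (η / 2) (by positivity))
  filter_upwards [hδ.eventually_lt_const hr, hε.eventually_lt_const hr] with n h1 h2
  set L := ∫ z, A z * B z ∂(cylinder d)
  have h3 : bil (ρ n) A B - L = ∫ ζ, ρ n ζ * (corr A B ζ - L) := by
    simp only [mul_sub]
    rw [integral_sub (integrable_mul_corr (hρ n).integrable hA hB)
      ((hρ n).integrable.mul_const L), integral_mul_const, (hρ n).integral_eq_one, one_mul, bil]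
  rw [Real.dist_eq, h3]
  refine lt_of_le_of_lt (b := η / 2) ?_ (by linarith)
  have h4 : η / 2 = ∫ ζ, ρ n ζ * (η / 2) := by
    rw [integral_mul_const, (hρ n).integral_eq_one, one_mul]
  rw [h4, ← Real.norm_eq_abs]
  refine norm_integral_le_of_norm_le ((hρ n).integrable.mul_const _)
    (Filter.Eventually.of_forall fun ζ ↦ ?_)
  rw [Real.norm_eq_abs, abs_mul, abs_of_nonneg ((hρ n).nonneg ζ)]
  by_cases h0 : ρ n ζ = 0
  · simp [h0]
  · obtain ⟨h5, h6⟩ := (hρ n).eq_zero ζ h0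
    refine mul_le_mul_of_nonneg_left (h ?_).le ((hρ n).nonneg ζ)
    rw [dist_zero_right, Prod.norm_def]
    exact max_lt (h5.trans_lt h1) (h6.trans_lt h2)

/-- Anisotropic mollifiers: the time scale `δ` is arbitrary, and the spatial gradient is of order
`2ᵏ` in `L¹`, uniformly in `δ`. -/
lemma exists_isMollifier (d : ℕ) : ∃ C : ℝ≥0∞, C ≠ ⊤ ∧ ∀ k : ℕ, ∀ δ : ℝ, 0 < δ →
    ∃ ρ : ℝ × E d → ℝ, IsMollifier δ ((2 : ℝ) ^ k)⁻¹ ρ ∧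
      ∀ i, ∫⁻ ζ, ‖pd (ex i) ρ ζ‖ₑ ≤ C * ENNReal.ofReal ((2 : ℝ) ^ k) := by
  let f : ContDiffBump (0 : E d) := ⟨1 / 2, 1, by norm_num, by norm_num⟩
  set χ : E d → ℝ := f.normed volume with hχ
  have hχs : ContDiff ℝ ∞ χ := f.contDiff_normed
  have hχd : ∀ v, Continuous fun y ↦ fderiv ℝ χ y v := fun v ↦
    (hχs.continuous_fderiv (by simp)).clm_apply continuous_const
  have hχi : ∀ v, Integrable fun y ↦ fderiv ℝ χ y v := fun v ↦
    (hχd v).integrable_of_hasCompactSupport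
      ((f.hasCompactSupport_normed.fderiv ℝ).comp_left (g := fun L : E d →L[ℝ] ℝ ↦ L v) rfl)
  refine ⟨∑ i : Fin d, ∫⁻ y, ‖fderiv ℝ χ y (EuclideanSpace.single i 1)‖ₑ,
    ENNReal.sum_ne_top.2 fun i _ ↦ (hχi _).2.ne, fun k δ hδ ↦ ?_⟩
  let g : ContDiffBump (0 : ℝ) := ⟨δ / 2, δ, by positivity, by linarith⟩
  set η : ℝ → ℝ := g.normed volume with hη
  have hηs : ContDiff ℝ ∞ η := g.contDiff_normed
  have h2k : (0 : ℝ) < 2 ^ k := by positivity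
  have hds : ContDiff ℝ ∞ (dil k χ) :=
    (hχs.comp (contDiff_const_smul ((2 : ℝ) ^ k))).const_smul (((2 : ℝ) ^ k) ^ d)
  refine ⟨fun ζ ↦ η ζ.1 * dil k χ ζ.2, ⟨?_, fun ζ ↦ ?_, fun ζ ↦ ?_, fun ζ hζ ↦ ?_, ?_⟩, fun i ↦ ?_⟩
  · exact (hηs.comp contDiff_fst).mul (hds.comp contDiff_snd)
  · simp only [Prod.fst_neg, Prod.snd_neg, dil, smul_neg, hη, hχ, ContDiffBump.normed_neg]
  · exact mul_nonneg (g.nonneg_normed _) (smul_nonneg (by positivity) (f.nonneg_normed _))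
  · have h1 : ζ.1 ∈ Function.support η := left_ne_zero_of_mul hζ
    have h2 : (2 : ℝ) ^ k • ζ.2 ∈ Function.support χ :=
      right_ne_zero_of_smul (right_ne_zero_of_mul hζ)
    rw [hη, g.support_normed_eq, mem_ball_zero_iff] at h1
    rw [hχ, f.support_normed_eq, mem_ball_zero_iff, norm_smul, Real.norm_of_nonneg h2k.le] at h2
    refine ⟨h1.le, ?_⟩
    rw [← one_div, le_div_iff₀' h2k]
    exact h2.le
  · rw [Measure.volume_eq_prod, integral_prod_mul, g.integral_normed, one_mul]
    simp only [dil]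
    rw [integral_smul, Measure.integral_comp_smul, f.integral_normed, finrank_euclideanSpace_fin,
      abs_of_pos (by positivity), smul_eq_mul, smul_eq_mul, mul_one,
      mul_inv_cancel₀ (by positivity)]
  · have h1 : ∀ ζ, pd (ex i) (fun ζ ↦ η ζ.1 * dil k χ ζ.2) ζ = η ζ.1 *
        ((2 : ℝ) ^ k * dil k (fun y ↦ fderiv ℝ χ y (EuclideanSpace.single i 1)) ζ.2) := fun ζ ↦ by
      have e1 : HasFDerivAt (fun ζ : ℝ × E d ↦ η ζ.1) _ ζ :=
        (hηs.differentiable (by simp) ζ.1).hasFDerivAt.comp ζ hasFDerivAt_fst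
      have e2 : HasFDerivAt (fun ζ : ℝ × E d ↦ (2 : ℝ) ^ k • ζ.2)
          ((2 : ℝ) ^ k • ContinuousLinearMap.snd ℝ ℝ (E d)) ζ :=
        ((2 : ℝ) ^ k • ContinuousLinearMap.snd ℝ ℝ (E d)).hasFDerivAt
      have e3 : HasFDerivAt (fun ζ : ℝ × E d ↦ dil k χ ζ.2) _ ζ :=
        ((hχs.differentiable (by simp) ((2 : ℝ) ^ k • ζ.2)).hasFDerivAt.comp ζ e2).const_smul
          (((2 : ℝ) ^ k) ^ d)
      rw [pd, show fderiv ℝ (fun ζ : ℝ × E d ↦ η ζ.1 * dil k χ ζ.2) ζ = _ from (e1.mul e3).fderiv]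
      simp [ex, dil, -mul_eq_mul_left_iff]
      ring
    simp only [h1, enorm_mul]
    rw [Measure.volume_eq_prod, lintegral_prod_mul (f := fun s ↦ ‖η s‖ₑ)
      (g := fun y ↦ ‖(2 : ℝ) ^ k‖ₑ * ‖dil k (fun y ↦ fderiv ℝ χ y (EuclideanSpace.single i 1)) y‖ₑ)
      hηs.continuous.enorm.measurable.aemeasurable
      ((integrable_dil k (hχi _)).1.enorm.const_mul _)]
    have h2 : ∫⁻ s, ‖η s‖ₑ = 1 := by
      rw [← ofReal_integral_norm_eq_lintegral_enorm g.integrable_normed]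
      simp only [Real.norm_of_nonneg (g.nonneg_normed _), g.integral_normed, ENNReal.ofReal_one]
    rw [h2, one_mul, lintegral_const_mul' _ _ enorm_ne_top,
      lintegral_enorm_dil k (hχd _).aestronglyMeasurable, Real.enorm_of_nonneg h2k.le, mul_comm]
    gcongr
    exact Finset.single_le_sum
      (f := fun i : Fin d ↦ ∫⁻ y, ‖fderiv ℝ χ y (EuclideanSpace.single i 1)‖ₑ)
      (fun _ _ ↦ bot_le) (Finset.mem_univ i)

/-- An increment in space-time is bounded by an increment in time and one in space. -/
lemma HolderField.eLpNorm_sub_le (hU : HolderField T θ U) {C : ℝ≥0∞}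
    (hC : ∀ y : E d, eLpNorm (fun z ↦ U (z - (0, y)) - U z) 3 (cylinder d) ≤
      C * ENNReal.ofReal (‖y‖ ^ θ)) (ζ : ℝ × E d) :
    eLpNorm (fun z ↦ U (z - ζ) - U z) 3 (cylinder d) ≤
      eLpNorm (fun z ↦ U (z - (ζ.1, 0)) - U z) 3 (cylinder d) +
        C * ENNReal.ofReal (‖ζ.2‖ ^ θ) := by
  have h1 : (fun z ↦ U (z - ζ) - U z) = (fun z ↦ U (z - (0, ζ.2) - (ζ.1, 0)) - U (z - (0, ζ.2))) +
      fun z ↦ U (z - (0, ζ.2)) - U z := by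
    ext1 z
    have : z - (0, ζ.2) - (ζ.1, 0) = z - ζ := by
      rw [sub_sub]
      congr 1
      ext <;> simp
    simp [this]
  have hm := fun ζ ↦ hU.inv.memLp_sub hU.memLp ζ
  have h2 : MemLp (fun z ↦ U (z - (ζ.1, 0)) - U z) 3 (cylinder d) := (hm _).sub hU.memLp
  have h3 := ((hU.inv.shift_sub (ζ.1, 0)).sub hU.inv).eLpNorm_sub h2.1 3 (0, ζ.2)
  have h4 := ((hU.inv.shift_sub (ζ.1, 0)).sub hU.inv).memLp_sub h2 (0, ζ.2)
  rw [h1]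
  refine (eLpNorm_add_le h4.1 ((hm _).sub hU.memLp).1 (by norm_num)).trans ?_
  gcongr
  · exact h3.le
  · exact hC _

lemma enorm_cubic_le (U : ℝ × E d → E d) {M : ℝ} (hM : ∀ z, ‖φ z‖ ≤ M) (i : Fin d) (ζ : ℝ × E d) :
    ‖cubic U φ i ζ‖ₑ ≤
      ENNReal.ofReal M * eLpNorm (fun z ↦ U (z - ζ) - U z) 3 (cylinder d) ^ 3 := by
  have h3 := eLpNorm_nnreal_pow_eq_lintegral (p := 3) (μ := cylinder d)
    (f := fun z ↦ U (z - ζ) - U z) (by norm_num)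
  simp only [NNReal.coe_ofNat, ENNReal.coe_ofNat, ENNReal.rpow_ofNat] at h3
  rw [h3, ← lintegral_const_mul' _ _ ENNReal.ofReal_ne_top]
  refine (enorm_integral_le_lintegral_enorm _).trans (lintegral_mono fun z ↦ ?_)
  rw [enorm_mul]
  refine mul_le_mul' ?_ ?_
  · rw [← ofReal_norm]
    exact ENNReal.ofReal_le_ofReal (hM z)
  · rw [enorm_mul, enorm_pow, enorm_norm, pow_succ' _ 2]
    gcongr
    rw [← ofReal_norm, ← ofReal_norm]
    exact ENNReal.ofReal_le_ofReal (PiLp.norm_apply_le (U (z - ζ) - U z) i)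

/-- Mollifiers along which the flux vanishes: the time scale is chosen so small that the increments
of the velocity in time are dominated by those in space, and then the flux at scale `2⁻ᵏ` is of
order `2ᵏ 2⁻³ᵏᶿ`. -/
lemma HolderField.exists_mollifiers (hU : HolderField T θ U) (hθ : 1 / 3 < θ) (ha : 0 < a)
    (hb : b < T) (hφ : CylTest a b φ) : ∃ (δ ε : ℕ → ℝ) (ρ : ℕ → ℝ × E d → ℝ),
      (∀ k, IsMollifier (δ k) (ε k) (ρ k)) ∧ (∀ k, 0 < δ k ∧ δ k < a ∧ b + δ k < T) ∧
      Filter.Tendsto δ Filter.atTop (nhds 0) ∧ Filter.Tendsto ε Filter.atTop (nhds 0) ∧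
      ∀ i, Filter.Tendsto (fun k ↦ ∫ ζ, pd (ex i) (ρ k) ζ * cubic U φ i ζ) Filter.atTop
        (nhds 0) := by
  obtain ⟨C, hCt, hC⟩ := hU.increment
  obtain ⟨C', hCt', hmol⟩ := exists_isMollifier d
  obtain ⟨M, hM⟩ := hφ.exists_bound
  have hε0 : Filter.Tendsto (fun k : ℕ ↦ ((2 : ℝ) ^ k)⁻¹) Filter.atTop (nhds 0) := by
    simp only [← inv_pow]
    exact tendsto_pow_atTop_nhds_zero_of_lt_one (by norm_num) (by norm_num)
  have hex : ∀ k : ℕ, ∃ δ > 0, δ < a ∧ b + δ < T ∧ δ ≤ ((2 : ℝ) ^ k)⁻¹ ∧ ∀ s : ℝ, |s| ≤ δ →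
      eLpNorm (fun z ↦ U (z - (s, 0)) - U z) 3 (cylinder d) ≤
        ENNReal.ofReal ((((2 : ℝ) ^ k)⁻¹) ^ θ) := fun k ↦ by
    have h1 := (tendsto_eLpNorm_translate hU.measurable hU.inv hU.eq_zero (p := 3) (by norm_num)
      (by norm_num) hU.memLp)
    have h2 : Filter.Tendsto (fun s : ℝ ↦ (s, (0 : E d))) (nhds 0) (nhds 0) :=
      (by fun_prop : Continuous fun s : ℝ ↦ (s, (0 : E d))).tendsto 0
    obtain ⟨r, hr, h3⟩ := Metric.eventually_nhds_iff.1 ((h1.comp h2).eventually_lt_const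
      (u := ENNReal.ofReal ((((2 : ℝ) ^ k)⁻¹) ^ θ)) (ENNReal.ofReal_pos.2 (by positivity)))
    have h4 : 0 < min (min r a) (min (T - b) ((2 : ℝ) ^ k)⁻¹) :=
      lt_min (lt_min hr ha) (lt_min (by linarith) (by positivity))
    set m := min (min r a) (min (T - b) ((2 : ℝ) ^ k)⁻¹)
    have m1 : m ≤ r := (min_le_left _ _).trans (min_le_left _ _)
    have m2 : m ≤ a := (min_le_left _ _).trans (min_le_right _ _)
    have m3 : m ≤ T - b := (min_le_right _ _).trans (min_le_left _ _)
    have m4 : m ≤ ((2 : ℝ) ^ k)⁻¹ := (min_le_right _ _).trans (min_le_right _ _)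
    refine ⟨m / 2, by linarith, by linarith, by linarith, by linarith, fun s hs ↦ (h3 ?_).le⟩
    rw [Real.dist_eq, sub_zero]
    linarith
  choose δ hδ0 hδa hδb hδk hδ using hex
  choose ρ hρ hρC using fun k ↦ hmol k (δ k) (hδ0 k)
  refine ⟨δ, fun k ↦ ((2 : ℝ) ^ k)⁻¹, ρ, hρ, fun k ↦ ⟨hδ0 k, hδa k, hδb k⟩,
    squeeze_zero (fun k ↦ (hδ0 k).le) hδk hε0, hε0, fun i ↦ ?_⟩
  have hpow : Filter.Tendsto (fun k : ℕ ↦ ENNReal.ofReal ((2 : ℝ) ^ (1 - 3 * θ)) ^ k) Filter.atTop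
      (nhds 0) := by
    refine ENNReal.tendsto_pow_atTop_nhds_zero_of_lt_one ?_
    rw [ENNReal.ofReal_lt_one]
    exact Real.rpow_lt_one_of_one_lt_of_neg (by norm_num) (by linarith)
  have hlim := ENNReal.Tendsto.const_mul (a := ENNReal.ofReal M * (1 + C) ^ 3 * C') hpow
    (Or.inr (by finiteness))
  rw [mul_zero] at hlim
  rw [tendsto_iff_edist_tendsto_0]
  refine tendsto_of_tendsto_of_tendsto_of_le_of_le tendsto_const_nhds hlim (fun _ ↦ bot_le)
    fun k ↦ ?_
  rw [edist_zero_right]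
  set r : ℝ := (((2 : ℝ) ^ k)⁻¹) ^ θ with hr
  have h2k : (0 : ℝ) < 2 ^ k := by positivity
  have h1 : ∀ ζ, ‖pd (ex i) (ρ k) ζ * cubic U φ i ζ‖ₑ ≤
      ‖pd (ex i) (ρ k) ζ‖ₑ * (ENNReal.ofReal M * ((1 + C) * ENNReal.ofReal r) ^ 3) := fun ζ ↦ by
    rw [enorm_mul]
    by_cases h0 : pd (ex i) (ρ k) ζ = 0
    · simp [h0]
    gcongr
    refine (enorm_cubic_le U hM i ζ).trans ?_
    obtain ⟨h5, h6⟩ := (hρ k).pd_eq_zero (ex i) ζ h0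
    gcongr
    refine (hU.eLpNorm_sub_le hC ζ).trans ?_
    rw [add_mul, one_mul]
    gcongr
    · exact hδ k _ h5
    · exact Real.rpow_le_rpow (norm_nonneg _) h6 (by linarith)
  refine (enorm_integral_le_lintegral_enorm _).trans ((lintegral_mono h1).trans ?_)
  rw [lintegral_mul_const' _ _ (by finiteness)]
  refine (mul_le_mul_left (hρC k i) _).trans (le_of_eq ?_)
  have hrk : (2 : ℝ) ^ k * r ^ 3 = ((2 : ℝ) ^ (1 - 3 * θ)) ^ k := by
    rw [hr, ← Real.rpow_natCast 2 k, ← Real.rpow_neg (by norm_num), ← Real.rpow_mul (by norm_num),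
      ← Real.rpow_natCast _ 3, ← Real.rpow_mul (by norm_num), ← Real.rpow_add (by norm_num),
      ← Real.rpow_natCast _ k, ← Real.rpow_mul (by norm_num)]
    congr 1
    push_cast
    ring
  rw [← ENNReal.ofReal_pow (by positivity), ← hrk, ENNReal.ofReal_mul h2k.le,
    ENNReal.ofReal_pow (p := r) (by positivity)]
  ring

/-- Conservation of energy above the exponent `1/3`. -/
lemma EulerSystem.integral_energy_eq_zero (h : EulerSystem T θ U Q) (hθ : 1 / 3 < θ) (ha : 0 < a)
    (hb : b < T) (hφ : CylTest a b φ) :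
    ∫ z, (‖U z‖ ^ 2 / 2 * pd et φ z +
      (‖U z‖ ^ 2 / 2 + Q z) * ∑ i, U z i * pd (ex i) φ z) ∂(cylinder d) = 0 := by
  obtain ⟨δ, ε, ρ, hρ, hδ, hδ0, hε0, hflux⟩ := h.field.exists_mollifiers hθ ha hb hφ
  have hu := h.field.cylLp
  have huu := h.field.cylLp_mul
  have hQ := h.cylLp_pressure
  have hsq := h.field.cylLp_sq
  have hu3 := h.field.cylLp_mul_sq
  have p1 : (1 : ℝ≥0∞) ≤ 3 := by norm_num
  have p2 : (3 : ℝ≥0∞) ≠ ⊤ := by norm_num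
  have p3 : (3 / 2 : ℝ≥0∞) ≠ ⊤ := by finiteness
  have l1 := fun j ↦ tendsto_bil (((hu j).mono three_halves_le_three).mul_test (hφ.pd et)) (hu j)
    p1 p2 hρ hδ0 hε0
  have l2 := fun j i ↦ tendsto_bil ((huu i j).mul_test (hφ.pd (ex i))) (hu j) p1 p2 hρ hδ0 hε0
  have l3 := fun j ↦ tendsto_bil (hQ.mul_test (hφ.pd (ex j))) (hu j) p1 p2 hρ hδ0 hε0
  have l4 := fun j ↦ tendsto_bil ((hu j).mul_test (hφ.pd (ex j))) hQ one_le_three_halves p3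
    hρ hδ0 hε0
  have l5 := fun i ↦ tendsto_bil ((hφ.pd (ex i)).cylLp ha hb ⊤) (hu3 i) le_rfl ENNReal.one_ne_top
    hρ hδ0 hε0
  have l6 := fun i ↦ tendsto_bil ((hu i).mul_test (hφ.pd (ex i))) hsq one_le_three_halves p3
    hρ hδ0 hε0
  have hl := (((((tendsto_finsetSum Finset.univ fun j _ ↦ l1 j).add
    (tendsto_finsetSum Finset.univ fun j _ ↦ tendsto_finsetSum Finset.univ fun i _ ↦ l2 j i)).add
    (tendsto_finsetSum Finset.univ fun j _ ↦ l3 j)).add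
    (tendsto_finsetSum Finset.univ fun j _ ↦ l4 j)).add
    ((tendsto_finsetSum Finset.univ fun i _ ↦ l5 i).const_mul 2⁻¹)).sub
    ((tendsto_finsetSum Finset.univ fun i _ ↦ l6 i).const_mul 2⁻¹)
  have hr := ((tendsto_finsetSum Finset.univ fun i _ ↦ hflux i).const_mul 2⁻¹).neg
  have key := tendsto_nhds_unique hl (hr.congr fun k ↦
    (h.energy_balance (hρ k) (hδ k).1.le (hδ k).2.1 (hδ k).2.2 hφ).symm)
  -- in the limit the two pressure terms agree and the two cubic terms cancel
  have e4 : ∀ j, ∫ z, U z j * pd (ex j) φ z * Q z ∂(cylinder d) =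
      ∫ z, Q z * pd (ex j) φ z * U z j ∂(cylinder d) := fun j ↦ by
    congr 1
    ext z
    ring
  have e6 : ∀ i, ∫ z, U z i * pd (ex i) φ z * ‖U z‖ ^ 2 ∂(cylinder d) =
      ∫ z, pd (ex i) φ z * (U z i * ‖U z‖ ^ 2) ∂(cylinder d) := fun i ↦ by
    congr 1
    ext z
    ring
  simp only [e4, e6, Finset.sum_const_zero, mul_zero, neg_zero] at key
  have i1 := fun j ↦ ((((hu j).mono three_halves_le_three).mul_test (hφ.pd et)).mul (hu j)
    (r := 1)).integrable le_rfl
  have i2 := fun j i ↦ (((huu i j).mul_test (hφ.pd (ex i))).mul (hu j) (r := 1)).integrable le_rfl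
  have i3 := fun j ↦ ((hQ.mul_test (hφ.pd (ex j))).mul (hu j) (r := 1)).integrable le_rfl
  have s1 := integrable_finsetSum Finset.univ fun j _ ↦ i1 j
  have s2 := integrable_finsetSum Finset.univ fun j _ ↦
    integrable_finsetSum Finset.univ fun i _ ↦ i2 j i
  have s3 := integrable_finsetSum Finset.univ fun j _ ↦ i3 j
  have hG : ∀ z, ‖U z‖ ^ 2 / 2 * pd et φ z +
      (‖U z‖ ^ 2 / 2 + Q z) * ∑ i, U z i * pd (ex i) φ z =
      2⁻¹ * (∑ j, U z j * pd et φ z * U z j + ∑ j, ∑ i, U z i * U z j * pd (ex i) φ z * U z j) +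
        ∑ j, Q z * pd (ex j) φ z * U z j := fun z ↦ by
    have g0 : ‖U z‖ ^ 2 = ∑ j, U z j * U z j := by
      rw [EuclideanSpace.norm_sq_eq]
      exact Finset.sum_congr rfl fun i _ ↦ by rw [Real.norm_eq_abs, sq_abs, pow_two]
    have g1 : ∑ j, U z j * pd et φ z * U z j = ‖U z‖ ^ 2 * pd et φ z := by
      rw [g0, Finset.sum_mul]
      exact Finset.sum_congr rfl fun i _ ↦ by ring
    have g2 : ∑ j, ∑ i, U z i * U z j * pd (ex i) φ z * U z j =
        ‖U z‖ ^ 2 * ∑ i, U z i * pd (ex i) φ z := by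
      rw [g0, Finset.sum_mul_sum]
      exact Finset.sum_congr rfl fun j _ ↦ Finset.sum_congr rfl fun i _ ↦ by ring
    have g3 : ∑ j, Q z * pd (ex j) φ z * U z j = Q z * ∑ i, U z i * pd (ex i) φ z := by
      rw [Finset.mul_sum]
      exact Finset.sum_congr rfl fun j _ ↦ by ring
    rw [g1, g2, g3]
    ring
  have s12 : Integrable (fun z ↦ ∑ j, U z j * pd et φ z * U z j +
      ∑ j, ∑ i, U z i * U z j * pd (ex i) φ z * U z j) (cylinder d) := s1.add s2
  simp only [hG]
  rw [integral_add (s12.const_mul 2⁻¹) s3, integral_const_mul, integral_add s1 s2,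
    integral_finsetSum _ fun j _ ↦ i1 j, integral_finsetSum _ fun j _ ↦ i3 j,
    integral_finsetSum _ fun j _ ↦ integrable_finsetSum _ fun i _ ↦ i2 j i]
  simp only [integral_finsetSum _ fun i _ ↦ i2 _ i]
  linarith

end Limit

end EulerTorus

theorem corollary4p1 (d : ℕ) (T : ℝ) (hT : 0 < T) (Φ : LittlewoodPaley d) (σ : ℝ)
    (hσ : 1 / 3 < σ) (u : ℝ → E d → E d) (hu : IsWeakEuler T u)
    (huB : Φ.MemLpBesov T σ 3 u) :
    (∃ q : ℝ → E d → ℝ, IsPressure T u q) ∧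
      ∀ q : ℝ → E d → ℝ, IsPressure T u q →
        ∀ φ : ℝ → E d → ℝ, IsTest T φ → duchonRobert T u q φ = 0 := by
  -- the Besov exponent may be lowered to `θ ∈ (1/3, 1)`
  obtain ⟨θ, hθ, hθσ⟩ : ∃ θ, 1 / 3 < θ ∧ θ < min σ 1 := exists_between (lt_min hσ (by norm_num))
  have hθ0 : 0 < θ := by linarith
  have hθ1 : θ ≤ 1 := (hθσ.trans_le (min_le_right _ _)).le
  obtain ⟨U, hU, hUu⟩ := exists_holderField Φ hθ0.le hθ1 (hθσ.trans_le (min_le_left _ _))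
    hu.periodic hu.memLp huB
  refine ⟨exists_isPressure Φ hθ0 hθ1 hU hUu, fun q hq φ hφ ↦ ?_⟩
  obtain ⟨Q, hQ, hQq⟩ := exists_eulerSystem Φ hu hU hUu hq
  obtain ⟨a, b, ha, hb, hφ'⟩ := hφ.cylTest
  rw [duchonRobert_eq hU hUu hQq hφ']
  exact hQ.integral_energy_eq_zero hθ ha hb hφ'
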